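/- For positive integers $n,M$ let $\mathcal D(n,M)$ denote the largest dimension of an affine subspace $C\subseteq\mathbb F_2^n$ such that, for some integer $0\le a\le M$, there is exactly one point $x_0\in C$ whose Hamming weight is congruent to $a$ modulo $M$. Then: 1. $\mathcal D(n,M)\le M-1$ for all $n\ge 1$, if $M$ is a power of $2$ (including $M=1$). 2. $\mathcal D(n,M)\le (M-1)\log_2(n+1)$ for all $n\ge 1$, if $M$ is an odd prime power. 3. $\mathcal D(n,M)\le 1+(M'-1)\log_2(n+1)$ for all $n\ge 1$, if $M=2M'$ for some odd prime power $M'$. 4. For every integer $\ell\ge 2$ there is a constant $C_\ell>0$, depending only on $\ell$, such that $\mathcal D(n,M)\le C_\ell\,(M'\log n)^{2^{\ell-1}-1}$ for all $n\ge 2$ and all $M=2^\ell M'$ with $M'$ an odd prime power. 5. Assume the Polynomial Freiman–Ruzsa (PFR) conjecture. Then for every positive integer $M$ there is a constant $c_M>0$, depending only on $M$, such that $\mathcal D(n,M)\le c_M\, n/\log n$ for all $n\ge 2$. Here the PFR conjecture is the statement that for every positive integer $m$ there is a constant $c=c(m)$ such that for every $r\ge 0$, every real $K$ and every nonempty $A\subseteq(\mathbb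 Z/m\mathbb Z)^r$ with $|A+A|\le K|A|$, the set $A$ is covered by at most $(2K)^{c}$ cosets of some subgroup $H\le(\mathbb Z/m\mathbb Z)^r$ with $|H|\le |A|$. -/

import Mathlib

open scoped Pointwise

/-- `C` is an affine subspace of `𝔽₂ⁿ` such that, for some residue `0 ≤ a ≤ M`, exactly one point
of `C` has Hamming weight congruent to `a` modulo `M`. -/
def HasUniqueWeightModPoint (n M : ℕ) (C : AffineSubspace (ZMod 2) (Fin n → ZMod 2)) : Prop :=
  ∃ a : ℕ, a ≤ M ∧ ∃! x : Fin n → ZMod 2, x ∈ C ∧ hammingNorm x ≡ a [MOD M]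

/-- The dimensions of the affine subspaces of `𝔽₂ⁿ` that have exactly one point of Hamming weight
congruent to `a` modulo `M`, for some `a`. -/
def uniqueWeightModDims (n M : ℕ) : Set ℕ :=
  {d | ∃ C : AffineSubspace (ZMod 2) (Fin n → ZMod 2),
    HasUniqueWeightModPoint n M C ∧ Module.finrank (ZMod 2) C.direction = d}

/-- `𝒟(n, M)`: the largest dimension of an affine subspace `C` of `𝔽₂ⁿ` such that, for some `a`,
there is exactly one point of `C` whose Hamming weight is congruent to `a` modulo `M`. -/
noncomputable def maxUniqueWeightModDim (n M : ℕ) : ℕ :=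
  sSup (uniqueWeightModDims n M)

/-- The maximum defining `𝒟(n, M)` exists and is attained. -/
theorem isGreatest_maxUniqueWeightModDim (n M : ℕ) :
    IsGreatest (uniqueWeightModDims n M) (maxUniqueWeightModDim n M) := by
  have hne : (uniqueWeightModDims n M).Nonempty := by
    refine ⟨_, AffineSubspace.mk' 0 ⊥, ⟨0, Nat.zero_le _, 0, ⟨?_, ?_⟩, ?_⟩, rfl⟩
    · exact AffineSubspace.self_mem_mk' _ _
    · rw [hammingNorm_zero]
    · rintro y ⟨hy, -⟩
      simpa [AffineSubspace.mem_mk'] using hy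
  have hbdd : BddAbove (uniqueWeightModDims n M) := by
    refine ⟨n, ?_⟩
    rintro d ⟨C, -, rfl⟩
    simpa using Submodule.finrank_le C.direction
  exact ⟨Nat.sSup_mem hne hbdd, fun d hd => le_csSup hbdd hd⟩

/-- The polynomial Freiman-Ruzsa conjecture over `ℤ/mℤ`: there is a constant `c`, depending only
on `m`, such that for every `r`, every nonempty `A ⊆ (ℤ/mℤ)ʳ` with `|A + A| ≤ K |A|` is covered by
at most `(2K)ᶜ` cosets of some subgroup `H` of `(ℤ/mℤ)ʳ` with `|H| ≤ |A|`. -/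
def PFRConjectureOver (m : ℕ) : Prop :=
  ∃ c : ℕ, ∀ (r : ℕ) (A : Finset (Fin r → ZMod m)) (K : ℝ), A.Nonempty →
    ((A + A).card : ℝ) ≤ K * (A.card : ℝ) →
    ∃ (H : AddSubgroup (Fin r → ZMod m)) (T : Finset (Fin r → ZMod m)),
      Nat.card H ≤ A.card ∧ (T.card : ℝ) ≤ (2 * K) ^ c ∧ ∀ x ∈ A, ∃ t ∈ T, x - t ∈ H

/-- The polynomial Freiman-Ruzsa conjecture: it holds over `ℤ/mℤ` for every positive integer `m`,
with a constant that may depend on `m`. -/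
def PFRConjecture : Prop :=
  ∀ m : ℕ, 0 < m → PFRConjectureOver m

/-! If `x₀` is the unique point of `C = x₀ + V` with its weight modulo `M`, then `v = 0` is the only
`v ∈ V` with `|x₀ + v| ≡ |x₀|`; everything is a bound on `dim V` for such a pair (`IsolatedWeight`).

Prime powers use the polynomial method. For `M = p ^ k` the indicator of `|x| ≡ a` is a polynomial
over `𝔽_p` of degree at most `M - 1` in the 0/1 coordinates: it is `M`-periodic in the weight, so
its Newton series stops before `M`, and `(|x| choose i)` is an elementary symmetric polynomial. If
`p = 2`, such a polynomial sums to zero over any coset of dimension at least `M`, but here the sum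
is 1. For general `p`, the translates of the indicator by `V` restrict to all the delta functions on
`x₀ + V`, so `2 ^ dim V` is at most the dimension of the space of polynomials of that degree.

For `M = 2 ^ ℓ M'` one passes to a large `W ≤ V` on which the weight modulo `2 ^ ℓ` is constant;
then `x₀` is isolated modulo `M'` in `x₀ + W`. For `ℓ = 1` this is one linear condition. In general
the weight modulo `2 ^ ℓ` is read off from the parities of `(|x| choose 2 ^ j)`, `j < ℓ`,
polynomials of degree at most `2 ^ (ℓ - 1)`, and `exists_submodule_const` extends `W` greedily by a
Chevalley–Warning argument applied to derivatives.

For general `M` under PFR: `|x + v|` is a linear form in `x` with coefficients `±1` plus `|v|`, so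
`V` yields a matching of size `2 ^ dim V` between elements and characters of `(ℤ/M)ⁿ⁺¹`. A large
matching forces a biased character sum on some subgroup `tH`. Approximate duality
(`exists_approx_duality`) turns bias into dense cosets of a subgroup of the dual of `tH` and of its
annihilator. The smaller of the two has order at most `√|tH|`; restricting the matching to its
preimage at least halves `log |tH|`. Summing the density losses through a potential gives `log` of
the matching size `O(n / log n)`.

Approximate duality repeatedly autocorrelates a weight on the large spectrum. The normalised `L²`
norm cannot keep dropping, so some stage has large additive energy; Balog–Szemerédi–Gowers and PFR
then supply the subgroup. -/

/-! ### Polynomial functions on the cube, filtered by degree. -/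

/-- The `l`-th coordinate of a point of `𝔽₂ⁿ`, as a `0/1`-valued function to `F`. -/
def bitFun (F : Type*) [Zero F] [One F] {n : ℕ} (l : Fin n) : (Fin n → ZMod 2) → F :=
  fun x => if x l ≠ 0 then 1 else 0

/-- The functions `𝔽₂ⁿ → F` that are affine in the `0/1`-valued coordinates. -/
def affineFuns (F : Type*) [Field F] (n : ℕ) : Submodule F ((Fin n → ZMod 2) → F) :=
  Submodule.span F (insert 1 (Set.range (bitFun F)))

/-- Translation of functions on `𝔽₂ⁿ`. -/
def translateHom (F : Type*) [Field F] {n : ℕ} (h : Fin n → ZMod 2) :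
    ((Fin n → ZMod 2) → F) →ₐ[F] ((Fin n → ZMod 2) → F) :=
  AlgHom.pi fun x => Pi.evalAlgHom F _ (x + h)

section Degree

variable {F : Type*} [Field F] {n : ℕ}

theorem translateHom_apply (h : Fin n → ZMod 2) (f : (Fin n → ZMod 2) → F) (x : Fin n → ZMod 2) :
    translateHom F h f x = f (x + h) := rfl

theorem one_mem_affineFuns : (1 : (Fin n → ZMod 2) → F) ∈ affineFuns F n :=
  Submodule.subset_span (Set.mem_insert _ _)

theorem bitFun_mem_affineFuns (l : Fin n) : bitFun F l ∈ affineFuns F n :=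
  Submodule.subset_span (Set.mem_insert_of_mem _ ⟨l, rfl⟩)

theorem affineFuns_pow_mono {i j : ℕ} (hij : i ≤ j) : affineFuns F n ^ i ≤ affineFuns F n ^ j :=
  pow_le_pow_right₀ (Submodule.one_le.2 one_mem_affineFuns) hij

theorem prod_mem_affineFuns_pow {ι : Type*} (s : Finset ι) (k : ℕ)
    (f : ι → (Fin n → ZMod 2) → F) (hf : ∀ i ∈ s, f i ∈ affineFuns F n ^ k) :
    ∏ i ∈ s, f i ∈ affineFuns F n ^ (k * s.card) := by
  classical
  induction s using Finset.induction_on with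
  | empty => simp [Submodule.one_le.1 le_rfl]
  | insert a s ha ih =>
    rw [Finset.prod_insert ha, Finset.card_insert_of_notMem ha, mul_add, mul_one, add_comm, pow_add]
    exact Submodule.mul_mem_mul (hf a (Finset.mem_insert_self _ _))
      (ih fun i hi => hf i (Finset.mem_insert_of_mem hi))

/-- `(|x| choose i)` counts the `i`-subsets of the support of `x`, so it is the `i`-th elementary
symmetric polynomial in the bits. -/
theorem choose_hammingNorm_mem (i : ℕ) :
    (fun x : Fin n → ZMod 2 => (((hammingNorm x).choose i : ℕ) : F)) ∈ affineFuns F n ^ i := by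
  classical
  have h : (fun x : Fin n → ZMod 2 => (((hammingNorm x).choose i : ℕ) : F)) =
      ∑ s ∈ Finset.powersetCard i Finset.univ, ∏ l ∈ s, bitFun F (n := n) l := by
    funext x
    rw [Finset.sum_apply]
    simp only [Finset.prod_apply, bitFun, Finset.prod_ite_zero, Finset.prod_const_one]
    rw [Finset.sum_boole, hammingNorm, ← Finset.card_powersetCard]
    congr 2
    ext s
    simp only [Finset.mem_powersetCard, Finset.mem_filter, Finset.subset_univ, true_and]
    constructor
    · rintro ⟨h1, h2⟩
      exact ⟨h2, fun l hl => by simpa using h1 hl⟩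
    · rintro ⟨h1, h2⟩
      exact ⟨fun l hl => by simpa using h2 l hl, h1⟩
  rw [h]
  refine Submodule.sum_mem _ fun s hs => ?_
  have := prod_mem_affineFuns_pow s 1 (fun l => bitFun F (n := n) l)
    (fun l _ => by simpa using bitFun_mem_affineFuns l)
  rwa [one_mul, (Finset.mem_powersetCard.1 hs).2] at this

/-- Translation is an algebra map that fixes each bit `b` or replaces it by `1 - b`, so it preserves
degree. -/
theorem translateHom_mem {k : ℕ} (h : Fin n → ZMod 2) {f : (Fin n → ZMod 2) → F}
    (hf : f ∈ affineFuns F n ^ k) : translateHom F h f ∈ affineFuns F n ^ k := by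
  have h1 : (affineFuns F n).map (translateHom F h).toLinearMap ≤ affineFuns F n := by
    rw [affineFuns, Submodule.map_span_le]
    rintro g (rfl | ⟨l, rfl⟩)
    · rw [AlgHom.toLinearMap_apply, map_one]
      exact one_mem_affineFuns
    · have : ∀ y : ZMod 2, h l = y → (translateHom F h).toLinearMap (bitFun F l) ∈ affineFuns F n := by
        intro y hy
        fin_cases y
        · convert bitFun_mem_affineFuns (F := F) l using 1
          funext x
          have : h l = 0 := hy
          simp [translateHom_apply, bitFun, this]
        · convert Submodule.sub_mem _ one_mem_affineFuns (bitFun_mem_affineFuns (F := F) l) using 1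
          funext x
          have : h l = 1 := hy
          have h2 : ∀ y : ZMod 2, (if y + 1 ≠ 0 then (1 : F) else 0) = 1 - if y ≠ 0 then 1 else 0 := by
            intro y
            by_cases hy : y = 0
            · simp [hy]
            · have h1 : ∀ z : ZMod 2, z ≠ 0 → z + 1 = 0 := by decide
              simp [hy, h1 y hy]
          simpa [translateHom_apply, bitFun, this] using h2 (x l)
      exact this _ rfl
  have h2 : (affineFuns F n ^ k).map (translateHom F h).toLinearMap ≤ affineFuns F n ^ k := by
    rw [Submodule.map_pow]
    exact pow_le_pow_left' h1 k
  exact h2 (Submodule.mem_map_of_mem hf)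

theorem finrank_affineFuns_pow_le (k : ℕ) :
    Module.finrank F (affineFuns F n ^ k : Submodule F ((Fin n → ZMod 2) → F)) ≤ (n + 1) ^ k := by
  classical
  have h : affineFuns F n = Submodule.span F
      ((insert 1 (Finset.univ.image (bitFun F)) : Finset ((Fin n → ZMod 2) → F)) : Set _) := by
    simp [affineFuns]
  rw [h, Submodule.span_pow, ← Finset.coe_pow]
  refine (finrank_span_finset_le_card _).trans (Finset.card_pow_le.trans ?_)
  gcongr
  refine (Finset.card_insert_le _ _).trans ?_
  gcongr
  exact Finset.card_image_le.trans (by simp)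

end Degree

/-! ### Coset sums and derivatives over `𝔽₂`. -/

theorem finrank_le_finrank_inf_ker_add_one {K E : Type*} [Field K] [AddCommGroup E] [Module K E]
    [FiniteDimensional K E] (V : Submodule K E) (φ : E →ₗ[K] K) :
    Module.finrank K V ≤ Module.finrank K (V ⊓ LinearMap.ker φ : Submodule K E) + 1 := by
  have h1 := Submodule.finrank_sup_add_finrank_inf_eq V (LinearMap.ker φ)
  have h2 := LinearMap.finrank_range_add_finrank_ker φ
  have h3 : Module.finrank K (LinearMap.range φ) ≤ 1 := by
    simpa using Submodule.finrank_le (LinearMap.range φ)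
  have h4 := Submodule.finrank_le (V ⊔ LinearMap.ker φ)
  omega

/-- A polynomial over `𝔽₂` of degree less than the dimension of an affine subspace sums to zero
over that subspace. -/
theorem sum_coset_eq_zero {n k : ℕ} {f : (Fin n → ZMod 2) → ZMod 2}
    (hf : f ∈ affineFuns (ZMod 2) n ^ k) (V : Submodule (ZMod 2) (Fin n → ZMod 2))
    (hV : k < Module.finrank (ZMod 2) V) (x : Fin n → ZMod 2) [Fintype V] :
    ∑ v : V, f (x + v) = 0 := by
  -- A monomial of degree `k` is invariant under the subspace of `V` where its `k` factors vanish,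
  -- of codimension at most `k`. Any nonzero `u` in it pairs `v` with `v + u`, and the paired terms
  -- cancel.
  have key : ∀ k : ℕ, ∀ g ∈ (insert 1 (Set.range (bitFun (ZMod 2) (n := n)))) ^ k,
      ∃ U ≤ V, Module.finrank (ZMod 2) V ≤ Module.finrank (ZMod 2) U + k ∧
        ∀ u ∈ U, ∀ y, g (y + u) = g y := by
    intro k
    induction k with
    | zero =>
      intro g hg
      refine ⟨V, le_rfl, le_rfl, fun u _ y => ?_⟩
      rw [pow_zero, Set.mem_one] at hg
      simp [hg]
    | succ k ih =>
      intro g hg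
      rw [pow_succ, Set.mem_mul] at hg
      obtain ⟨a, ha, b, hb, rfl⟩ := hg
      obtain ⟨U, hUV, hU, hinv⟩ := ih a ha
      rcases hb with rfl | ⟨l, rfl⟩
      · exact ⟨U, hUV, by omega, by simpa using hinv⟩
      · refine ⟨U ⊓ LinearMap.ker (LinearMap.proj l), inf_le_left.trans hUV, ?_, ?_⟩
        · have := finrank_le_finrank_inf_ker_add_one U
            (LinearMap.proj l : (Fin n → ZMod 2) →ₗ[ZMod 2] ZMod 2)
          omega
        · rintro u ⟨hu, hul⟩ y
          have : u l = 0 := hul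
          simp [hinv u hu y, bitFun, this]
  rw [affineFuns, Submodule.span_pow] at hf
  induction hf using Submodule.span_induction with
  | zero => simp
  | add a b _ _ ha hb => simp [Finset.sum_add_distrib, ha, hb]
  | smul c a _ ha => simp [← Finset.mul_sum, ha]
  | mem g hg =>
    obtain ⟨U, hUV, hU, hinv⟩ := key k g hg
    have hpos : 0 < Module.finrank (ZMod 2) U := by omega
    obtain ⟨u, hu0⟩ := Module.finrank_pos_iff_exists_ne_zero.1 hpos
    have hchar : ∀ z : ZMod 2, z + z = 0 := by decide
    have huu : (u : Fin n → ZMod 2) + u = 0 := funext fun i => hchar _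
    refine Finset.sum_involution (fun v _ => v + ⟨u, hUV u.2⟩) ?_ ?_ ?_ ?_
    · intro v _
      simp only [Submodule.coe_add, ← add_assoc]
      rw [hinv u u.2, hchar]
    · intro v _ _ h
      apply hu0
      have := add_eq_left.1 h
      exact Subtype.ext (congrArg (fun w : V => (w : Fin n → ZMod 2)) this)
    · simp
    · intro v _
      apply Subtype.ext
      simp [add_assoc, huu]

/-- The derivative of a function on `𝔽₂ⁿ` in characteristic two. -/
def char2Deriv {n : ℕ} (h : Fin n → ZMod 2) (f : (Fin n → ZMod 2) → ZMod 2) :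
    (Fin n → ZMod 2) → ZMod 2 :=
  f + translateHom (ZMod 2) h f

/-- Leibniz rule: `D(ab) = Da · Tb + a · Db` with `T` the translation. At `k = 0` the truncated `k -
1` is harmless, since constants have zero derivative. -/
theorem char2Deriv_mem {n k : ℕ} (h : Fin n → ZMod 2) {f : (Fin n → ZMod 2) → ZMod 2}
    (hf : f ∈ affineFuns (ZMod 2) n ^ k) : char2Deriv h f ∈ affineFuns (ZMod 2) n ^ (k - 1) := by
  have hchar : ∀ z : ZMod 2, z + z = 0 := by decide
  rcases k with _ | k
  · rw [pow_zero, Submodule.mem_one] at hf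
    obtain ⟨c, rfl⟩ := hf
    have : char2Deriv h (algebraMap (ZMod 2) ((Fin n → ZMod 2) → ZMod 2) c) = 0 := by
      funext x
      simp [char2Deriv, hchar]
    rw [this]
    exact Submodule.zero_mem _
  rw [Nat.add_sub_cancel]
  have hlin : ∀ f ∈ affineFuns (ZMod 2) n,
      char2Deriv h f ∈ (1 : Submodule (ZMod 2) ((Fin n → ZMod 2) → ZMod 2)) := by
    intro f hf
    induction hf using Submodule.span_induction with
    | zero =>
      convert Submodule.zero_mem _
      funext x; simp [char2Deriv]
    | add a b _ _ ha hb =>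
      convert Submodule.add_mem _ ha hb using 1
      simp only [char2Deriv, map_add]; ring
    | smul c a _ ha =>
      convert Submodule.smul_mem _ c ha using 1
      simp only [char2Deriv, map_smul, smul_add]
    | mem g hg =>
      rcases hg with rfl | ⟨l, rfl⟩
      · convert Submodule.zero_mem _
        funext x; simp [char2Deriv, hchar]
      · rw [Submodule.mem_one]
        refine ⟨h l, funext fun x => ?_⟩
        have : ∀ y z : ZMod 2, z = (if y ≠ 0 then (1 : ZMod 2) else 0) +
          (if y + z ≠ 0 then (1 : ZMod 2) else 0) := by decide
        simpa [char2Deriv, translateHom_apply, bitFun] using this (x l) (h l)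
  induction k generalizing f with
  | zero => simpa using hlin f (by simpa using hf)
  | succ k ih =>
    rw [pow_succ] at hf
    induction hf using Submodule.mul_induction_on' with
    | mem_mul_mem a ha b hb =>
      have : char2Deriv h (a * b) = char2Deriv h a * translateHom (ZMod 2) h b +
          a * char2Deriv h b := by
        simp only [char2Deriv, map_mul]
        have : a * translateHom (ZMod 2) h b + a * translateHom (ZMod 2) h b = 0 :=
          funext fun _ => hchar _
        linear_combination -this
      rw [this]
      refine Submodule.add_mem _ ?_ ?_
      · rw [pow_succ]
        refine Submodule.mul_mem_mul (ih ha) ?_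
        have := translateHom_mem (k := 1) h (f := b) (by simpa using hb)
        simpa using this
      · have := Submodule.mul_mem_mul ha (hlin b hb)
        simpa using this
    | add a _ b _ ha hb =>
      convert Submodule.add_mem _ ha hb using 1
      simp only [char2Deriv, map_add]; ring

/-! ### Newton series of periodic functions and Lucas' theorem. -/

/-- In characteristic `p`, with `E` the shift, `(E - 1) ^ (p ^ k) = E ^ (p ^ k) - 1`, which kills
`g`. So all forward differences of order at least `p ^ k` vanish and the Newton series at 0 is
finite. -/
theorem exists_sum_choose_of_periodic {F : Type*} [Field F] (p : ℕ) [Fact p.Prime] [CharP F p]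
    (k : ℕ) (g : ℕ → F) (hg : ∀ w, g (w + p ^ k) = g w) :
    ∃ c : ℕ → F, ∀ w, g w = ∑ i ∈ Finset.range (p ^ k), c i * (w.choose i : F) := by
  have hp : p.Prime := Fact.out
  have hpos : 0 < p ^ k := pow_pos hp.pos k
  have h0 : (fwdDiff 1)^[p ^ k] g = 0 := by
    funext y
    have h := shift_eq_sum_fwdDiff_iter (M := ℕ) 1 g (p ^ k) y
    rw [smul_eq_mul, mul_one, hg, Finset.sum_range_succ, ← Nat.succ_pred_eq_of_pos hpos,
      Finset.sum_range_succ', Nat.succ_pred_eq_of_pos hpos, Finset.sum_eq_zero] at h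
    · simpa using h
    · intro i hi
      have hi' := Finset.mem_range.1 hi
      have hdvd : p ∣ (p ^ k).choose (i + 1) :=
        hp.dvd_choose_pow (by omega) (by have := Nat.pred_lt hpos.ne'; omega)
      rw [nsmul_eq_mul, (CharP.cast_eq_zero_iff F p _).2 hdvd, zero_mul]
  have h1 : ∀ i, p ^ k ≤ i → (fwdDiff 1)^[i] g = 0 := by
    intro i hi
    obtain ⟨j, rfl⟩ := Nat.exists_eq_add_of_le hi
    rw [add_comm, Function.iterate_add_apply, h0]
    clear hi
    induction j with
    | zero => rfl
    | succ j ih =>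
      rw [Function.iterate_succ_apply', ih]
      funext y
      simp [fwdDiff]
  refine ⟨fun i => (fwdDiff 1)^[i] g 0, fun w => ?_⟩
  have h := shift_eq_sum_fwdDiff_iter (M := ℕ) 1 g w 0
  simp only [zero_add, smul_eq_mul, mul_one, nsmul_eq_mul] at h
  rw [h]
  rcases le_total (w + 1) (p ^ k) with hw | hw
  · rw [← Finset.sum_subset (Finset.range_mono hw)]
    · exact Finset.sum_congr rfl fun i _ => mul_comm _ _
    · intro i _ hi
      rw [Nat.choose_eq_zero_of_lt (by simpa using hi)]
      simp
  · rw [← Finset.sum_subset (Finset.range_mono hw)]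
    · exact Finset.sum_congr rfl fun i _ => mul_comm _ _
    · intro i _ hi
      rw [h1 i (by simpa using hi)]
      simp

theorem ite_modEq_mem_affineFuns_pow {F : Type*} [Field F] (p : ℕ) [Fact p.Prime] [CharP F p]
    (k n a : ℕ) :
    (fun x : Fin n → ZMod 2 => if hammingNorm x ≡ a [MOD p ^ k] then (1 : F) else 0) ∈
      affineFuns F n ^ (p ^ k - 1) := by
  obtain ⟨c, hc⟩ := exists_sum_choose_of_periodic p k
    (fun w => if w ≡ a [MOD p ^ k] then (1 : F) else 0) (fun w => by
      have : w + p ^ k ≡ a [MOD p ^ k] ↔ w ≡ a [MOD p ^ k] := by simp [Nat.ModEq]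
      simp only [this])
  have : (fun x : Fin n → ZMod 2 => if hammingNorm x ≡ a [MOD p ^ k] then (1 : F) else 0) =
      ∑ i ∈ Finset.range (p ^ k),
        c i • fun x : Fin n → ZMod 2 => (((hammingNorm x).choose i : ℕ) : F) := by
    funext x
    rw [hc (hammingNorm x), Finset.sum_apply]
    rfl
  rw [this]
  refine Submodule.sum_mem _ fun i hi => Submodule.smul_mem _ _ ?_
  exact affineFuns_pow_mono (by have := Finset.mem_range.1 hi; omega) (choose_hammingNorm_mem i)

theorem odd_choose_two_pow_succ (w j : ℕ) :
    w.choose (2 ^ (j + 1)) ≡ (w / 2).choose (2 ^ j) [MOD 2] := by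
  have := Choose.choose_modEq_choose_mod_mul_choose_div_nat (p := 2) (n := w) (k := 2 ^ (j + 1))
  rwa [pow_succ, Nat.mul_mod_left, Nat.mul_div_cancel _ two_pos, Nat.choose_zero_right,
    one_mul] at this

/-- By Lucas, the parity of `w.choose (2 ^ j)` is the `j`-th binary digit of `w`; the induction
strips the lowest digit. -/
theorem modEq_two_pow_of_choose {w a ℓ : ℕ}
    (h : ∀ j < ℓ, w.choose (2 ^ j) ≡ a.choose (2 ^ j) [MOD 2]) : w ≡ a [MOD 2 ^ ℓ] := by
  induction ℓ generalizing w a with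
  | zero => simp [Nat.modEq_one]
  | succ ℓ ih =>
    have h0 : w ≡ a [MOD 2] := by simpa using h 0 (Nat.succ_pos _)
    have h1 : w / 2 ≡ a / 2 [MOD 2 ^ ℓ] := ih fun j hj =>
      ((odd_choose_two_pow_succ w j).symm.trans (h (j + 1) (by omega))).trans
        (odd_choose_two_pow_succ a j)
    have h2 := h1.mul_left' 2
    rw [← pow_succ'] at h2
    have h3 : 2 * (w / 2) + w % 2 ≡ 2 * (a / 2) + a % 2 [MOD 2 ^ (ℓ + 1)] := by
      rw [show w % 2 = a % 2 from h0]
      exact h2.add_right _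
    rwa [Nat.div_add_mod, Nat.div_add_mod] at h3

/-! ### Isolated weights: polynomial bounds for `M` a prime power or twice an odd one. -/

/-- In `x₀ + V`, the point `x₀` is the only one whose weight is congruent to its own weight. -/
def IsolatedWeight {n : ℕ} (M : ℕ) (x₀ : Fin n → ZMod 2)
    (V : Submodule (ZMod 2) (Fin n → ZMod 2)) : Prop :=
  ∀ v ∈ V, hammingNorm (x₀ + v) ≡ hammingNorm x₀ [MOD M] → v = 0

theorem exists_isolatedWeight {n M : ℕ} :
    ∃ (x₀ : Fin n → ZMod 2) (V : Submodule (ZMod 2) (Fin n → ZMod 2)),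
      IsolatedWeight M x₀ V ∧ Module.finrank (ZMod 2) V = maxUniqueWeightModDim n M := by
  obtain ⟨C, ⟨a, _, x, ⟨hxC, hxa⟩, huniq⟩, hC⟩ := (isGreatest_maxUniqueWeightModDim n M).1
  refine ⟨x, C.direction, fun v hv hmod => ?_, hC⟩
  have hvC : x + v ∈ C := by
    rw [add_comm]
    exact AffineSubspace.vadd_mem_of_mem_direction hv hxC
  simpa using huniq (x + v) ⟨hvC, hmod.trans hxa⟩

section Bounds

variable {n : ℕ} {x₀ : Fin n → ZMod 2} {V : Submodule (ZMod 2) (Fin n → ZMod 2)}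

/-- The indicator of the residue of `x₀` has degree below `dim V` if the bound fails, yet its sum
over `x₀ + V` has exactly one nonzero term. -/
theorem IsolatedWeight.finrank_le_two_pow {k : ℕ} (h : IsolatedWeight (2 ^ k) x₀ V) :
    Module.finrank (ZMod 2) V ≤ 2 ^ k - 1 := by
  classical
  by_contra! hlt
  have := sum_coset_eq_zero
    (ite_modEq_mem_affineFuns_pow (F := ZMod 2) 2 k n (hammingNorm x₀)) V hlt x₀
  rw [Finset.sum_eq_single 0] at this
  · simp [Nat.ModEq.refl] at this
  · intro v _ hv
    rw [if_neg]
    exact fun hmod => hv (Subtype.ext (h v v.2 hmod))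
  · simp

theorem IsolatedWeight.two_pow_finrank_le {p k : ℕ} (hp : p.Prime)
    (h : IsolatedWeight (p ^ k) x₀ V) :
    2 ^ Module.finrank (ZMod 2) V ≤ (n + 1) ^ (p ^ k - 1) := by
  classical
  have := Fact.mk hp
  set B := affineFuns (ZMod p) n ^ (p ^ k - 1) with hB
  set f : (Fin n → ZMod 2) → ZMod p :=
    fun x => if hammingNorm x ≡ hammingNorm x₀ [MOD p ^ k] then 1 else 0 with hf
  have hfB : f ∈ B := ite_modEq_mem_affineFuns_pow p k n _
  let R : ((Fin n → ZMod 2) → ZMod p) →ₗ[ZMod p] (V → ZMod p) :=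
    LinearMap.funLeft _ _ fun v : V => x₀ + v
  -- Translating the indicator `f` by `-v` gives on `x₀ + V` the delta function at `x₀ + v`, so
  -- low-degree functions restrict onto all functions on the coset.
  have htop : B.map R = ⊤ := by
    rw [eq_top_iff]
    intro g _
    have : g = ∑ v : V, g v • R (translateHom (ZMod p) (-(v : Fin n → ZMod 2)) f) := by
      funext u
      rw [Finset.sum_apply, Finset.sum_eq_single u]
      · simp [R, LinearMap.funLeft_apply, translateHom_apply, hf, Nat.ModEq.refl]
      · intro v _ hv
        have : f (x₀ + u + -v) = 0 := by
          rw [hf]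
          refine if_neg fun hmod => hv ?_
          rw [add_assoc] at hmod
          have := h _ (V.add_mem u.2 (V.neg_mem v.2)) hmod
          exact (Subtype.ext (add_neg_eq_zero.1 this)).symm
        simp [R, LinearMap.funLeft_apply, translateHom_apply, this]
      · simp
    rw [this]
    exact Submodule.sum_mem _ fun v _ => Submodule.smul_mem _ _
      (Submodule.mem_map_of_mem (translateHom_mem _ hfB))
  have h1 : Module.finrank (ZMod p) (B.map R) = 2 ^ Module.finrank (ZMod 2) V := by
    rw [htop, finrank_top, Module.finrank_fintype_fun_eq_card, Module.card_eq_pow_finrank (K := ZMod 2)]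
    simp
  rw [← h1]
  exact (Submodule.finrank_map_le R B).trans (finrank_affineFuns_pow_le _)

theorem IsolatedWeight.finrank_le_logb {M : ℕ} (hM : IsPrimePow M) (h : IsolatedWeight M x₀ V) :
    (Module.finrank (ZMod 2) V : ℝ) ≤ ((M : ℝ) - 1) * Real.logb 2 ((n : ℝ) + 1) := by
  obtain ⟨p, k, hp, _, rfl⟩ := (isPrimePow_nat_iff M).1 hM
  have h1 := h.two_pow_finrank_le hp
  have hpos : 1 ≤ p ^ k := Nat.one_le_pow _ _ hp.pos
  have h2 : (2 : ℝ) ^ Module.finrank (ZMod 2) V ≤ ((n : ℝ) + 1) ^ (p ^ k - 1) := by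
    exact_mod_cast h1
  have h3 := Real.logb_le_logb_of_le one_lt_two (by positivity) h2
  rw [Real.logb_pow, Real.logb_pow, Real.logb_self_eq_one one_lt_two, mul_one,
    Nat.cast_sub hpos] at h3
  simpa using h3

theorem IsolatedWeight.mono {M : ℕ} (h : IsolatedWeight M x₀ V)
    {W : Submodule (ZMod 2) (Fin n → ZMod 2)} (hW : W ≤ V) : IsolatedWeight M x₀ W :=
  fun v hv => h v (hW hv)

theorem IsolatedWeight.of_mul {M N : ℕ} (hMN : N.Coprime M) (h : IsolatedWeight (N * M) x₀ V)
    (hN : ∀ v ∈ V, hammingNorm (x₀ + v) ≡ hammingNorm x₀ [MOD N]) : IsolatedWeight M x₀ V :=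
  fun v hv hmod => h v hv ((Nat.modEq_and_modEq_iff_modEq_mul hMN).1 ⟨hN v hv, hmod⟩)

theorem hammingNorm_cast_eq_sum (x : Fin n → ZMod 2) : (hammingNorm x : ZMod 2) = ∑ i, x i := by
  rw [hammingNorm, ← Finset.sum_boole]
  refine Finset.sum_congr rfl fun i _ => ?_
  have : ∀ y : ZMod 2, (if y ≠ 0 then (1 : ZMod 2) else 0) = y := by decide
  exact this _

/-- Weight modulo 2 is linear, so on the hyperplane section where coordinates sum to zero the parity
is fixed and isolation modulo `2 * M` becomes isolation modulo `M`. -/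
theorem IsolatedWeight.finrank_le_one_add_logb {M : ℕ} (hodd : Odd M) (hM : IsPrimePow M)
    (h : IsolatedWeight (2 * M) x₀ V) :
    (Module.finrank (ZMod 2) V : ℝ) ≤ 1 + ((M : ℝ) - 1) * Real.logb 2 ((n : ℝ) + 1) := by
  let φ : (Fin n → ZMod 2) →ₗ[ZMod 2] ZMod 2 := ∑ i, LinearMap.proj i
  have h1 := finrank_le_finrank_inf_ker_add_one V φ
  have h2 : IsolatedWeight M x₀ (V ⊓ LinearMap.ker φ) := by
    refine (h.mono inf_le_left).of_mul (Nat.coprime_two_left.2 hodd) ?_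
    rintro v ⟨_, hv⟩
    have hv' : ∑ i, v i = 0 := by simpa [φ] using hv
    rw [← ZMod.natCast_eq_natCast_iff, hammingNorm_cast_eq_sum, hammingNorm_cast_eq_sum]
    simp [Finset.sum_add_distrib, hv']
  have h3 := h2.finrank_le_logb hM
  have h4 : (Module.finrank (ZMod 2) V : ℝ) ≤
    Module.finrank (ZMod 2) (V ⊓ LinearMap.ker φ : Submodule _ _) + 1 := by exact_mod_cast h1
  linarith

end Bounds

/-! ### Subspaces on which low-degree functions are constant; the factor `2 ^ ℓ`. -/

/-- The iterated derivative of `f` in the directions `Δ i`, `i ∈ S`. -/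
def multiDeriv {n : ℕ} {ι : Type*} (Δ : ι → Fin n → ZMod 2) (S : Finset ι)
    (f : (Fin n → ZMod 2) → ZMod 2) : (Fin n → ZMod 2) → ZMod 2 :=
  fun x => ∑ T ∈ S.powerset, f (x + ∑ i ∈ T, Δ i)

section MultiDeriv

variable {n : ℕ} {ι : Type*} [DecidableEq ι] (Δ : ι → Fin n → ZMod 2)
  (f : (Fin n → ZMod 2) → ZMod 2)

theorem multiDeriv_insert {a : ι} {S : Finset ι} (ha : a ∉ S) :
    multiDeriv Δ (insert a S) f = char2Deriv (Δ a) (multiDeriv Δ S f) := by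
  funext x
  simp only [multiDeriv, char2Deriv, Pi.add_apply, translateHom_apply]
  rw [Finset.sum_powerset_insert ha]
  congr 1
  refine Finset.sum_congr rfl fun T hT => ?_
  rw [Finset.sum_insert fun h => ha (Finset.mem_powerset.1 hT h), add_assoc]

theorem multiDeriv_mem {k : ℕ} (hf : f ∈ affineFuns (ZMod 2) n ^ k) (S : Finset ι) :
    multiDeriv Δ S f ∈ affineFuns (ZMod 2) n ^ (k - S.card) := by
  induction S using Finset.induction_on with
  | empty =>
    have : multiDeriv Δ ∅ f = f := by
      funext x
      simp [multiDeriv]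
    simpa [this] using hf
  | insert a S ha ih =>
    rw [multiDeriv_insert Δ f ha, Finset.card_insert_of_notMem ha, ← Nat.sub_sub]
    exact char2Deriv_mem _ ih

theorem multiDeriv_eq_of_le_card {k : ℕ} (hf : f ∈ affineFuns (ZMod 2) n ^ k) {S : Finset ι}
    (hS : k ≤ S.card) (x y : Fin n → ZMod 2) : multiDeriv Δ S f x = multiDeriv Δ S f y := by
  have := multiDeriv_mem Δ f hf S
  rw [Nat.sub_eq_zero_of_le hS, pow_zero, Submodule.mem_one] at this
  obtain ⟨c, hc⟩ := this
  rw [← hc]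
  rfl

/-- Translation by `Δ i` is `1 + D_i`; the identity expands the product of these operators over `T`.
-/
theorem apply_add_sum_eq_sum_multiDeriv (T : Finset ι) (x : Fin n → ZMod 2) :
    f (x + ∑ i ∈ T, Δ i) = ∑ S ∈ T.powerset, multiDeriv Δ S f x := by
  have hchar : ∀ z : ZMod 2, z + z = 0 := by decide
  induction T using Finset.induction_on generalizing x with
  | empty => simp [multiDeriv]
  | insert a T ha ih =>
    rw [Finset.sum_insert ha, ← add_assoc, ih, Finset.sum_powerset_insert ha,
      ← Finset.sum_add_distrib]
    refine Finset.sum_congr rfl fun S hS => ?_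
    rw [multiDeriv_insert Δ f fun h => ha (Finset.mem_powerset.1 hS h)]
    simp only [char2Deriv, Pi.add_apply, translateHom_apply]
    rw [← add_assoc, hchar, zero_add]

end MultiDeriv

theorem card_filter_card_lt_le (d k : ℕ) (hk : 1 ≤ k) :
    (Finset.univ.filter fun S : Finset (Fin d) => S.card < k).card ≤ k * (d + 1) ^ (k - 1) := by
  have h : (Finset.univ.filter fun S : Finset (Fin d) => S.card < k) ⊆
      (Finset.range k).biUnion fun s => Finset.powersetCard s Finset.univ := by
    intro S hS
    simpa using hS
  refine (Finset.card_le_card h).trans (Finset.card_biUnion_le.trans ?_)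
  calc ∑ s ∈ Finset.range k, (Finset.powersetCard s (Finset.univ : Finset (Fin d))).card
      ≤ ∑ s ∈ Finset.range k, (d + 1) ^ (k - 1) := by
        refine Finset.sum_le_sum fun s hs => ?_
        rw [Finset.card_powersetCard, Finset.card_univ, Fintype.card_fin]
        have hs' := Finset.mem_range.1 hs
        exact (Nat.choose_le_pow d s).trans ((Nat.pow_le_pow_left (Nat.le_succ d) s).trans
          (Nat.pow_le_pow_right (Nat.succ_pos d) (by omega)))
    _ = k * (d + 1) ^ (k - 1) := by simp

/-- Functions of degree at most `k` on `x₀ + V` are simultaneously constant on `x₀ + W` for some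
large subspace `W`. -/
theorem exists_submodule_const {n k ℓ : ℕ} (hk : 1 ≤ k)
    (f : Fin ℓ → (Fin n → ZMod 2) → ZMod 2) (hf : ∀ j, f j ∈ affineFuns (ZMod 2) n ^ k)
    (x₀ : Fin n → ZMod 2) (V : Submodule (ZMod 2) (Fin n → ZMod 2)) :
    ∃ W ≤ V, (∀ j, ∀ w ∈ W, f j (x₀ + w) = f j x₀) ∧
      Module.finrank (ZMod 2) V ≤ Module.finrank (ZMod 2) W +
        k * (ℓ * (k * (Module.finrank (ZMod 2) W + 1) ^ (k - 1))) := by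
  classical
  -- `W` has maximal dimension. If the bound fails, a complement `U` of `W` in `V` is large enough
  -- to contain a vector that enlarges `W`.
  obtain ⟨W, ⟨hWV, hWf⟩, hmax⟩ := Set.exists_max_image
    {W : Submodule (ZMod 2) (Fin n → ZMod 2) | W ≤ V ∧ ∀ j, ∀ w ∈ W, f j (x₀ + w) = f j x₀}
    (fun W => Module.finrank (ZMod 2) W) (Set.toFinite _) ⟨⊥, bot_le, by simp⟩
  refine ⟨W, hWV, hWf, ?_⟩
  by_contra! hlt
  set d := Module.finrank (ZMod 2) W with hd
  obtain ⟨U', hU'⟩ := Submodule.exists_isCompl (W.comap V.subtype)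
  set U := U'.map V.subtype with hU
  have hUV : U ≤ V := Submodule.map_subtype_le _ _
  have hWU : W ⊓ U = ⊥ := by
    rw [eq_bot_iff]
    rintro y ⟨hyW, u, huU, rfl⟩
    have : u ∈ (W.comap V.subtype) ⊓ U' := ⟨hyW, huU⟩
    rw [hU'.inf_eq_bot] at this
    simpa using this
  have hrank : Module.finrank (ZMod 2) V = d + Module.finrank (ZMod 2) U := by
    rw [← Submodule.finrank_add_eq_of_isCompl hU', hU, Submodule.finrank_map_subtype_eq,
      (Submodule.comapSubtypeEquivOfLe hWV).finrank_eq]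
  let b := Module.finBasis (ZMod 2) W
  let Δ : Fin d → Fin n → ZMod 2 := fun i => b i
  have hspan : ∀ w ∈ W, ∃ T : Finset (Fin d), w = ∑ i ∈ T, Δ i := by
    intro w hw
    refine ⟨Finset.univ.filter fun i => b.repr ⟨w, hw⟩ i = 1, ?_⟩
    have h1 := congrArg (Subtype.val) (b.sum_repr ⟨w, hw⟩)
    simp only [Submodule.coe_sum, Submodule.coe_smul] at h1
    refine h1.symm.trans ?_
    rw [Finset.sum_filter]
    refine Finset.sum_congr rfl fun i _ => ?_
    have : ∀ z : ZMod 2, ∀ y : Fin n → ZMod 2, z • y = if z = 1 then y else 0 := by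
      intro z y
      have hz : z = 0 ∨ z = 1 := by revert z; decide
      rcases hz with rfl | rfl <;> simp
    exact this _ _
  let I : Finset (Fin ℓ × Finset (Fin d)) :=
    Finset.univ ×ˢ Finset.univ.filter fun S => S.card < k
  -- The product of the `g q` over `I` is the indicator that all derivatives of order below `k`
  -- along the basis of `W` take the same values as at `x₀`. Each factor has degree at most `k`.
  let g : Fin ℓ × Finset (Fin d) → (Fin n → ZMod 2) → ZMod 2 := fun q =>
    multiDeriv Δ q.2 (f q.1) + algebraMap (ZMod 2) _ (1 + multiDeriv Δ q.2 (f q.1) x₀)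
  have hg : ∀ q ∈ I, g q ∈ affineFuns (ZMod 2) n ^ k := fun q _ =>
    Submodule.add_mem _ (affineFuns_pow_mono (Nat.sub_le _ _) (multiDeriv_mem Δ _ (hf q.1) q.2))
      (affineFuns_pow_mono (Nat.zero_le k) (by
        rw [pow_zero]; exact Submodule.algebraMap_mem _))
  have hcard : k * I.card < Module.finrank (ZMod 2) U := by
    have h1 : I.card ≤ ℓ * (k * (d + 1) ^ (k - 1)) := by
      rw [Finset.card_product, Finset.card_univ, Fintype.card_fin]
      exact Nat.mul_le_mul_left _ (card_filter_card_lt_le d k hk)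
    have h2 := Nat.mul_le_mul_left k h1
    omega
  have hsum := sum_coset_eq_zero (prod_mem_affineFuns_pow I k g hg) U hcard x₀
  have hchar : ∀ y z : ZMod 2, y + (1 + z) ≠ 0 → y = z := by decide
  have hone : (∏ q ∈ I, g q) (x₀ + ((0 : U) : Fin n → ZMod 2)) = 1 := by
    rw [Finset.prod_apply]
    refine Finset.prod_eq_one fun q _ => ?_
    have : ∀ z : ZMod 2, z + (1 + z) = 1 := by decide
    simpa [g] using this _
  -- Chevalley–Warning: the number of agreeing points in `x₀ + U` is even and `x₀` is one of them,
  -- so there is another.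
  obtain ⟨u, hu0, hu⟩ : ∃ u : U, u ≠ 0 ∧ (∏ q ∈ I, g q) (x₀ + (u : Fin n → ZMod 2)) ≠ 0 := by
    by_contra! hcon
    rw [Finset.sum_eq_single 0 (fun u _ hu => hcon u hu) (by simp), hone] at hsum
    exact one_ne_zero hsum
  rw [Finset.prod_apply, Finset.prod_ne_zero_iff] at hu
  have hD : ∀ j S, multiDeriv Δ S (f j) (x₀ + (u : Fin n → ZMod 2)) = multiDeriv Δ S (f j) x₀ := by
    intro j S
    rcases lt_or_ge S.card k with hS | hS
    · exact hchar _ _ (hu (j, S) (by simp [I, hS]))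
    · exact multiDeriv_eq_of_le_card Δ _ (hf j) hS _ _
  have huW : (u : Fin n → ZMod 2) ∉ W := fun h => hu0 <| by
    have : (u : Fin n → ZMod 2) ∈ W ⊓ U := ⟨h, u.2⟩
    rw [hWU] at this
    exact Subtype.ext (by simpa using this)
  have hlarger := hmax (W ⊔ Submodule.span (ZMod 2) {(u : Fin n → ZMod 2)}) ⟨?_, ?_⟩
  · have : W < W ⊔ Submodule.span (ZMod 2) {(u : Fin n → ZMod 2)} :=
      left_lt_sup.2 fun h => huW (h (Submodule.mem_span_singleton_self _))
    exact absurd (Submodule.finrank_lt_finrank_of_lt this) (not_lt.2 hlarger)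
  · exact sup_le hWV ((Submodule.span_singleton_le_iff_mem _ _).2 (hUV u.2))
  · intro j w hw
    obtain ⟨w₁, hw₁, w₂, hw₂, rfl⟩ := Submodule.mem_sup.1 hw
    obtain ⟨c, rfl⟩ := Submodule.mem_span_singleton.1 hw₂
    have hc : ∀ z : ZMod 2, z = 0 ∨ z = 1 := by decide
    rcases hc c with rfl | rfl
    · simpa using hWf j w₁ hw₁
    -- The values of `f j` on `x₀ + u + W` are sums of derivatives at `x₀ + u`, which equal those at
    -- `x₀`; hence they match the values on `x₀ + W`.
    · obtain ⟨T, hT⟩ := hspan w₁ hw₁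
      rw [one_smul, add_comm w₁, ← add_assoc, hT,
        apply_add_sum_eq_sum_multiDeriv Δ (f j)]
      simp only [hD]
      rw [← apply_add_sum_eq_sum_multiDeriv, ← hT, hWf j w₁ hw₁]

theorem IsolatedWeight.exists_le_finrank {n ℓ M : ℕ} (hℓ : 1 ≤ ℓ) (hM : Odd M)
    {x₀ : Fin n → ZMod 2} {V : Submodule (ZMod 2) (Fin n → ZMod 2)}
    (h : IsolatedWeight (2 ^ ℓ * M) x₀ V) :
    ∃ W, IsolatedWeight M x₀ W ∧ Module.finrank (ZMod 2) V ≤ Module.finrank (ZMod 2) W +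
      2 ^ (ℓ - 1) * (ℓ * (2 ^ (ℓ - 1) * (Module.finrank (ZMod 2) W + 1) ^ (2 ^ (ℓ - 1) - 1))) := by
  obtain ⟨W, hWV, hWf, hW⟩ := exists_submodule_const (n := n) (k := 2 ^ (ℓ - 1)) (ℓ := ℓ)
    Nat.one_le_two_pow (fun j x => ((hammingNorm x).choose (2 ^ (j : ℕ)) : ZMod 2))
    (fun j => affineFuns_pow_mono (Nat.pow_le_pow_right two_pos (by omega))
      (choose_hammingNorm_mem _)) x₀ V
  refine ⟨W, (h.mono hWV).of_mul (Nat.Coprime.pow_left _ (Nat.coprime_two_left.2 hM)) ?_, hW⟩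
  intro v hv
  refine modEq_two_pow_of_choose fun j hj => ?_
  rw [← ZMod.natCast_eq_natCast_iff]
  exact hWf ⟨j, hj⟩ v hv

theorem IsolatedWeight.finrank_le_two_pow_mul {n ℓ M : ℕ} (hn : 2 ≤ n) (hℓ : 2 ≤ ℓ) (hodd : Odd M)
    (hM : IsPrimePow M) {x₀ : Fin n → ZMod 2} {V : Submodule (ZMod 2) (Fin n → ZMod 2)}
    (h : IsolatedWeight (2 ^ ℓ * M) x₀ V) :
    (Module.finrank (ZMod 2) V : ℝ) ≤
      ((1 + 2 ^ (ℓ - 1) * (ℓ * 2 ^ (ℓ - 1))) * 3 ^ (2 ^ (ℓ - 1) - 1)) *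
        ((M : ℝ) * Real.log n) ^ (2 ^ (ℓ - 1) - 1) := by
  obtain ⟨W, hW, hle⟩ := h.exists_le_finrank (by omega) hodd
  have h1 := hW.finrank_le_logb hM
  set d := Module.finrank (ZMod 2) W
  set e := 2 ^ (ℓ - 1) - 1 with he
  have he1 : e ≠ 0 := by
    have : 2 ^ 1 ≤ 2 ^ (ℓ - 1) := Nat.pow_le_pow_right two_pos (by omega)
    omega
  have hlog2 := Real.log_two_gt_d9
  have hn' : (2 : ℝ) ≤ n := by exact_mod_cast hn
  have hMpos : (1 : ℝ) ≤ M := by exact_mod_cast hM.one_lt.le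
  have hlogn : Real.log 2 ≤ Real.log n := Real.log_le_log two_pos hn'
  have h2 : Real.logb 2 ((n : ℝ) + 1) ≤ 3 * Real.log n := by
    have : Real.log ((n : ℝ) + 1) ≤ 2 * Real.log n := by
      rw [← Real.log_rpow (by linarith), Real.rpow_two]
      exact Real.log_le_log (by linarith) (by nlinarith)
    rw [Real.logb, div_le_iff₀ (by linarith)]
    nlinarith
  have h3 : 1 ≤ Real.logb 2 ((n : ℝ) + 1) := by
    rw [Real.le_logb_iff_rpow_le one_lt_two (by linarith)]
    simpa using by linarith
  -- With `Λ = log₂ (n + 1) ≥ 1`, `d + 1 ≤ (M - 1) Λ + 1 ≤ M Λ ≤ 3 M log n`. The exponent `e` is at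
  -- least 1 because `ℓ ≥ 2`, which lets `d` itself be absorbed.
  have h4 : (d : ℝ) + 1 ≤ 3 * (M * Real.log n) := by nlinarith
  have h5 : (d : ℝ) ≤ ((d : ℝ) + 1) ^ e :=
    (by linarith : (d : ℝ) ≤ d + 1).trans (le_self_pow₀ (by linarith [(Nat.cast_nonneg d : (0 : ℝ) ≤ d)]) he1)
  have h6 : (Module.finrank (ZMod 2) V : ℝ) ≤
      d + 2 ^ (ℓ - 1) * (ℓ * (2 ^ (ℓ - 1) * ((d : ℝ) + 1) ^ e)) := by exact_mod_cast hle
  calc (Module.finrank (ZMod 2) V : ℝ)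
      ≤ (1 + 2 ^ (ℓ - 1) * (ℓ * 2 ^ (ℓ - 1))) * ((d : ℝ) + 1) ^ e := by linarith
    _ ≤ (1 + 2 ^ (ℓ - 1) * (ℓ * 2 ^ (ℓ - 1))) * (3 * (M * Real.log n)) ^ e := by gcongr
    _ = _ := by rw [mul_pow]; ring

/-! ### Balog–Szemerédi–Gowers. -/

set_option maxHeartbeats 1000000 in
/-- Dependent random choice: a dense graph contains a large set of vertices all of whose pairs are
joined by many paths of length four. -/
theorem exists_many_paths {α : Type*} (Q : Finset α) (hQ : Q.Nonempty) (R : α → α → Prop)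
    [DecidableRel R] (L : ℝ) (hL : 1 ≤ L)
    (hE : (Q.card : ℝ) ^ 2 ≤ 2 * L * ∑ v ∈ Q, ∑ a ∈ Q, if R a v then (1 : ℝ) else 0) :
    ∃ A ⊆ Q, (Q.card : ℝ) ≤ 4 * L * A.card ∧ ∀ a ∈ A, ∀ a' ∈ A,
      (Q.card : ℝ) ^ 3 ≤ 98304 * L ^ 5 *
        ∑ c ∈ Q, (∑ b ∈ Q, if R a b ∧ R c b then (1 : ℝ) else 0) *
          ∑ b ∈ Q, if R a' b ∧ R c b then (1 : ℝ) else 0 := by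
  classical
  set N : ℝ := (Q.card : ℝ) with hN
  have hNpos : 0 < N := Nat.cast_pos.2 hQ.card_pos
  let w : α → α → ℝ := fun a v => if R a v then 1 else 0
  let cod : α → α → ℝ := fun a b => ∑ v ∈ Q, if R a v ∧ R b v then (1 : ℝ) else 0
  let z : α → α → ℝ := fun a b => if cod a b < N / (128 * L ^ 2) then 1 else 0
  have hz0 : ∀ a b, 0 ≤ z a b := fun a b => by simp only [z]; split_ifs <;> norm_num
  have hcod0 : ∀ a b, 0 ≤ cod a b := fun a b =>
    Finset.sum_nonneg fun v _ => by split_ifs <;> norm_num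
  have hdeg : N ^ 3 / (4 * L ^ 2) ≤ ∑ v ∈ Q, (∑ a ∈ Q, w a v) ^ 2 := by
    have h1 := sq_sum_le_card_mul_sum_sq (s := Q) (f := fun v => ∑ a ∈ Q, w a v)
    have h2 : N ^ 2 / (2 * L) ≤ ∑ v ∈ Q, ∑ a ∈ Q, w a v := by
      rw [div_le_iff₀ (by positivity), mul_comm]; exact hE
    have h3 := pow_le_pow_left₀ (by positivity) h2 2
    have h4 := h3.trans h1
    rw [← hN] at h4
    have h5 : (N ^ 2 / (2 * L)) ^ 2 = N * (N ^ 3 / (4 * L ^ 2)) := by field_simp; ring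
    rw [h5] at h4
    exact le_of_mul_le_mul_left h4 hNpos
  have hbad : ∑ v ∈ Q, ∑ a ∈ Q, ∑ b ∈ Q, z a b * (w a v * w b v) ≤ N ^ 3 / (128 * L ^ 2) := by
    rw [Finset.sum_comm]
    have h1 : ∀ a ∈ Q, ∑ v ∈ Q, ∑ b ∈ Q, z a b * (w a v * w b v) ≤
        N * (N / (128 * L ^ 2)) := by
      intro a _
      rw [Finset.sum_comm, hN, ← nsmul_eq_mul, ← hN]
      refine Finset.sum_le_card_nsmul _ _ _ fun b _ => ?_
      rw [← Finset.mul_sum]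
      have h2 : ∑ v ∈ Q, w a v * w b v = cod a b :=
        Finset.sum_congr rfl fun v _ => by simp only [w]; split_ifs <;> simp_all
      rw [h2]
      simp only [z]
      split_ifs with h
      · linarith
      · have : 0 ≤ N / (128 * L ^ 2) := by positivity
        linarith
    refine (Finset.sum_le_card_nsmul _ _ _ h1).trans_eq ?_
    rw [nsmul_eq_mul, ← hN]
    ring
  -- Average over a random vertex `v` with neighbourhood `A₁`: `|A₁|²` has mean at least `N² /
  -- (4L²)`, while pairs in `A₁` of codegree below `N / (128 L²)` number at most `N² / (128 L²)` on
  -- average. The weight 16 leaves half of the main term.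
  obtain ⟨v, hv, hvle⟩ : ∃ v ∈ Q, N ^ 2 / (8 * L ^ 2) ≤
      (∑ a ∈ Q, w a v) ^ 2 - 16 * ∑ a ∈ Q, ∑ b ∈ Q, z a b * (w a v * w b v) := by
    refine Finset.exists_le_of_sum_le hQ ?_
    rw [Finset.sum_sub_distrib, ← Finset.mul_sum, Finset.sum_const, nsmul_eq_mul, ← hN]
    have : N * (N ^ 2 / (8 * L ^ 2)) = N ^ 3 / (4 * L ^ 2) - 16 * (N ^ 3 / (128 * L ^ 2)) := by
      field_simp; ring
    linarith
  set A₁ := Q.filter fun a => R a v with hA₁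
  have hA₁Q : A₁ ⊆ Q := Finset.filter_subset _ _
  set n₁ : ℝ := (A₁.card : ℝ) with hn₁
  have hd : ∑ a ∈ Q, w a v = n₁ := by simp [w, hn₁, hA₁]
  have hB : ∑ a ∈ Q, ∑ b ∈ Q, z a b * (w a v * w b v) = ∑ a ∈ A₁, ∑ b ∈ A₁, z a b := by
    rw [hA₁, Finset.sum_filter]
    refine Finset.sum_congr rfl fun a _ => ?_
    rw [Finset.sum_filter]
    split_ifs with h
    · exact Finset.sum_congr rfl fun b _ => by simp [w, h]
    · exact Finset.sum_eq_zero fun b _ => by simp [w, h]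
  rw [hd, hB] at hvle
  have hn0 : 0 ≤ n₁ := Nat.cast_nonneg _
  have hBnn : 0 ≤ ∑ a ∈ A₁, ∑ b ∈ A₁, z a b :=
    Finset.sum_nonneg fun a _ => Finset.sum_nonneg fun b _ => hz0 a b
  have hn₁N : N ≤ 3 * L * n₁ := by
    have h1 : N ^ 2 ≤ n₁ ^ 2 * (8 * L ^ 2) := by
      rw [← div_le_iff₀ (by positivity)]; linarith
    have h2 : N ^ 2 ≤ (3 * L * n₁) ^ 2 := by nlinarith [sq_nonneg (L * n₁)]
    exact le_of_sq_le_sq h2 (by positivity)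
  have hn₁pos : 0 < n₁ := by
    by_contra! h
    have : n₁ = 0 := le_antisymm h hn0
    rw [this] at hn₁N
    linarith
  have hBle : 16 * ∑ a ∈ A₁, ∑ b ∈ A₁, z a b ≤ n₁ ^ 2 := by
    have : 0 ≤ N ^ 2 / (8 * L ^ 2) := by positivity
    linarith
  -- Vertices with more than a quarter of `A₁` as bad partners are deleted. Any two survivors share
  -- at least half of `A₁` as good partners `c`, each giving `(N / (128 L²))²` paths; `98304 = 6 ·
  -- 128²`.
  set A₂ := A₁.filter fun a => 4 * ∑ b ∈ A₁, z a b ≤ n₁ with hA₂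
  have hA₂A₁ : A₂ ⊆ A₁ := Finset.filter_subset _ _
  have hA₂card : 3 * n₁ ≤ 4 * (A₂.card : ℝ) := by
    have h1 : ((A₁ \ A₂).card : ℝ) * (n₁ / 4) ≤ ∑ a ∈ A₁, ∑ b ∈ A₁, z a b := by
      refine le_trans ?_ (Finset.sum_le_sum_of_subset_of_nonneg (Finset.sdiff_subset (t := A₂))
        fun a _ _ => Finset.sum_nonneg fun b _ => hz0 a b)
      rw [← nsmul_eq_mul]
      refine Finset.card_nsmul_le_sum _ _ _ fun a ha => ?_
      obtain ⟨ha1, ha2⟩ := Finset.mem_sdiff.1 ha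
      have := not_le.1 fun h => ha2 (Finset.mem_filter.2 ⟨ha1, h⟩)
      linarith
    have h2 : ((A₁ \ A₂).card : ℝ) = n₁ - A₂.card := by
      rw [Finset.card_sdiff_of_subset hA₂A₁, Nat.cast_sub (Finset.card_le_card hA₂A₁)]
    rw [h2] at h1
    nlinarith
  refine ⟨A₂, hA₂A₁.trans hA₁Q, by nlinarith, fun a ha a' ha' => ?_⟩
  set C := A₁.filter fun c => z a c = 0 ∧ z a' c = 0 with hC
  have hCcard : n₁ ≤ 2 * (C.card : ℝ) := by
    have h1 : n₁ - C.card ≤ ∑ c ∈ A₁, (z a c + z a' c) := by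
      have h3 : n₁ - C.card = ∑ c ∈ A₁, (1 - if z a c = 0 ∧ z a' c = 0 then (1 : ℝ) else 0) := by
        simp [Finset.sum_sub_distrib, hn₁, hC]
      rw [h3]
      refine Finset.sum_le_sum fun c _ => ?_
      simp only [z]
      split_ifs <;> simp_all
    rw [Finset.sum_add_distrib] at h1
    have h2 := (Finset.mem_filter.1 ha).2
    have h3 := (Finset.mem_filter.1 ha').2
    linarith
  have hgood : ∀ x c, z x c = 0 → N / (128 * L ^ 2) ≤ cod x c := by
    intro x c h
    by_contra! hlt
    simp [z, hlt] at h
  have hsum : (C.card : ℝ) * (N / (128 * L ^ 2)) ^ 2 ≤ ∑ c ∈ Q, cod a c * cod a' c := by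
    refine le_trans ?_ (Finset.sum_le_sum_of_subset_of_nonneg
      ((Finset.filter_subset _ _).trans hA₁Q : C ⊆ Q)
      fun c _ _ => mul_nonneg (hcod0 _ _) (hcod0 _ _))
    rw [← nsmul_eq_mul]
    refine Finset.card_nsmul_le_sum _ _ _ fun c hc => ?_
    have h := (Finset.mem_filter.1 hc).2
    rw [sq]
    exact mul_le_mul (hgood _ _ h.1) (hgood _ _ h.2) (by positivity) (hcod0 _ _)
  calc N ^ 3 ≤ 98304 * L ^ 5 * (C.card * (N / (128 * L ^ 2)) ^ 2) := by
        have : 98304 * L ^ 5 * (C.card * (N / (128 * L ^ 2)) ^ 2) = 6 * L * C.card * N ^ 2 := by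
          field_simp; ring
        rw [this]
        have h6 : N ≤ 6 * L * C.card := by nlinarith
        nlinarith [mul_le_mul_of_nonneg_right h6 (sq_nonneg N)]
    _ ≤ _ := by gcongr

section Energy

variable {G : Type*} [AddCommGroup G] [DecidableEq G]

/-- The number of representations of `x` as a difference of two elements of `Q`. -/
def diffCount (Q : Finset G) (x : G) : ℕ :=
  ((Q ×ˢ Q).filter fun p => p.1 - p.2 = x).card

theorem sum_diffCount [Fintype G] (Q : Finset G) : ∑ x, diffCount Q x = Q.card ^ 2 := by
  rw [sq, ← Finset.card_product]
  exact (Finset.card_eq_sum_card_fiberwise fun _ _ => Finset.mem_coe.2 (Finset.mem_univ _)).symm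

theorem diffCount_le (Q : Finset G) (x : G) : diffCount Q x ≤ Q.card := by
  refine Finset.card_le_card_of_injOn Prod.fst
    (fun p hp => (Finset.mem_product.1 (Finset.mem_filter.1 hp).1).1) ?_
  rintro ⟨a, b⟩ hp ⟨c, d⟩ hq h
  have h1 : a - b = x := (Finset.mem_filter.1 hp).2
  have h2 : c - d = x := (Finset.mem_filter.1 hq).2
  have h3 : a = c := h
  subst h3
  have : b = d := sub_right_injective (h1.trans h2.symm)
  rw [this]

/-- The Balog–Szemerédi–Gowers theorem. -/
theorem exists_subset_small_diff [Fintype G] (Q : Finset G) (hQ : Q.Nonempty) (L : ℝ) (hL : 4 ≤ L)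
    (hE : (Q.card : ℝ) ^ 3 ≤ L * ∑ x, (diffCount Q x : ℝ) ^ 2) :
    ∃ P ⊆ Q, (Q.card : ℝ) ≤ L ^ 2 * P.card ∧ ((P - P).card : ℝ) ≤ L ^ 22 * P.card := by
  set N : ℝ := (Q.card : ℝ) with hN
  have hNpos : 0 < N := Nat.cast_pos.2 hQ.card_pos
  have hr : ∀ x, (diffCount Q x : ℝ) ≤ N := fun x => Nat.cast_le.2 (diffCount_le Q x)
  have hsum : ∑ x, (diffCount Q x : ℝ) = N ^ 2 := by
    rw [← Nat.cast_sum, sum_diffCount, Nat.cast_pow]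
  -- Popular differences: they carry at least a `1 / (2L)` share of all pairs, and there are at most
  -- `2 L N` of them.
  set D := Finset.univ.filter fun x : G => N ≤ 2 * L * diffCount Q x with hD
  have hDsum : N ^ 2 ≤ 2 * L * ∑ x ∈ D, (diffCount Q x : ℝ) := by
    have h1 : ∀ x, 2 * L * (diffCount Q x : ℝ) ^ 2 ≤
        2 * L * (if x ∈ D then N * (diffCount Q x : ℝ) else 0) + N * diffCount Q x := by
      intro x
      have h0 : (0 : ℝ) ≤ diffCount Q x := Nat.cast_nonneg _
      split_ifs with h
      · have := mul_le_mul_of_nonneg_right (hr x) h0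
        nlinarith
      · have : 2 * L * diffCount Q x < N := by simpa [hD] using h
        nlinarith
    have h2 := Finset.sum_le_sum fun x (_ : x ∈ Finset.univ) => h1 x
    rw [Finset.sum_add_distrib, ← Finset.mul_sum, ← Finset.mul_sum, ← Finset.mul_sum, hsum,
      Finset.sum_ite_mem, Finset.univ_inter, ← Finset.mul_sum] at h2
    have h3 : N * N ^ 2 ≤ N * (2 * L * ∑ x ∈ D, (diffCount Q x : ℝ)) := by nlinarith
    exact le_of_mul_le_mul_left h3 hNpos
  have hDcard : (D.card : ℝ) ≤ 2 * L * N := by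
    have h1 : (D.card : ℝ) * N ≤ ∑ x ∈ D, 2 * L * (diffCount Q x : ℝ) := by
      rw [← nsmul_eq_mul]
      exact Finset.card_nsmul_le_sum _ _ _ fun x hx => (Finset.mem_filter.1 hx).2
    have h2 : ∑ x ∈ D, (diffCount Q x : ℝ) ≤ ∑ x, (diffCount Q x : ℝ) :=
      Finset.sum_le_sum_of_subset_of_nonneg (Finset.subset_univ _) fun _ _ _ => Nat.cast_nonneg _
    rw [← Finset.mul_sum] at h1
    rw [hsum] at h2
    have h3 : (D.card : ℝ) * N ≤ 2 * L * N * N := by nlinarith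
    exact le_of_mul_le_mul_right h3 hNpos
  have hedges : ∑ x ∈ D, (diffCount Q x : ℝ) =
      ∑ v ∈ Q, ∑ a ∈ Q, if a - v ∈ D then (1 : ℝ) else 0 := by
    rw [Finset.sum_comm, ← Finset.sum_product', Finset.sum_boole, ← Nat.cast_sum]
    congr 1
    refine Eq.trans ?_ (Finset.card_eq_sum_card_fiberwise
      (f := fun p : G × G => p.1 - p.2) (t := D) fun p hp => (Finset.mem_filter.1 hp).2).symm
    refine Finset.sum_congr rfl fun x hx => ?_
    rw [diffCount, Finset.filter_filter]
    congr 1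
    refine Finset.filter_congr fun p _ => ⟨fun h => ⟨by subst h; exact hx, h⟩, fun h => h.2⟩
  rw [hedges] at hDsum
  obtain ⟨A, hAQ, hAcard, hA⟩ := exists_many_paths Q hQ (fun a v => a - v ∈ D) L
    (by linarith) hDsum
  have hApos : 0 < (A.card : ℝ) := by
    by_contra! h
    have h0 : (A.card : ℝ) = 0 := le_antisymm h (Nat.cast_nonneg _)
    rw [h0] at hAcard
    linarith
  refine ⟨A, hAQ, hAcard.trans ?_, ?_⟩
  · have : 4 * L ≤ L ^ 2 := by nlinarith
    gcongr
  set D4 := D ×ˢ D ×ˢ D ×ˢ D with hD4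
  let φ : G × G × G × G → G := fun d => d.1 - d.2.1 + d.2.2.1 - d.2.2.2
  -- A path `a, b, c, b', a'` writes `a - a'` as `(a - b) - (c - b) + (c - b') - (a' - b')` with all
  -- four terms in `D`. Many representations per difference and only `|D| ^ 4` quadruples bound `|A
  -- - A|`.
  have hfib : ∀ x ∈ A - A, N ^ 3 / (98304 * L ^ 5) ≤ ((D4.filter fun d => φ d = x).card : ℝ) := by
    intro x hx
    obtain ⟨a, ha, a', ha', rfl⟩ := Finset.mem_sub.1 hx
    rw [div_le_iff₀ (by positivity), mul_comm]
    refine (hA a ha a' ha').trans ?_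
    gcongr
    set S := Q.sigma fun c => (Q.filter fun b => a - b ∈ D ∧ c - b ∈ D) ×ˢ
      (Q.filter fun b => a' - b ∈ D ∧ c - b ∈ D) with hS
    have h1 : (∑ c ∈ Q, (∑ b ∈ Q, if a - b ∈ D ∧ c - b ∈ D then (1 : ℝ) else 0) *
        ∑ b ∈ Q, if a' - b ∈ D ∧ c - b ∈ D then (1 : ℝ) else 0) = (S.card : ℝ) := by
      rw [hS, Finset.card_sigma, Nat.cast_sum]
      refine Finset.sum_congr rfl fun c _ => ?_
      rw [Finset.card_product, Nat.cast_mul, Finset.sum_boole, Finset.sum_boole]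
    rw [h1]
    norm_cast
    refine Finset.card_le_card_of_injOn
      (fun q => (a - q.2.1, q.1 - q.2.1, q.1 - q.2.2, a' - q.2.2)) ?_ ?_
    · rintro ⟨c, b, b'⟩ hq
      simp only [hS, Finset.coe_sigma, Set.mem_sigma_iff, Finset.mem_coe, Finset.mem_product,
        Finset.mem_filter] at hq
      simp only [Finset.mem_coe, Finset.mem_filter, hD4, Finset.mem_product, φ]
      refine ⟨⟨hq.2.1.2.1, hq.2.1.2.2, hq.2.2.2.2, hq.2.2.2.1⟩, by abel⟩
    · rintro ⟨c, b, b'⟩ _ ⟨c₂, b₂, b₂'⟩ _ h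
      simp only [Prod.mk.injEq] at h
      obtain ⟨h1, h2, _, h4⟩ := h
      have hb : b = b₂ := sub_right_injective h1
      have hb' : b' = b₂' := sub_right_injective h4
      subst hb hb'
      have hc : c = c₂ := sub_left_injective h2
      subst hc
      rfl
  have htot : ((A - A).card : ℝ) * (N ^ 3 / (98304 * L ^ 5)) ≤ (2 * L * N) ^ 4 := by
    calc ((A - A).card : ℝ) * (N ^ 3 / (98304 * L ^ 5))
        ≤ ∑ x ∈ A - A, ((D4.filter fun d => φ d = x).card : ℝ) := by
          rw [← nsmul_eq_mul]
          exact Finset.card_nsmul_le_sum _ _ _ hfib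
      _ ≤ ∑ x, ((D4.filter fun d => φ d = x).card : ℝ) :=
          Finset.sum_le_sum_of_subset_of_nonneg (Finset.subset_univ _)
            fun _ _ _ => Nat.cast_nonneg _
      _ = (D4.card : ℝ) := by
          rw [← Nat.cast_sum]
          congr 1
          exact (Finset.card_eq_sum_card_fiberwise
            fun _ _ => Finset.mem_coe.2 (Finset.mem_univ _)).symm
      _ = (D.card : ℝ) ^ 4 := by
          rw [hD4]
          simp only [Finset.card_product, Nat.cast_mul]
          ring
      _ ≤ (2 * L * N) ^ 4 := by gcongr
  have h1 : ((A - A).card : ℝ) ≤ 1572864 * L ^ 9 * N := by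
    have h2 : ((A - A).card : ℝ) * (N ^ 3 / (98304 * L ^ 5)) ≤
        1572864 * L ^ 9 * N * (N ^ 3 / (98304 * L ^ 5)) := by
      refine htot.trans_eq ?_
      field_simp
      ring
    exact le_of_mul_le_mul_right h2 (by positivity)
  have h4 : (4 : ℝ) ^ 12 ≤ L ^ 12 := by gcongr
  calc ((A - A).card : ℝ) ≤ 1572864 * L ^ 9 * (4 * L * A.card) := by
        refine h1.trans ?_
        gcongr
    _ = 6291456 * L ^ 10 * A.card := by ring
    _ ≤ L ^ 12 * L ^ 10 * A.card := by
        gcongr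
        linarith
    _ = L ^ 22 * A.card := by ring

/-- Plünnecke–Ruzsa passes from differences to sums, squaring the constant `L ^ 22`. -/
theorem exists_subset_small_doubling [Fintype G] (Q : Finset G) (hQ : Q.Nonempty) (L : ℝ) (hL : 4 ≤ L)
    (hE : (Q.card : ℝ) ^ 3 ≤ L * ∑ x, (diffCount Q x : ℝ) ^ 2) :
    ∃ P ⊆ Q, P.Nonempty ∧ (Q.card : ℝ) ≤ L ^ 2 * P.card ∧
      ((P + P).card : ℝ) ≤ L ^ 44 * P.card := by
  obtain ⟨P, hPQ, h1, h2⟩ := exists_subset_small_diff Q hQ L hL hE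
  have hP : P.Nonempty := by
    rw [Finset.nonempty_iff_ne_empty]
    rintro rfl
    have : (0 : ℝ) < Q.card := by exact_mod_cast hQ.card_pos
    simp at h1
    simp [h1] at hQ
  refine ⟨P, hPQ, hP, h1, ?_⟩
  have hPpos : (0 : ℝ) < P.card := by exact_mod_cast hP.card_pos
  have h3 := Finset.pluennecke_ruzsa_inequality_nsmul_sub hP P 2
  rw [two_nsmul] at h3
  have h4 : ((P + P).card : ℝ) ≤ (((P - P).card : ℝ) / P.card) ^ 2 * P.card := by
    have := (NNRat.cast_le (K := ℝ)).2 h3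
    push_cast at this
    exact this
  refine h4.trans ?_
  have h5 : ((P - P).card : ℝ) / P.card ≤ L ^ 22 := by rwa [div_le_iff₀ hPpos]
  calc (((P - P).card : ℝ) / P.card) ^ 2 * P.card ≤ (L ^ 22) ^ 2 * P.card := by gcongr
    _ = L ^ 44 * P.card := by ring

end Energy

/-! ### PFR for finite abelian groups of bounded exponent. -/

section Transfer

theorem exists_injective_zmod_hom {M d : ℕ} (hM : 0 < M) (hd : d ∣ M) :
    ∃ φ : ZMod d →+ ZMod M, Function.Injective φ := by
  obtain ⟨e, rfl⟩ := hd
  have he : 0 < e := Nat.pos_of_mul_pos_left hM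
  have hd0 : 0 < d := Nat.pos_of_mul_pos_right hM
  let ψ : ℤ →+ ZMod (d * e) := (zmultiplesHom _) (e : ZMod (d * e))
  have hψ : ∀ k : ℤ, ψ k = ((k * e : ℤ) : ZMod (d * e)) := fun k => by simp [ψ]
  refine ⟨ZMod.lift d ⟨ψ, ?_⟩, (injective_iff_map_eq_zero _).2 fun x hx => ?_⟩
  · rw [hψ, ZMod.intCast_zmod_eq_zero_iff_dvd]
    push_cast
    exact dvd_rfl
  · obtain ⟨k, rfl⟩ := ZMod.intCast_surjective x
    rw [ZMod.lift_coe, hψ, ZMod.intCast_zmod_eq_zero_iff_dvd, Nat.cast_mul] at hx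
    exact (ZMod.intCast_zmod_eq_zero_iff_dvd _ _).2
      (Int.dvd_of_mul_dvd_mul_right (by exact_mod_cast he.ne') hx)

theorem exists_injective_hom_pi_zmod {M : ℕ} (hM : 0 < M) (G : Type) [AddCommGroup G] [Finite G]
    (hG : ∀ x : G, M • x = 0) : ∃ (r : ℕ) (φ : G →+ (Fin r → ZMod M)), Function.Injective φ := by
  classical
  obtain ⟨ι, hι, d, _, ⟨e⟩⟩ := AddCommGroup.equiv_directSum_zmod_of_finite' G
  have hd : ∀ i, d i ∣ M := by
    intro i
    have h1 := hG (e.symm (DirectSum.of (fun i => ZMod (d i)) i 1))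
    rw [← map_nsmul, map_eq_zero_iff _ e.symm.injective, ← map_nsmul,
      map_eq_zero_iff _ (DirectSum.of_injective i), nsmul_one] at h1
    exact (ZMod.natCast_eq_zero_iff _ _).1 h1
  choose φ hφ using fun i => exists_injective_zmod_hom hM (hd i)
  let ev : (i : ι) → G →+ ZMod (d i) := fun i =>
    (DFinsupp.evalAddMonoidHom i).comp e.toAddMonoidHom
  refine ⟨Fintype.card ι, AddMonoidHom.pi fun j =>
    (φ ((Fintype.equivFin ι).symm j)).comp (ev ((Fintype.equivFin ι).symm j)), ?_⟩
  rw [injective_iff_map_eq_zero]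
  intro x hx
  rw [← map_eq_zero_iff e e.injective]
  refine DFinsupp.ext fun i => ?_
  have h1 := congrFun hx (Fintype.equivFin ι i)
  have h2 : φ ((Fintype.equivFin ι).symm (Fintype.equivFin ι i))
    (ev ((Fintype.equivFin ι).symm (Fintype.equivFin ι i)) x) = 0 := h1
  rw [Equiv.symm_apply_apply, map_eq_zero_iff _ (hφ i)] at h2
  exact h2

/-- The polynomial Freiman–Ruzsa conjecture over `ℤ/mℤ` implies it over all finite abelian groups
of exponent dividing `m`. -/
theorem PFRConjectureOver.of_exponent {M : ℕ} (hM : 0 < M) (h : PFRConjectureOver M) :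
    ∃ c : ℕ, ∀ (G : Type) [AddCommGroup G] [Finite G] [DecidableEq G], (∀ x : G, M • x = 0) →
      ∀ (A : Finset G) (K : ℝ), A.Nonempty → ((A + A).card : ℝ) ≤ K * A.card →
      ∃ (H : AddSubgroup G) (T : Finset G), Nat.card H ≤ A.card ∧ (T.card : ℝ) ≤ (2 * K) ^ c ∧
        ∀ x ∈ A, ∃ t ∈ T, x - t ∈ H := by
  classical
  obtain ⟨c, hc⟩ := h
  refine ⟨c, fun G _ _ _ hG A K hA hAK => ?_⟩
  obtain ⟨r, φ, hφ⟩ := exists_injective_hom_pi_zmod hM G hG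
  have himg : (A.image φ).card = A.card := Finset.card_image_of_injective _ hφ
  obtain ⟨H, T, hH, hT, hcov⟩ := hc r (A.image φ) K (hA.image _) (by
    rw [← Finset.image_add, himg, Finset.card_image_of_injective _ hφ]
    exact hAK)
  obtain ⟨a₀, -⟩ := id hA
  -- Coset representatives in the ambient group need not come from `G`: each is replaced by a point
  -- of `A` whose image lies in its coset. The default `a₀` covers cosets that miss the image of
  -- `A`.
  let g : (Fin r → ZMod M) → G := fun t =>
    if h : ∃ x ∈ A, φ x - t ∈ H then h.choose else a₀
  refine ⟨H.comap φ, T.image g, ?_, ?_, fun x hx => ?_⟩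
  · rw [← himg]
    refine le_trans ?_ hH
    have : NeZero M := ⟨hM.ne'⟩
    exact Nat.card_le_card_of_injective (fun x : H.comap φ => (⟨φ x, x.2⟩ : H)) fun x y hxy =>
      Subtype.ext (hφ (congrArg Subtype.val hxy))
  · exact (Nat.cast_le.2 Finset.card_image_le).trans hT
  · obtain ⟨t, ht, hxt⟩ := hcov (φ x) (Finset.mem_image_of_mem _ hx)
    refine ⟨g t, Finset.mem_image_of_mem _ ht, ?_⟩
    have hex : ∃ x ∈ A, φ x - t ∈ H := ⟨x, hx, hxt⟩
    have hg : φ (g t) - t ∈ H := by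
      simp only [g, dif_pos hex]
      exact hex.choose_spec.2
    rw [AddSubgroup.mem_comap, map_sub]
    have := H.sub_mem hxt hg
    rwa [sub_sub_sub_cancel_right] at this

end Transfer

/-! ### From energy of a weight to energy of a level set. -/

section LevelSet

variable {G : Type*} [AddCommGroup G] [Fintype G]

/-- The autocorrelation of a function on a finite abelian group. -/
def autocorr (f : G → ℝ) (x : G) : ℝ := ∑ y, f (y + x) * f y

theorem autocorr_nonneg {f : G → ℝ} (hf : ∀ x, 0 ≤ f x) (x : G) : 0 ≤ autocorr f x :=
  Finset.sum_nonneg fun _ _ => mul_nonneg (hf _) (hf _)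

theorem sum_correlation (f g : G → ℝ) :
    ∑ x, ∑ y, f (y + x) * g y = (∑ x, f x) * ∑ x, g x := by
  rw [Finset.sum_comm, Finset.mul_sum]
  refine Finset.sum_congr rfl fun y _ => ?_
  rw [← Finset.sum_mul]
  congr 1
  exact Fintype.sum_equiv (Equiv.addLeft y) _ _ fun x => rfl

theorem sum_autocorr (f : G → ℝ) : ∑ x, autocorr f x = (∑ x, f x) ^ 2 := by
  rw [sq]
  exact sum_correlation f f

theorem autocorr_le (f : G → ℝ) (x : G) : autocorr f x ≤ ∑ y, f y ^ 2 := by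
  have h1 : ∑ y, f (y + x) ^ 2 = ∑ y, f y ^ 2 :=
    Fintype.sum_equiv (Equiv.addRight x) _ _ fun y => rfl
  have h2 : ∀ y, f (y + x) * f y ≤ (f (y + x) ^ 2 + f y ^ 2) / 2 := fun y => by
    nlinarith [sq_nonneg (f (y + x) - f y)]
  refine (Finset.sum_le_sum fun y _ => h2 y).trans_eq ?_
  rw [← Finset.sum_div, Finset.sum_add_distrib, h1]
  ring

theorem sum_mul_correlation_le {c f g : G → ℝ} {B : ℝ} (hf : ∀ x, 0 ≤ f x) (hf1 : ∑ x, f x = 1)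
    (h : ∀ y, ∑ x, c x * g (y + x) ≤ B) : ∑ x, c x * ∑ y, g (y + x) * f y ≤ B := by
  calc ∑ x, c x * ∑ y, g (y + x) * f y = ∑ y, f y * ∑ x, c x * g (y + x) := by
        simp only [Finset.mul_sum]
        rw [Finset.sum_comm]
        exact Finset.sum_congr rfl fun _ _ => Finset.sum_congr rfl fun _ _ => by ring
    _ ≤ ∑ y, f y * B := Finset.sum_le_sum fun y _ => mul_le_mul_of_nonneg_left (h y) (hf y)
    _ = B := by rw [← Finset.sum_mul, hf1, one_mul]

theorem correlation_neg (f g : G → ℝ) (x : G) :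
    ∑ y, f (y + x) * g y = ∑ y, g (y + -x) * f y :=
  Fintype.sum_equiv (Equiv.addRight x) _ _ fun y => by simp [mul_comm]

/-- A probability weight whose autocorrelation has large energy is roughly constant on a set of
large additive energy. -/
theorem exists_level_set [DecidableEq G] {f : G → ℝ} (hf : ∀ x, 0 ≤ f x) (hf1 : ∑ x, f x = 1)
    {Λ : ℝ} (hΛ : 4 ≤ Λ) (hE : ∑ x, f x ^ 2 ≤ Λ * ∑ x, autocorr f x ^ 2) :
    ∃ Q : Finset G, Q.Nonempty ∧ 0 < ∑ x, f x ^ 2 ∧ (∀ x ∈ Q, ∑ y, f y ^ 2 ≤ Λ ^ 6 * f x) ∧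
      (Q.card : ℝ) ^ 3 ≤ Λ ^ 44 * ∑ x, (diffCount Q x : ℝ) ^ 2 ∧
      1 ≤ Λ ^ 26 * (Q.card * ∑ x, f x ^ 2) := by
  have hΛ0 : 0 < Λ := by linarith
  set F := ∑ x, f x ^ 2 with hF
  have hFpos : 0 < F := by
    have h1 := sq_sum_le_card_mul_sum_sq (s := Finset.univ) (f := f)
    rw [hf1, ← hF, one_pow] at h1
    by_contra! h
    have : ((Finset.univ : Finset G).card : ℝ) * F ≤ 0 :=
      mul_nonpos_of_nonneg_of_nonpos (Nat.cast_nonneg _) h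
    linarith
  -- `Q` is where `f` is within a factor `Λ ^ 6` of `F = ‖f‖₂²`. The remainder `r` is shown to
  -- contribute negligibly to the energy, both where `f` is too small and where it is too large.
  set Q := Finset.univ.filter fun x => F ≤ Λ ^ 6 * f x ∧ f x ≤ Λ ^ 6 * F with hQ
  let m : G → ℝ := fun x => if x ∈ Q then f x else 0
  let r : G → ℝ := fun x => if x ∈ Q then 0 else f x
  have hm0 : ∀ x, 0 ≤ m x := fun x => by simp only [m]; split_ifs <;> simp [hf]
  have hr0 : ∀ x, 0 ≤ r x := fun x => by simp only [r]; split_ifs <;> simp [hf]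
  have hmr : ∀ x, f x = m x + r x := fun x => by simp only [m, r]; split_ifs <;> simp
  let c := autocorr f
  have hc0 : ∀ x, 0 ≤ c x := autocorr_nonneg hf
  have hcF : ∀ x, c x ≤ F := autocorr_le f
  have hc1 : ∑ x, c x = 1 := by rw [sum_autocorr, hf1, one_pow]
  have hc2 : ∑ x, c x ^ 2 ≤ F := by
    calc ∑ x, c x ^ 2 ≤ ∑ x, F * c x := Finset.sum_le_sum fun x _ => by
          rw [sq]; exact mul_le_mul_of_nonneg_right (hcF x) (hc0 x)
      _ = F := by rw [← Finset.mul_sum, hc1, mul_one]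
  have hcneg : ∀ x, c (-x) = c x := fun x => by
    simp only [c, autocorr]
    rw [correlation_neg f f x]
  have hr2 : ∀ x, r x ^ 2 * Λ ^ 6 ≤ F * f x ∨ r x * F * Λ ^ 6 ≤ f x ^ 2 := by
    intro x
    by_cases hx : x ∈ Q
    · left
      simpa [r, hx] using mul_nonneg hFpos.le (hf x)
    · have hx' : ¬ (F ≤ Λ ^ 6 * f x ∧ f x ≤ Λ ^ 6 * F) := by simpa [hQ] using hx
      simp only [r, if_neg hx]
      rcases not_and_or.1 hx' with h | h
      · left; nlinarith [hf x]
      · right; nlinarith [hf x]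
  -- Where `f` is too small, AM–GM is used with weight `Λ ^ 3`; where it is too large, `c ≤ F`
  -- suffices. The three terms sum to at most `F / Λ ^ 3 + F / Λ ^ 6`.
  have hrsum : ∀ y, ∑ x, c x * r (y + x) ≤ 2 * F / Λ ^ 3 := by
    intro y
    have h1 : ∀ x, c x * r (y + x) ≤ c x ^ 2 / (2 * Λ ^ 3) + F * f (y + x) / (2 * Λ ^ 3) +
        f (y + x) ^ 2 / Λ ^ 6 := by
      intro x
      have hfx := hf (y + x)
      rcases hr2 (y + x) with h | h
      · have h2 : r (y + x) ^ 2 * Λ ^ 3 ≤ F * f (y + x) / Λ ^ 3 := by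
          rw [le_div_iff₀ (by positivity)]
          calc _ = r (y + x) ^ 2 * Λ ^ 6 := by ring
            _ ≤ _ := h
        have h3 : c x * r (y + x) ≤ (c x ^ 2 / Λ ^ 3 + r (y + x) ^ 2 * Λ ^ 3) / 2 := by
          have h4 : 0 ≤ (c x / Λ ^ 3 - r (y + x)) ^ 2 * Λ ^ 3 := by positivity
          have h5 : (c x / Λ ^ 3 - r (y + x)) ^ 2 * Λ ^ 3 =
              c x ^ 2 / Λ ^ 3 - 2 * (c x * r (y + x)) + r (y + x) ^ 2 * Λ ^ 3 := by
            field_simp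
            ring
          linarith
        have h6 : 0 ≤ f (y + x) ^ 2 / Λ ^ 6 := by positivity
        have h7 : c x ^ 2 / (2 * Λ ^ 3) = c x ^ 2 / Λ ^ 3 / 2 := by field_simp
        have h8 : F * f (y + x) / (2 * Λ ^ 3) = F * f (y + x) / Λ ^ 3 / 2 := by field_simp
        linarith
      · have h2 : c x * r (y + x) ≤ f (y + x) ^ 2 / Λ ^ 6 := by
          rw [le_div_iff₀ (by positivity)]
          refine le_trans ?_ h
          have := mul_le_mul_of_nonneg_right (hcF x) (hr0 (y + x))
          nlinarith [pow_pos hΛ0 6]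
        have h3 : 0 ≤ c x ^ 2 / (2 * Λ ^ 3) := by positivity
        have h4 : 0 ≤ F * f (y + x) / (2 * Λ ^ 3) := by positivity
        linarith
    have hs1 : ∑ x, f (y + x) = 1 := by
      rw [← hf1]; exact Fintype.sum_equiv (Equiv.addLeft y) _ _ fun x => rfl
    have hs2 : ∑ x, f (y + x) ^ 2 = F :=
      Fintype.sum_equiv (Equiv.addLeft y) _ _ fun x => rfl
    refine (Finset.sum_le_sum fun x _ => h1 x).trans ?_
    rw [Finset.sum_add_distrib, Finset.sum_add_distrib, ← Finset.sum_div, ← Finset.sum_div,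
      ← Finset.sum_div, ← Finset.mul_sum, hs1, hs2, mul_one]
    have h5 : (∑ x, c x ^ 2) / (2 * Λ ^ 3) ≤ F / (2 * Λ ^ 3) := by gcongr
    have h6 : F / Λ ^ 6 ≤ F / Λ ^ 3 := by
      exact div_le_div_of_nonneg_left hFpos.le (by positivity)
        (pow_le_pow_right₀ (by linarith) (by norm_num))
    have h7 : F / (2 * Λ ^ 3) = F / Λ ^ 3 / 2 := by field_simp
    have h8 : 2 * F / Λ ^ 3 = 2 * (F / Λ ^ 3) := by ring
    rw [h7] at h5 ⊢
    linarith
  have hdiff : ∀ x, c x ≤ autocorr m x + (∑ y, r (y + x) * f y) + ∑ y, r (y + -x) * f y := by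
    intro x
    rw [← correlation_neg f r x]
    simp only [c, autocorr]
    rw [← Finset.sum_add_distrib, ← Finset.sum_add_distrib]
    refine Finset.sum_le_sum fun y _ => ?_
    have h1 := hmr (y + x)
    have h2 := hmr y
    have h3 := hm0 y
    have h4 := hr0 (y + x)
    have h5 := hr0 y
    have h6 := hm0 (y + x)
    rw [h1, h2]
    nlinarith [mul_nonneg h4 h5]
  have hcm : ∀ x, autocorr m x ≤ c x := fun x => Finset.sum_le_sum fun y _ => by
    have h1 := hmr (y + x)
    have h2 := hmr y
    exact mul_le_mul (by linarith [hr0 (y + x)]) (by linarith [hr0 y]) (hm0 _) (hf _)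
  have hEm : F ≤ 2 * Λ * ∑ x, autocorr m x ^ 2 := by
    have hA := sum_mul_correlation_le hf hf1 hrsum
    have hA' : ∑ x, c x * ∑ y, r (y + -x) * f y ≤ 2 * F / Λ ^ 3 := by
      refine le_of_eq_of_le ?_ hA
      exact Fintype.sum_equiv (Equiv.neg G) _ _ fun x => by
        simp only [Equiv.neg_apply, hcneg]
    -- With `a = autocorr m x ≤ c`, `c² - a² = (c - a)(c + a) ≤ 2 c (c - a)`, and `hdiff` bounds `c
    -- - a`. The total loss is at most `8 F / Λ ^ 3`, and `Λ ≥ 4` makes `Λ` times it at most `F /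
    -- 2`.
    have h1 : ∀ x, c x ^ 2 ≤ autocorr m x ^ 2 +
        2 * (c x * (∑ y, r (y + x) * f y) + c x * ∑ y, r (y + -x) * f y) := by
      intro x
      have h2 := hdiff x
      have h3 := hcm x
      have h4 := autocorr_nonneg hm0 x
      have h5 := hc0 x
      nlinarith [mul_le_mul_of_nonneg_left h2 h5, mul_le_mul_of_nonneg_right h3 h4,
        mul_nonneg (sub_nonneg.2 h3) (sub_nonneg.2 h3)]
    have h2 := Finset.sum_le_sum fun x (_ : x ∈ Finset.univ) => h1 x
    rw [Finset.sum_add_distrib, ← Finset.mul_sum, Finset.sum_add_distrib] at h2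
    have h3 : Λ * (8 * F / Λ ^ 3) ≤ F / 2 := by
      rw [← mul_div_assoc, div_le_iff₀ (by positivity)]
      nlinarith [mul_pos hFpos hΛ0, mul_pos (mul_pos hFpos hΛ0) hΛ0]
    have h4 : Λ * ∑ x, c x ^ 2 ≤ Λ * (∑ x, autocorr m x ^ 2 + 8 * F / Λ ^ 3) := by
      refine mul_le_mul_of_nonneg_left ?_ hΛ0.le
      have : 8 * F / Λ ^ 3 = 2 * (2 * F / Λ ^ 3 + 2 * F / Λ ^ 3) := by ring
      linarith
    have h5 : F ≤ Λ * ∑ x, c x ^ 2 := hE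
    rw [mul_add] at h4
    linarith
  have hcmQ : ∀ x, autocorr m x ≤ (Λ ^ 6 * F) ^ 2 * diffCount Q x := by
    intro x
    have h1 : diffCount Q x = (Finset.univ.filter fun y => y + x ∈ Q ∧ y ∈ Q).card := by
      refine Finset.card_nbij' (fun p => p.2) (fun y => (y + x, y)) ?_ ?_ ?_ ?_
      · rintro ⟨a, b⟩ h
        simp only [Finset.coe_filter, Finset.mem_product, Set.mem_ofPred_eq] at h
        obtain ⟨⟨ha, hb⟩, rfl⟩ := h
        simp [ha, hb]
      · intro y h
        simpa using h
      · rintro ⟨a, b⟩ h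
        simp only [Finset.coe_filter, Finset.mem_product, Set.mem_ofPred_eq] at h
        obtain ⟨⟨ha, hb⟩, rfl⟩ := h
        simp
      · intro y _
        rfl
    rw [h1, ← Finset.sum_boole, Finset.mul_sum]
    refine Finset.sum_le_sum fun y _ => ?_
    have hle : ∀ z ∈ Q, f z ≤ Λ ^ 6 * F := fun z hz => (Finset.mem_filter.1 hz).2.2
    by_cases h2 : y + x ∈ Q <;> by_cases h3 : y ∈ Q <;> simp only [m, h2, h3] <;> simp
    rw [sq]
    exact mul_le_mul (hle _ h2) (hle _ h3) (hf _) (by positivity)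
  set D := ∑ x, (diffCount Q x : ℝ) ^ 2 with hD
  have hED : F ≤ 2 * Λ * ((Λ ^ 6 * F) ^ 4 * D) := by
    refine hEm.trans (mul_le_mul_of_nonneg_left ?_ (by positivity))
    rw [hD, Finset.mul_sum]
    refine Finset.sum_le_sum fun x _ => ?_
    calc autocorr m x ^ 2 ≤ ((Λ ^ 6 * F) ^ 2 * diffCount Q x) ^ 2 := by
          gcongr
          · exact autocorr_nonneg hm0 x
          · exact hcmQ x
      _ = _ := by ring
  have hED' : 1 ≤ 2 * Λ ^ 25 * F ^ 3 * D := by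
    have h1 : F * 1 ≤ F * (2 * Λ ^ 25 * F ^ 3 * D) := by
      rw [mul_one]
      refine hED.trans_eq ?_
      ring
    exact le_of_mul_le_mul_left h1 hFpos
  have hQF : (Q.card : ℝ) * F ≤ Λ ^ 6 := by
    calc (Q.card : ℝ) * F ≤ ∑ x ∈ Q, Λ ^ 6 * f x := by
          rw [← nsmul_eq_mul]
          exact Finset.card_nsmul_le_sum _ _ _ fun x hx => (Finset.mem_filter.1 hx).2.1
      _ ≤ ∑ x, Λ ^ 6 * f x := Finset.sum_le_sum_of_subset_of_nonneg (Finset.subset_univ _)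
          fun x _ _ => mul_nonneg (by positivity) (hf x)
      _ = Λ ^ 6 := by rw [← Finset.mul_sum, hf1, mul_one]
  have hDQ : D ≤ (Q.card : ℝ) ^ 3 := by
    calc D ≤ ∑ x, (Q.card : ℝ) * diffCount Q x := Finset.sum_le_sum fun x _ => by
          rw [sq]
          exact mul_le_mul_of_nonneg_right (Nat.cast_le.2 (diffCount_le Q x)) (Nat.cast_nonneg _)
      _ = (Q.card : ℝ) ^ 3 := by
          rw [← Finset.mul_sum, ← Nat.cast_sum, sum_diffCount]
          push_cast
          ring
  have hD0 : 0 ≤ D := Finset.sum_nonneg fun _ _ => sq_nonneg _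
  have hQ' : ∀ x ∈ Q, F ≤ Λ ^ 6 * f x := fun x hx => (Finset.mem_filter.1 hx).2.1
  clear_value m r c Q F D
  refine ⟨Q, ?_, hFpos, hQ', ?_, ?_⟩
  · rw [Finset.nonempty_iff_ne_empty]
    intro h
    rw [h] at hDQ
    have : D = 0 := le_antisymm (by simpa using hDQ) hD0
    rw [this] at hED'
    linarith
  · rw [← hD]
    have h1 : (Q.card : ℝ) ^ 3 * F ^ 3 ≤ Λ ^ 18 := by
      calc (Q.card : ℝ) ^ 3 * F ^ 3 = (Q.card * F) ^ 3 := by ring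
        _ ≤ (Λ ^ 6) ^ 3 := by gcongr
        _ = Λ ^ 18 := by ring
    calc (Q.card : ℝ) ^ 3 ≤ Q.card ^ 3 * (2 * Λ ^ 25 * F ^ 3 * D) :=
          le_mul_of_one_le_right (by positivity) hED'
      _ = (Q.card ^ 3 * F ^ 3) * (2 * Λ ^ 25 * D) := by ring
      _ ≤ Λ ^ 18 * (2 * Λ ^ 25 * D) := by gcongr
      _ = 2 * (Λ ^ 43 * D) := by ring
      _ ≤ Λ * (Λ ^ 43 * D) := by gcongr; linarith
      _ = Λ ^ 44 * D := by ring
  · set y := (Q.card : ℝ) * F with hy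
    have hy0 : 0 ≤ y := by positivity
    have h1 : 1 ≤ Λ ^ 26 * y ^ 3 := by
      calc 1 ≤ 2 * Λ ^ 25 * F ^ 3 * D := hED'
        _ ≤ Λ * Λ ^ 25 * F ^ 3 * (Q.card : ℝ) ^ 3 := by gcongr; linarith
        _ = Λ ^ 26 * y ^ 3 := by rw [hy]; ring
    rcases le_total y 1 with h | h
    · refine h1.trans ?_
      gcongr
      exact pow_le_of_le_one hy0 h (by norm_num)
    · have : 1 ≤ Λ ^ 26 := one_le_pow₀ (by linarith)
      nlinarith

end LevelSet

/-! ### Approximate duality from PFR. -/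

section Duality

variable {K : Type} [AddCommGroup K] [Fintype K]

/-- The Fourier transform of a weight on a finite abelian group. -/
noncomputable def weightFourier (p : K → ℝ) (χ : AddChar K ℂ) : ℂ := ∑ x, (p x : ℂ) * χ x

theorem norm_weightFourier_le_one {p : K → ℝ} (hp : ∀ x, 0 ≤ p x) (hp1 : ∑ x, p x = 1)
    (χ : AddChar K ℂ) : ‖weightFourier p χ‖ ≤ 1 := by
  rw [← hp1]
  refine (norm_sum_le _ _).trans (Finset.sum_le_sum fun x _ => ?_)
  rw [norm_mul, χ.norm_apply, mul_one, Complex.norm_real, Real.norm_of_nonneg (hp x)]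

theorem exists_phase (z : ℂ) : ∃ u : ℂ, ‖u‖ = 1 ∧ u * z = ‖z‖ := by
  by_cases hz : z = 0
  · exact ⟨1, by simp, by simp [hz]⟩
  · have hz' : (‖z‖ : ℂ) ≠ 0 := by simpa using hz
    refine ⟨‖z‖ / z, ?_, by field_simp⟩
    rw [norm_div, Complex.norm_real, norm_norm, div_self (by simpa using hz)]

/-- Large values of a Fourier transform persist on differences. -/
theorem sq_mass_le_sum_autocorr {p : K → ℝ} (hp : ∀ x, 0 ≤ p x) (hp1 : ∑ x, p x = 1)
    {f : AddChar K ℂ → ℝ} (hf : ∀ χ, 0 ≤ f χ) {δ : ℝ} (hδ : 0 ≤ δ)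
    (hsupp : ∀ χ, f χ ≠ 0 → δ ≤ ‖weightFourier p χ‖) :
    (δ * ∑ χ, f χ) ^ 2 ≤ ∑ ξ, autocorr f ξ * ‖weightFourier p ξ‖ := by
  choose u hu huz using fun χ => exists_phase (weightFourier p χ)
  -- The phases `u` make every `û(χ) p̂(χ)` positive, so `δ ∑ f ≤ ∑ p |g|`. Cauchy–Schwarz in `p`
  -- and expanding `|g|²` bring in `p̂` at differences of characters.
  let g : K → ℂ := fun x => ∑ χ, (f χ : ℂ) * u χ * χ x
  have h1 : δ * ∑ χ, f χ ≤ ∑ x, p x * ‖g x‖ := by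
    have h2 : δ * ∑ χ, f χ ≤ ∑ χ, f χ * ‖weightFourier p χ‖ := by
      rw [Finset.mul_sum]
      refine Finset.sum_le_sum fun χ _ => ?_
      by_cases h : f χ = 0
      · simp [h]
      · rw [mul_comm]
        exact mul_le_mul_of_nonneg_left (hsupp χ h) (hf χ)
    have h3 : ((∑ χ, f χ * ‖weightFourier p χ‖ : ℝ) : ℂ) = ∑ x, (p x : ℂ) * g x := by
      push_cast
      simp only [g, Finset.mul_sum]
      rw [Finset.sum_comm]
      refine Finset.sum_congr rfl fun χ _ => ?_
      rw [← huz, weightFourier, Finset.mul_sum, Finset.mul_sum]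
      exact Finset.sum_congr rfl fun x _ => by ring
    have h4 : 0 ≤ ∑ χ, f χ * ‖weightFourier p χ‖ :=
      Finset.sum_nonneg fun χ _ => mul_nonneg (hf χ) (norm_nonneg _)
    refine h2.trans ?_
    rw [← Real.norm_of_nonneg h4, ← Complex.norm_real, h3]
    refine (norm_sum_le _ _).trans_eq (Finset.sum_congr rfl fun x _ => ?_)
    rw [norm_mul, Complex.norm_real, Real.norm_of_nonneg (hp x)]
  have h5 : (∑ x, p x * ‖g x‖) ^ 2 ≤ ∑ x, p x * ‖g x‖ ^ 2 :=
    Real.pow_arith_mean_le_arith_mean_pow _ _ _ (fun x _ => hp x) hp1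
      (fun x _ => norm_nonneg _) 2
  have h6 : ((∑ x, p x * ‖g x‖ ^ 2 : ℝ) : ℂ) =
      ∑ χ', ∑ ξ, (f (χ' + ξ) * f χ' : ℝ) * (u (χ' + ξ) * (starRingEnd ℂ) (u χ')) *
        weightFourier p ξ := by
    have h7 : ∀ x, ((p x * ‖g x‖ ^ 2 : ℝ) : ℂ) = ∑ χ', ∑ ξ, (f (χ' + ξ) * f χ' : ℝ) *
        (u (χ' + ξ) * (starRingEnd ℂ) (u χ')) * (p x * ξ x) := by
      intro x
      have h8 : ((‖g x‖ ^ 2 : ℝ) : ℂ) = g x * (starRingEnd ℂ) (g x) := by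
        rw [Complex.mul_conj, Complex.normSq_eq_norm_sq]
      rw [Complex.ofReal_mul, h8]
      simp only [g, map_sum, map_mul, Complex.conj_ofReal]
      rw [Finset.mul_sum, Finset.mul_sum]
      refine Finset.sum_congr rfl fun χ' _ => ?_
      rw [Finset.sum_mul, Finset.mul_sum]
      refine Eq.symm (Fintype.sum_equiv (Equiv.addLeft χ') _ _ fun ξ => ?_)
      have h9 : χ' x * (starRingEnd ℂ) (χ' x) = 1 := by
        rw [Complex.mul_conj, Complex.normSq_eq_norm_sq, χ'.norm_apply]
        simp
      simp only [Equiv.coe_addLeft, AddChar.add_apply]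
      push_cast
      linear_combination (-(p x : ℂ) * f (χ' + ξ) * f χ' * u (χ' + ξ) *
        (starRingEnd ℂ) (u χ') * ξ x) * h9
    rw [Complex.ofReal_sum]
    simp only [h7]
    rw [Finset.sum_comm]
    refine Finset.sum_congr rfl fun χ' _ => ?_
    rw [Finset.sum_comm]
    refine Finset.sum_congr rfl fun ξ _ => ?_
    rw [weightFourier, Finset.mul_sum]
  have h10 : 0 ≤ ∑ x, p x * ‖g x‖ ^ 2 :=
    Finset.sum_nonneg fun x _ => mul_nonneg (hp x) (sq_nonneg _)
  have h0 : 0 ≤ δ * ∑ χ, f χ := mul_nonneg hδ (Finset.sum_nonneg fun χ _ => hf χ)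
  calc (δ * ∑ χ, f χ) ^ 2 ≤ (∑ x, p x * ‖g x‖) ^ 2 := by gcongr
    _ ≤ ∑ x, p x * ‖g x‖ ^ 2 := h5
    _ = ‖((∑ x, p x * ‖g x‖ ^ 2 : ℝ) : ℂ)‖ := by
        rw [Complex.norm_real, Real.norm_of_nonneg h10]
    _ ≤ ∑ χ', ∑ ξ, f (χ' + ξ) * f χ' * ‖weightFourier p ξ‖ := by
        rw [h6]
        refine (norm_sum_le _ _).trans (Finset.sum_le_sum fun χ' _ =>
          (norm_sum_le _ _).trans (Finset.sum_le_sum fun ξ _ => ?_))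
        rw [norm_mul, norm_mul, norm_mul, RCLike.norm_conj, hu, hu, mul_one, mul_one,
          Complex.norm_real, Real.norm_of_nonneg (mul_nonneg (hf _) (hf _))]
    _ = ∑ ξ, autocorr f ξ * ‖weightFourier p ξ‖ := by
        rw [Finset.sum_comm]
        refine Finset.sum_congr rfl fun ξ _ => ?_
        rw [autocorr, Finset.sum_mul]

section CosetMass

variable {A : Type*} [AddCommGroup A] [Fintype A]

open Classical in
/-- The mass that a weight gives to the coset `a + H`. -/
noncomputable def cosetMass (q : A → ℝ) (H : AddSubgroup A) (a : A) : ℝ :=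
  ∑ x, if x - a ∈ H then q x else 0

theorem cosetMass_mono {f q : A → ℝ} (h : ∀ x, f x ≤ q x) (H : AddSubgroup A) (a : A) :
    cosetMass f H a ≤ cosetMass q H a :=
  Finset.sum_le_sum fun x _ => by split_ifs; exacts [h x, le_rfl]

/-- The right side is an `f`-weighted combination of coset masses of `f`; hence autocorrelating a
weight of mass at most 1 never increases the maximal coset mass. -/
theorem cosetMass_autocorr (f : A → ℝ) (H : AddSubgroup A) (a : A) :
    cosetMass (autocorr f) H a = ∑ y, f y * cosetMass f H (y + a) := by
  classical
  have h1 : ∀ x, (if x - a ∈ H then autocorr f x else 0) =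
      ∑ y, f y * if x - a ∈ H then f (y + x) else 0 := by
    intro x
    split_ifs with h
    · exact Finset.sum_congr rfl fun y _ => mul_comm _ _
    · simp
  simp only [cosetMass, h1]
  rw [Finset.sum_comm]
  refine Finset.sum_congr rfl fun y _ => ?_
  rw [← Finset.mul_sum]
  congr 1
  refine Fintype.sum_equiv (Equiv.addLeft y) _ _ fun x => ?_
  simp only [Equiv.coe_addLeft, add_sub_add_left_eq_sub]

end CosetMass

/-- The weights produced by the iteration: supported where the Fourier transform of `p` is at least
`δ`, of total mass at least `δ`, and no more concentrated on cosets than `q`. -/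
structure SpectralWeight (p : K → ℝ) (q : AddChar K ℂ → ℝ) (δ : ℝ) (f : AddChar K ℂ → ℝ) :
    Prop where
  nonneg : ∀ χ, 0 ≤ f χ
  sum_le_one : ∑ χ, f χ ≤ 1
  le_sum : δ ≤ ∑ χ, f χ
  supp : ∀ χ, f χ ≠ 0 → δ ≤ ‖weightFourier p χ‖
  coset : ∀ (H : AddSubgroup (AddChar K ℂ)) (B : ℝ), (∀ χ, cosetMass q H χ ≤ B) →
    ∀ χ, cosetMass f H χ ≤ B

theorem SpectralWeight.mono {p : K → ℝ} {q f : AddChar K ℂ → ℝ} {δ δ' : ℝ}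
    (h : SpectralWeight p q δ f) (hδ : δ' ≤ δ) : SpectralWeight p q δ' f :=
  ⟨h.nonneg, h.sum_le_one, hδ.trans h.le_sum, fun χ hχ => hδ.trans (h.supp χ hχ), h.coset⟩

/-- The autocorrelation of `f` is cut at spectral level `δ² / 2`: the part below accounts for at
most half of the lower bound in `sq_mass_le_sum_autocorr`. Since `δ ≤ 1/2`, the single parameter `δ
^ 5` bounds both the new level and the new mass from below. -/
theorem SpectralWeight.exists_step {p : K → ℝ} (hp : ∀ x, 0 ≤ p x) (hp1 : ∑ x, p x = 1)
    {q f : AddChar K ℂ → ℝ} {δ : ℝ} (hδ0 : 0 < δ) (hδ : δ ≤ 1 / 2)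
    (h : SpectralWeight p q δ f) :
    ∃ f', SpectralWeight p q (δ ^ 5) f' ∧ (∀ χ, f' χ ≤ autocorr f χ) ∧
      δ ^ 2 / 2 * (∑ χ, f χ) ^ 2 ≤ ∑ χ, f' χ := by
  classical
  set m := ∑ χ, f χ with hm
  let f' : AddChar K ℂ → ℝ := fun ξ =>
    if δ ^ 2 / 2 ≤ ‖weightFourier p ξ‖ then autocorr f ξ else 0
  have hc0 := autocorr_nonneg h.nonneg
  have hle : ∀ χ, f' χ ≤ autocorr f χ := fun χ => by
    simp only [f']; split_ifs; exacts [le_rfl, hc0 χ]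
  have hm0 : 0 < m := hδ0.trans_le h.le_sum
  have hmass : δ ^ 2 / 2 * m ^ 2 ≤ ∑ χ, f' χ := by
    have h1 := sq_mass_le_sum_autocorr hp hp1 h.nonneg hδ0.le h.supp
    have h2 : ∀ ξ, autocorr f ξ * ‖weightFourier p ξ‖ ≤ f' ξ + δ ^ 2 / 2 * autocorr f ξ := by
      intro ξ
      have h3 := norm_weightFourier_le_one hp hp1 ξ
      have h4 := hc0 ξ
      have h6 := norm_nonneg (weightFourier p ξ)
      simp only [f']
      split_ifs with h5
      · nlinarith [mul_nonneg (sq_nonneg δ) h4]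
      · nlinarith
    have h3 := h1.trans (Finset.sum_le_sum fun ξ _ => h2 ξ)
    rw [Finset.sum_add_distrib, ← Finset.mul_sum, sum_autocorr, ← hm] at h3
    nlinarith
  have hδ5 : δ ^ 5 ≤ δ ^ 2 / 2 * δ ^ 2 := by nlinarith [pow_pos hδ0 4]
  refine ⟨f', ⟨fun χ => ?_, ?_, ?_, ?_, ?_⟩, hle, hmass⟩
  · simp only [f']; split_ifs; exacts [hc0 χ, le_rfl]
  · calc ∑ χ, f' χ ≤ ∑ χ, autocorr f χ := Finset.sum_le_sum fun χ _ => hle χ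
      _ = m ^ 2 := sum_autocorr f
      _ ≤ 1 := pow_le_one₀ hm0.le h.sum_le_one
  · refine hδ5.trans (le_trans ?_ hmass)
    have := h.le_sum
    gcongr
  · intro χ hχ
    by_contra hlt
    apply hχ
    simp only [f']
    rw [if_neg]
    intro h2
    apply hlt
    refine le_trans (hδ5.trans ?_) h2
    have : δ ^ 2 ≤ 1 := pow_le_one₀ hδ0.le (by linarith)
    exact mul_le_of_le_one_right (by positivity) this
  · intro H B hB χ
    have hB0 : 0 ≤ B := by
      refine le_trans ?_ (h.coset H B hB 0)
      exact Finset.sum_nonneg fun x _ => by split_ifs; exacts [h.nonneg x, le_rfl]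
    refine (cosetMass_mono hle H χ).trans ?_
    rw [cosetMass_autocorr]
    calc ∑ y, f y * cosetMass f H (y + χ) ≤ ∑ y, f y * B :=
          Finset.sum_le_sum fun y _ => mul_le_mul_of_nonneg_left (h.coset H B hB _) (h.nonneg y)
      _ = m * B := by rw [← Finset.sum_mul]
      _ ≤ B := mul_le_of_le_one_left hB0 h.sum_le_one

/-- Pigeonholing over the iteration gives a spectral weight with large additive energy. -/
theorem SpectralWeight.exists_large_energy {p : K → ℝ} (hp : ∀ x, 0 ≤ p x) (hp1 : ∑ x, p x = 1)
    {q : AddChar K ℂ → ℝ} {R : ℝ} (hR : 1 ≤ R) (s : ℕ) :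
    ∀ {f : AddChar K ℂ → ℝ} {δ : ℝ}, 0 < δ → δ ≤ 1 / 2 → SpectralWeight p q δ f →
      (∑ χ, f χ ^ 2) * Fintype.card K ≤ R ^ s * (∑ χ, f χ) ^ 2 →
      ∃ g, SpectralWeight p q (δ ^ 5 ^ s) g ∧
        (∑ χ, g χ ^ 2) * (∑ χ, g χ) ^ 2 * (δ ^ 5 ^ s) ^ 4 ≤ 4 * R * ∑ χ, autocorr g χ ^ 2 := by
  induction s with
  | zero =>
    intro f δ hδ0 hδ h hfX
    obtain ⟨f', hf', hle, hmass⟩ := h.exists_step hp hp1 hδ0 hδ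
    rw [pow_zero, one_mul] at hfX
    rw [pow_zero, pow_one]
    refine ⟨f, h, ?_⟩
    set m := ∑ χ, f χ with hm
    set m' := ∑ χ, f' χ with hm'
    have hm0 : 0 < m := hδ0.trans_le h.le_sum
    -- The dual group has `|K|` elements, so Cauchy–Schwarz bounds `‖f'‖₂²` from below; with no room
    -- left for a drop, the energy is already large.
    have h1 : m' ^ 2 ≤ (Fintype.card K : ℝ) * ∑ χ, f' χ ^ 2 := by
      have := sq_sum_le_card_mul_sum_sq (s := Finset.univ) (f := f')
      rwa [Finset.card_univ, AddChar.card_eq] at this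
    have h2 : ∑ χ, f' χ ^ 2 ≤ ∑ χ, autocorr f χ ^ 2 :=
      Finset.sum_le_sum fun χ _ => pow_le_pow_left₀ (hf'.nonneg χ) (hle χ) 2
    have h3 : (δ ^ 2 / 2 * m ^ 2) ^ 2 ≤ m' ^ 2 := by gcongr
    have hX : (0 : ℝ) < Fintype.card K := by exact_mod_cast Fintype.card_pos
    have hF0 : 0 ≤ ∑ χ, f χ ^ 2 := Finset.sum_nonneg fun _ _ => sq_nonneg _
    have h4 : δ ^ 4 / 4 * m ^ 2 * ((∑ χ, f χ ^ 2) * Fintype.card K) ≤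
        (Fintype.card K : ℝ) * ∑ χ, autocorr f χ ^ 2 := by
      calc δ ^ 4 / 4 * m ^ 2 * ((∑ χ, f χ ^ 2) * Fintype.card K)
          ≤ δ ^ 4 / 4 * m ^ 2 * m ^ 2 := by gcongr
        _ = (δ ^ 2 / 2 * m ^ 2) ^ 2 := by ring
        _ ≤ (Fintype.card K : ℝ) * ∑ χ, f' χ ^ 2 := h3.trans h1
        _ ≤ _ := by gcongr
    have h5 : δ ^ 4 / 4 * m ^ 2 * (∑ χ, f χ ^ 2) ≤ ∑ χ, autocorr f χ ^ 2 := by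
      refine le_of_mul_le_mul_left ?_ hX
      linarith
    have h6 : 0 ≤ ∑ χ, autocorr f χ ^ 2 := Finset.sum_nonneg fun _ _ => sq_nonneg _
    nlinarith
  | succ s ih =>
    intro f δ hδ0 hδ h hfX
    obtain ⟨f', hf', hle, hmass⟩ := h.exists_step hp hp1 hδ0 hδ
    set m := ∑ χ, f χ with hm
    set m' := ∑ χ, f' χ with hm'
    have hm0 : 0 < m := hδ0.trans_le h.le_sum
    have hF0 : 0 ≤ ∑ χ, f χ ^ 2 := Finset.sum_nonneg fun _ _ => sq_nonneg _
    have hX : (0 : ℝ) < Fintype.card K := by exact_mod_cast Fintype.card_pos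
    -- Either `‖f‖₂² / m²` drops by at most a factor `R`, and `f' ≤ autocorr f` gives large energy
    -- for `f`, or it drops by more and one power of `R` in the invariant is used up.
    rcases le_or_gt (m' ^ 2 * ∑ χ, f χ ^ 2) (R * m ^ 2 * ∑ χ, f' χ ^ 2) with hgood | hbad
    · have hδ' : δ ^ 5 ^ (s + 1) ≤ δ :=
        pow_le_of_le_one hδ0.le (by linarith) (pow_ne_zero _ (by norm_num))
      refine ⟨f, h.mono hδ', ?_⟩
      have h2 : ∑ χ, f' χ ^ 2 ≤ ∑ χ, autocorr f χ ^ 2 :=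
        Finset.sum_le_sum fun χ _ => pow_le_pow_left₀ (hf'.nonneg χ) (hle χ) 2
      have h3 : (δ ^ 2 / 2 * m ^ 2) ^ 2 ≤ m' ^ 2 := by gcongr
      have h4 : m ^ 2 * (δ ^ 4 * m ^ 2 * ∑ χ, f χ ^ 2) ≤
          m ^ 2 * (4 * R * ∑ χ, autocorr f χ ^ 2) := by
        calc m ^ 2 * (δ ^ 4 * m ^ 2 * ∑ χ, f χ ^ 2)
            = 4 * ((δ ^ 2 / 2 * m ^ 2) ^ 2 * ∑ χ, f χ ^ 2) := by ring
          _ ≤ 4 * (m' ^ 2 * ∑ χ, f χ ^ 2) := by gcongr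
          _ ≤ 4 * (R * m ^ 2 * ∑ χ, f' χ ^ 2) := by gcongr
          _ ≤ 4 * (R * m ^ 2 * ∑ χ, autocorr f χ ^ 2) := by gcongr
          _ = _ := by ring
      have h5 := le_of_mul_le_mul_left h4 (by positivity)
      have h6 : (δ ^ 5 ^ (s + 1)) ^ 4 ≤ δ ^ 4 := by gcongr
      calc _ ≤ (∑ χ, f χ ^ 2) * m ^ 2 * δ ^ 4 := by gcongr
        _ = δ ^ 4 * m ^ 2 * ∑ χ, f χ ^ 2 := by ring
        _ ≤ _ := h5
    · have hδ5 : δ ^ 5 ≤ 1 / 2 :=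
        (pow_le_of_le_one hδ0.le (by linarith) (by norm_num)).trans hδ
      have hnext : (∑ χ, f' χ ^ 2) * Fintype.card K ≤ R ^ s * m' ^ 2 := by
        have h1 : R * m ^ 2 * ((∑ χ, f' χ ^ 2) * Fintype.card K) ≤
            R * m ^ 2 * (R ^ s * m' ^ 2) := by
          calc R * m ^ 2 * ((∑ χ, f' χ ^ 2) * Fintype.card K)
              = (R * m ^ 2 * ∑ χ, f' χ ^ 2) * Fintype.card K := by ring
            _ ≤ (m' ^ 2 * ∑ χ, f χ ^ 2) * Fintype.card K := by gcongr
            _ = m' ^ 2 * ((∑ χ, f χ ^ 2) * Fintype.card K) := by ring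
            _ ≤ m' ^ 2 * (R ^ (s + 1) * m ^ 2) := by gcongr
            _ = _ := by ring
        exact le_of_mul_le_mul_left h1 (by positivity)
      obtain ⟨g, hg, hgE⟩ := ih (by positivity) hδ5 hf' hnext
      have hpow : (δ ^ 5) ^ 5 ^ s = δ ^ 5 ^ (s + 1) := by rw [← pow_mul, pow_succ']
      rw [hpow] at hg hgE
      exact ⟨g, hg, hgE⟩

end Duality

section Duality

variable {K : Type} [AddCommGroup K]

/-- The elements of `K` on which all the characters in `H` are trivial. -/
def charAnnihilator (H : AddSubgroup (AddChar K ℂ)) : AddSubgroup K where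
  carrier := {x | ∀ η ∈ H, η x = 1}
  zero_mem' := fun η _ => η.map_zero_eq_one
  add_mem' := fun {x y} hx hy η hη => by rw [AddChar.map_add_eq_mul, hx η hη, hy η hη, one_mul]
  neg_mem' := fun {x} hx η hη => by rw [AddChar.map_neg_eq_inv, hx η hη, inv_one]

theorem mem_charAnnihilator {H : AddSubgroup (AddChar K ℂ)} {x : K} :
    x ∈ charAnnihilator H ↔ ∀ η ∈ H, η x = 1 := Iff.rfl

variable [Fintype K]

open Classical in
theorem sum_subgroup_char (H : AddSubgroup (AddChar K ℂ)) (x : K) :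
    ∑ η : H, (η : AddChar K ℂ) x = if x ∈ charAnnihilator H then (Nat.card H : ℂ) else 0 := by
  have h := AddChar.sum_eq_ite
    ((AddChar.doubleDualEmb x : AddChar (AddChar K ℂ) ℂ).compAddMonoidHom H.subtype)
  have h0 : (AddChar.doubleDualEmb x : AddChar (AddChar K ℂ) ℂ).compAddMonoidHom H.subtype = 0 ↔
      x ∈ charAnnihilator H := by
    rw [AddChar.eq_zero_iff, mem_charAnnihilator]
    simp
  simp only [AddChar.compAddMonoidHom_apply, AddSubgroup.coe_subtype,
    AddChar.doubleDualEmb_apply, h0] at h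
  rw [h, Nat.card_eq_fintype_card]

/-- Sum `η x` over all `x` and all `η ∈ H` in both orders; orthogonality in each variable gives in
fact equality. -/
theorem card_mul_card_charAnnihilator_le (H : AddSubgroup (AddChar K ℂ)) :
    Nat.card H * Nat.card (charAnnihilator H) ≤ Nat.card K := by
  classical
  have h1 : ∑ x : K, ∑ η : H, (η : AddChar K ℂ) x =
      (Nat.card (charAnnihilator H) : ℂ) * Nat.card H := by
    simp only [sum_subgroup_char]
    rw [← Finset.sum_filter, Finset.sum_const, nsmul_eq_mul]
    congr 2
    rw [Nat.card_eq_fintype_card, Fintype.card_subtype]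
  have h2 : ∑ x : K, ∑ η : H, (η : AddChar K ℂ) x = (Nat.card K : ℂ) := by
    rw [Finset.sum_comm, Finset.sum_eq_single 0]
    · simp
    · intro η _ hη
      rw [AddChar.sum_eq_zero_iff_ne_zero]
      exact fun h => hη (Subtype.ext h)
    · simp
  rw [h2] at h1
  have h3 : Nat.card K = Nat.card (charAnnihilator H) * Nat.card H := by exact_mod_cast h1
  rw [h3, mul_comm]

open Classical in
-- Expanding the squares and summing over `H` leaves only pairs `x, y` in the same coset of the
-- annihilator, each with factor `|H|`.
theorem sum_coset_norm_sq_le {p : K → ℝ} (hp : ∀ x, 0 ≤ p x) (hp1 : ∑ x, p x = 1)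
    (H : AddSubgroup (AddChar K ℂ)) (t : AddChar K ℂ) {B : ℝ}
    (hB : ∀ x, cosetMass p (charAnnihilator H) x ≤ B) :
    ∑ η : H, ‖weightFourier p (t + η)‖ ^ 2 ≤ Nat.card H * B := by
  have h1 : ((∑ η : H, ‖weightFourier p (t + η)‖ ^ 2 : ℝ) : ℂ) =
      ∑ y, ∑ x, (p x * p y : ℝ) * t (x - y) * ∑ η : H, (η : AddChar K ℂ) (x - y) := by
    have h2 : ∀ η : H, ((‖weightFourier p (t + η)‖ ^ 2 : ℝ) : ℂ) =
        ∑ y, ∑ x, (p x * p y : ℝ) * t (x - y) * (η : AddChar K ℂ) (x - y) := by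
      intro η
      have h3 : ((‖weightFourier p (t + η)‖ ^ 2 : ℝ) : ℂ) =
          weightFourier p (t + η) * (starRingEnd ℂ) (weightFourier p (t + η)) := by
        rw [Complex.mul_conj, Complex.normSq_eq_norm_sq]
      rw [h3, weightFourier, map_sum, Finset.mul_sum]
      refine Finset.sum_congr rfl fun y _ => ?_
      rw [Finset.sum_mul]
      refine Finset.sum_congr rfl fun x _ => ?_
      rw [map_mul, Complex.conj_ofReal, ← AddChar.map_neg_eq_conj, AddChar.add_apply,
        AddChar.add_apply, sub_eq_add_neg, AddChar.map_add_eq_mul, AddChar.map_add_eq_mul]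
      push_cast
      ring
    rw [Complex.ofReal_sum]
    simp only [h2]
    rw [Finset.sum_comm]
    refine Finset.sum_congr rfl fun y _ => ?_
    rw [Finset.sum_comm]
    exact Finset.sum_congr rfl fun x _ => (Finset.mul_sum _ _ _).symm
  have h0 : 0 ≤ ∑ η : H, ‖weightFourier p (t + η)‖ ^ 2 :=
    Finset.sum_nonneg fun _ _ => sq_nonneg _
  calc ∑ η : H, ‖weightFourier p (t + η)‖ ^ 2
      = ‖((∑ η : H, ‖weightFourier p (t + η)‖ ^ 2 : ℝ) : ℂ)‖ := by
        rw [Complex.norm_real, Real.norm_of_nonneg h0]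
    _ ≤ ∑ y, ∑ x, p x * p y * (if x - y ∈ charAnnihilator H then (Nat.card H : ℝ) else 0) := by
        rw [h1]
        refine (norm_sum_le _ _).trans (Finset.sum_le_sum fun y _ =>
          (norm_sum_le _ _).trans_eq (Finset.sum_congr rfl fun x _ => ?_))
        rw [sum_subgroup_char, norm_mul, norm_mul, Complex.norm_real,
          Real.norm_of_nonneg (mul_nonneg (hp x) (hp y)), t.norm_apply, mul_one]
        split_ifs <;> simp
    _ = ∑ y, p y * (Nat.card H * cosetMass p (charAnnihilator H) y) := by
        refine Finset.sum_congr rfl fun y _ => ?_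
        rw [cosetMass, Finset.mul_sum, Finset.mul_sum]
        refine Finset.sum_congr rfl fun x _ => ?_
        split_ifs <;> ring
    _ ≤ ∑ y, p y * (Nat.card H * B) := by
        refine Finset.sum_le_sum fun y _ => mul_le_mul_of_nonneg_left
          (mul_le_mul_of_nonneg_left (hB y) (Nat.cast_nonneg _)) (hp y)
    _ = Nat.card H * B := by rw [← Finset.sum_mul, hp1, one_mul]

theorem cosetMass_eq_sum {A : Type*} [AddCommGroup A] [Fintype A] (q : A → ℝ) (H : AddSubgroup A)
    [Fintype H] (a : A) : cosetMass q H a = ∑ η : H, q (a + η) := by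
  classical
  rw [cosetMass, ← Finset.sum_filter]
  symm
  refine Finset.sum_bij (fun (η : H) _ => a + (η : A)) (fun η _ => by simp) (fun x _ y _ h => ?_)
    (fun x hx => ⟨⟨x - a, (Finset.mem_filter.1 hx).2⟩, Finset.mem_univ _, by simp⟩)
    fun _ _ => rfl
  exact Subtype.ext (add_left_cancel h)

/-- A cover of a set by few cosets contains a coset on which a given weight is large. -/
theorem exists_cosetMass_ge {A : Type*} [AddCommGroup A] [Fintype A] {q : A → ℝ}
    (hq : ∀ x, 0 ≤ q x) (H : AddSubgroup A) (P T : Finset A) (hP : P.Nonempty)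
    (hcov : ∀ x ∈ P, ∃ t ∈ T, x - t ∈ H) :
    ∃ t, ∑ x ∈ P, q x ≤ T.card * cosetMass q H t := by
  classical
  obtain ⟨x₀, hx₀⟩ := hP
  obtain ⟨t₀, ht₀, -⟩ := hcov x₀ hx₀
  obtain ⟨t, -, ht⟩ := Finset.exists_max_image T (cosetMass q H) ⟨t₀, ht₀⟩
  refine ⟨t, ?_⟩
  calc ∑ x ∈ P, q x ≤ ∑ x, ∑ t ∈ T, if x - t ∈ H then q x else 0 := by
        refine (Finset.sum_le_sum fun x hx => ?_).trans
          (Finset.sum_le_sum_of_subset_of_nonneg (Finset.subset_univ P) fun x _ _ =>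
            Finset.sum_nonneg fun t _ => by split_ifs; exacts [hq x, le_rfl])
        obtain ⟨t, ht, hxt⟩ := hcov x hx
        refine le_trans ?_ (Finset.single_le_sum (f := fun t => if x - t ∈ H then q x else 0)
          (fun t _ => by split_ifs; exacts [hq x, le_rfl]) ht)
        simp [hxt]
    _ = ∑ t ∈ T, cosetMass q H t := by rw [Finset.sum_comm]; rfl
    _ ≤ T.card * cosetMass q H t := by
        rw [← nsmul_eq_mul]
        exact Finset.sum_le_card_nsmul _ _ _ ht

/-- **Approximate duality**: a biased bilinear form is trivial on large cosets. -/
theorem PFRConjectureOver.exists_approx_duality {M : ℕ} (hM : 0 < M) (h : PFRConjectureOver M) :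
    ∃ C : ℕ, ∀ (K : Type) [AddCommGroup K] [Fintype K], (∀ x : K, M • x = 0) →
      ∀ (p : K → ℝ) (q : AddChar K ℂ → ℝ), (∀ x, 0 ≤ p x) → ∑ x, p x = 1 → (∀ χ, 0 ≤ q χ) →
      ∑ χ, q χ = 1 → ∀ (δ R : ℝ) (s : ℕ), 0 < δ → δ ≤ 1 / 2 → 1 ≤ R →
      (Fintype.card K : ℝ) ≤ R ^ s →
      2 * δ ≤ ‖∑ χ, (q χ : ℂ) * weightFourier p χ‖ →
      ∃ (H : AddSubgroup (AddChar K ℂ)) (x₀ : K) (χ₀ : AddChar K ℂ),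
        1 ≤ (4 * R / δ ^ (6 * 5 ^ s)) ^ C * cosetMass p (charAnnihilator H) x₀ ∧
        1 ≤ (4 * R / δ ^ (6 * 5 ^ s)) ^ C * cosetMass q H χ₀ := by
  classical
  obtain ⟨c, hc⟩ := h.of_exponent hM
  -- `1937 = 44 · 44 + 1`: the doubling constant is `Λ ^ (44 · 44)` and one more `Λ` absorbs the 2
  -- of PFR. `121 = 26 + 88 + 6 + 1` collects the losses from the size of `Q`, from `P ⊆ Q`, from
  -- the level set, and from the mass `θ`.
  refine ⟨1937 * c + 121, ?_⟩
  intro K _ _ hK p q hp hp1 hq hq1 δ R s hδ0 hδ hR hKR hbias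
  have hGexp : ∀ χ : AddChar K ℂ, M • χ = 0 := fun χ => by
    ext x
    rw [AddChar.nsmul_apply, ← AddChar.map_nsmul_eq_pow, hK, AddChar.map_zero_eq_one,
      AddChar.zero_apply]
  let f₀ : AddChar K ℂ → ℝ := fun χ => if δ ≤ ‖weightFourier p χ‖ then q χ else 0
  have hf₀q : ∀ χ, f₀ χ ≤ q χ := fun χ => by
    simp only [f₀]; split_ifs; exacts [le_rfl, hq χ]
  have hf₀0 : ∀ χ, 0 ≤ f₀ χ := fun χ => by
    simp only [f₀]; split_ifs; exacts [hq χ, le_rfl]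
  have hf₀m : δ ≤ ∑ χ, f₀ χ := by
    have h1 : 2 * δ ≤ ∑ χ, (f₀ χ + δ * q χ) := by
      refine hbias.trans ((norm_sum_le _ _).trans (Finset.sum_le_sum fun χ _ => ?_))
      rw [norm_mul, Complex.norm_real, Real.norm_of_nonneg (hq χ)]
      have h2 := norm_weightFourier_le_one hp hp1 χ
      have h3 := hq χ
      simp only [f₀]
      split_ifs with h4
      · nlinarith [mul_nonneg hδ0.le h3]
      · nlinarith
    rw [Finset.sum_add_distrib, ← Finset.mul_sum, hq1] at h1
    linarith
  have hf₀ : SpectralWeight p q δ f₀ := by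
    refine ⟨hf₀0, ?_, hf₀m, fun χ hχ => ?_, fun H B hB χ => (cosetMass_mono hf₀q H χ).trans (hB χ)⟩
    · rw [← hq1]; exact Finset.sum_le_sum fun χ _ => hf₀q χ
    · by_contra hlt
      exact hχ (by simp [f₀, hlt])
  have hstart : (∑ χ, f₀ χ ^ 2) * Fintype.card K ≤ R ^ s * (∑ χ, f₀ χ) ^ 2 := by
    have h1 : ∑ χ, f₀ χ ^ 2 ≤ (∑ χ, f₀ χ) ^ 2 :=
      Finset.sum_sq_le_sq_sum_of_nonneg fun χ _ => hf₀0 χ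
    rw [mul_comm]
    exact mul_le_mul hKR h1 (Finset.sum_nonneg fun _ _ => sq_nonneg _) (by positivity)
  obtain ⟨g, hg, hgE⟩ := hf₀.exists_large_energy hp hp1 hR s hδ0 hδ hstart
  set θ := δ ^ 5 ^ s with hθ
  set m := ∑ χ, g χ with hm
  have hθ0 : 0 < θ := by positivity
  have hθ1 : θ ≤ 1 := pow_le_one₀ hδ0.le (by linarith)
  have hm0 : 0 < m := hθ0.trans_le hg.le_sum
  have hδ6 : δ ^ (6 * 5 ^ s) = θ ^ 6 := by rw [hθ, ← pow_mul, mul_comm]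
  rw [hδ6]
  set Λ := 4 * R / θ ^ 6 with hΛdef
  have hΛθ : Λ * θ ^ 6 = 4 * R := by rw [hΛdef]; field_simp
  have hΛ4 : 4 ≤ Λ := by
    rw [hΛdef, le_div_iff₀ (by positivity)]
    have : θ ^ 6 ≤ 1 := pow_le_one₀ hθ0.le hθ1
    linarith
  have hΛ0 : 0 < Λ := by linarith
  have hΛθ2 : ∀ k ≤ 6, 1 ≤ Λ * θ ^ k := by
    intro k hk
    have h1 : θ ^ 6 ≤ θ ^ k := pow_le_pow_of_le_one hθ0.le hθ1 hk
    have h2 := mul_le_mul_of_nonneg_left h1 hΛ0.le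
    linarith
  let f : AddChar K ℂ → ℝ := fun χ => g χ / m
  have hf0 : ∀ χ, 0 ≤ f χ := fun χ => div_nonneg (hg.nonneg χ) hm0.le
  have hf1 : ∑ χ, f χ = 1 := by
    simp only [f]
    rw [← Finset.sum_div, ← hm, div_self hm0.ne']
  have hauto : ∀ ξ, autocorr f ξ = autocorr g ξ / m ^ 2 := fun ξ => by
    simp only [autocorr, f]
    rw [Finset.sum_div]
    exact Finset.sum_congr rfl fun y _ => by field_simp
  have hfE : ∑ χ, f χ ^ 2 ≤ Λ * ∑ χ, autocorr f χ ^ 2 := by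
    have h1 : ∑ χ, f χ ^ 2 = (∑ χ, g χ ^ 2) / m ^ 2 := by
      simp only [f, div_pow]
      rw [Finset.sum_div]
    have h2 : ∑ χ, autocorr f χ ^ 2 = (∑ χ, autocorr g χ ^ 2) / m ^ 4 := by
      simp only [hauto, div_pow, ← pow_mul]
      rw [Finset.sum_div]
    rw [h1, h2, ← mul_div_assoc, div_le_div_iff₀ (by positivity) (by positivity)]
    set X := ∑ χ, g χ ^ 2
    set Y := ∑ χ, autocorr g χ ^ 2
    have hX0 : 0 ≤ X := Finset.sum_nonneg fun _ _ => sq_nonneg _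
    have hY0 : 0 ≤ Y := Finset.sum_nonneg fun _ _ => sq_nonneg _
    have h3 : X * m ^ 2 * θ ^ 4 ≤ Λ * θ ^ 2 * Y * θ ^ 4 := by
      calc X * m ^ 2 * θ ^ 4 ≤ 4 * R * Y := hgE
        _ = Λ * θ ^ 2 * Y * θ ^ 4 := by rw [← hΛθ]; ring
    have h4 := le_of_mul_le_mul_right h3 (by positivity)
    have h5 : Λ * θ ^ 2 * Y ≤ Λ * Y := by
      have : θ ^ 2 ≤ 1 := pow_le_one₀ hθ0.le hθ1
      nlinarith [mul_nonneg hΛ0.le hY0]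
    calc X * m ^ 4 = X * m ^ 2 * m ^ 2 := by ring
      _ ≤ Λ * Y * m ^ 2 := mul_le_mul_of_nonneg_right (h4.trans h5) (sq_nonneg m)
  obtain ⟨Q, hQ, hF0, hQf, hQE, hQF⟩ := exists_level_set hf0 hf1 hΛ4 hfE
  have hL4 : 4 ≤ Λ ^ 44 := hΛ4.trans (le_self_pow₀ (by linarith) (by norm_num))
  obtain ⟨P, hPQ, hP, hPcard, hPP⟩ := exists_subset_small_doubling Q hQ (Λ ^ 44) hL4 hQE
  rw [← pow_mul] at hPcard hPP
  obtain ⟨H, T, hH, hT, hcov⟩ := hc (AddChar K ℂ) hGexp P (Λ ^ (44 * 44)) hP hPP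
  have hPpos : (0 : ℝ) < P.card := by exact_mod_cast hP.card_pos
  have hT' : (T.card : ℝ) ≤ Λ ^ (1937 * c) := by
    refine hT.trans ?_
    rw [pow_mul Λ 1937 c]
    gcongr
    calc 2 * Λ ^ (44 * 44) ≤ Λ * Λ ^ (44 * 44) := by gcongr; linarith
      _ = Λ ^ 1937 := (pow_succ' _ _).symm
  have hcmp : ∀ k ≤ 121, Λ ^ (1937 * c) * Λ ^ k ≤ Λ ^ (1937 * c + 121) := by
    intro k hk
    rw [← pow_add]
    exact pow_le_pow_right₀ (by linarith) (by omega)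
  have hgQ : ∀ χ ∈ P, θ ≤ ‖weightFourier p χ‖ := by
    intro χ hχ
    refine hg.supp χ fun h0 => ?_
    have h1 := hQf χ (hPQ hχ)
    simp only [f, h0, zero_div, mul_zero] at h1
    exact absurd hF0 (not_lt.2 h1)
  -- On `P` the transform of `p` is at least `θ`, so some coset of `H` carries much of its square
  -- mass; as `|H| ≤ |P|`, `sum_coset_norm_sq_le` then forces a heavy coset of the annihilator.
  have hside1 : ∃ x₀, 1 ≤ Λ ^ (1937 * c + 121) * cosetMass p (charAnnihilator H) x₀ := by
    obtain ⟨x₀, hx₀⟩ := Finite.exists_max fun x => cosetMass p (charAnnihilator H) x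
    refine ⟨x₀, ?_⟩
    set B := cosetMass p (charAnnihilator H) x₀
    have hB0 : 0 ≤ B := Finset.sum_nonneg fun x _ => by split_ifs; exacts [hp x, le_rfl]
    obtain ⟨t, ht⟩ := exists_cosetMass_ge (q := fun χ => ‖weightFourier p χ‖ ^ 2)
      (fun _ => sq_nonneg _) H P T hP hcov
    rw [cosetMass_eq_sum] at ht
    have h1 := sum_coset_norm_sq_le hp hp1 H t hx₀
    have h2 : (P.card : ℝ) * θ ^ 2 ≤ ∑ χ ∈ P, ‖weightFourier p χ‖ ^ 2 := by
      rw [← nsmul_eq_mul]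
      exact Finset.card_nsmul_le_sum _ _ _ fun χ hχ => pow_le_pow_left₀ hθ0.le (hgQ χ hχ) 2
    have hH' : (Nat.card H : ℝ) ≤ P.card := by exact_mod_cast hH
    have h3 : (P.card : ℝ) * θ ^ 2 ≤ P.card * (Λ ^ (1937 * c) * B) := by
      calc (P.card : ℝ) * θ ^ 2 ≤ T.card * (Nat.card H * B) :=
            (h2.trans ht).trans (mul_le_mul_of_nonneg_left h1 (Nat.cast_nonneg _))
        _ ≤ Λ ^ (1937 * c) * (P.card * B) := by gcongr
        _ = _ := by ring
    have h4 := le_of_mul_le_mul_left h3 hPpos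
    calc 1 ≤ Λ * θ ^ 2 := hΛθ2 2 (by norm_num)
      _ ≤ Λ * (Λ ^ (1937 * c) * B) := by gcongr
      _ = Λ ^ (1937 * c) * Λ ^ 1 * B := by ring
      _ ≤ _ := by gcongr; exact hcmp 1 (by norm_num)
  -- The weight `g` is large on `P`, so some coset of `H` is heavy for `g`; by the field `coset` a
  -- bound for `q` would also bound `g`.
  have hside2 : ∃ χ₀, 1 ≤ Λ ^ (1937 * c + 121) * cosetMass q H χ₀ := by
    obtain ⟨χ₀, hχ₀⟩ := Finite.exists_max fun χ => cosetMass q H χ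
    refine ⟨χ₀, ?_⟩
    set B := cosetMass q H χ₀
    have hB0 : 0 ≤ B := Finset.sum_nonneg fun x _ => by split_ifs; exacts [hq x, le_rfl]
    obtain ⟨t, ht⟩ := exists_cosetMass_ge hg.nonneg H P T hP hcov
    have h1 := hg.coset H B hχ₀ t
    set F := ∑ χ, f χ ^ 2
    have h2 : (P.card : ℝ) * (F * m) ≤ Λ ^ 6 * ∑ χ ∈ P, g χ := by
      rw [← nsmul_eq_mul, Finset.mul_sum P]
      refine Finset.card_nsmul_le_sum _ _ _ fun χ hχ => ?_
      have h3 := mul_le_mul_of_nonneg_right (hQf χ (hPQ hχ)) hm0.le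
      have h4 : Λ ^ 6 * f χ * m = Λ ^ 6 * g χ := by simp only [f]; field_simp
      rwa [h4] at h3
    have h5 : 1 ≤ Λ ^ 26 * (Λ ^ (44 * 2) * P.card * F) :=
      hQF.trans (by gcongr)
    have h6 : θ ≤ Λ ^ 120 * (T.card * B) := by
      calc θ ≤ m * 1 := by rw [mul_one]; exact hg.le_sum
        _ ≤ m * (Λ ^ 26 * (Λ ^ (44 * 2) * P.card * F)) := by gcongr
        _ = Λ ^ 114 * (P.card * (F * m)) := by ring
        _ ≤ Λ ^ 114 * (Λ ^ 6 * ∑ χ ∈ P, g χ) := by gcongr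
        _ ≤ Λ ^ 114 * (Λ ^ 6 * (T.card * B)) := by
            gcongr
            exact ht.trans (mul_le_mul_of_nonneg_left h1 (Nat.cast_nonneg _))
        _ = _ := by ring
    calc 1 ≤ Λ * θ ^ 1 := hΛθ2 1 (by norm_num)
      _ = Λ * θ := by rw [pow_one]
      _ ≤ Λ * (Λ ^ 120 * (T.card * B)) := by gcongr
      _ ≤ Λ * (Λ ^ 120 * (Λ ^ (1937 * c) * B)) := by gcongr
      _ = Λ ^ (1937 * c) * Λ ^ 121 * B := by ring
      _ ≤ _ := by gcongr; exact hcmp 121 le_rfl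
  obtain ⟨x₀, hx₀⟩ := hside1
  obtain ⟨χ₀, hχ₀⟩ := hside2
  exact ⟨H, x₀, χ₀, hx₀, hχ₀⟩

end Duality

/-! ### Sizes of the subgroups `tH` and of their duals. -/

/-- The number of `t`-th multiples in an abelian group. -/
noncomputable def multiplesCard (t : ℕ) (H : Type*) [AddCommGroup H] : ℕ :=
  Nat.card (nsmulAddMonoidHom t : H →+ H).range

section MultiplesCard

variable {H : Type*} [AddCommGroup H]

theorem multiplesCard_pos [Finite H] (t : ℕ) : 0 < multiplesCard t H := Nat.card_pos

theorem multiplesCard_subgroup_le [Finite H] (t : ℕ) (H₁ : AddSubgroup H) :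
    multiplesCard t H₁ ≤ multiplesCard t H := by
  refine Nat.card_le_card_of_injective
    (fun y : (nsmulAddMonoidHom t : H₁ →+ H₁).range =>
      (⟨((y : H₁) : H), ?_⟩ : (nsmulAddMonoidHom t : H →+ H).range)) fun y z h => ?_
  · obtain ⟨x, hx⟩ := y.2
    exact ⟨x, by rw [← hx]; rfl⟩
  · exact Subtype.ext (Subtype.ext (Subtype.mk.inj h))

/-- Restriction of characters to a subgroup. -/
def charRestrict (K : AddSubgroup H) : AddChar H ℂ →+ AddChar K ℂ where
  toFun ψ := ψ.compAddMonoidHom K.subtype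
  map_zero' := rfl
  map_add' _ _ := rfl

theorem charRestrict_apply (K : AddSubgroup H) (ψ : AddChar H ℂ) (x : K) :
    charRestrict K ψ x = ψ x := rfl

theorem nsmul_eq_nsmul_of_charRestrict {t : ℕ} {ψ ψ' : AddChar H ℂ}
    (h : charRestrict (nsmulAddMonoidHom t : H →+ H).range ψ =
      charRestrict (nsmulAddMonoidHom t : H →+ H).range ψ') : t • ψ = t • ψ' := by
  ext x
  have h1 := DFunLike.congr_fun h ⟨t • x, x, rfl⟩
  rw [charRestrict_apply, charRestrict_apply] at h1
  rw [AddChar.nsmul_apply, AddChar.nsmul_apply, ← AddChar.map_nsmul_eq_pow,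
    ← AddChar.map_nsmul_eq_pow]
  exact h1

/-- Since `(t • ψ) x = ψ (t • x)`, the multiple `t • ψ` depends only on the restriction of `ψ` to
`tH`, and that restriction lies in `Hs`. -/
theorem multiplesCard_comap_charRestrict_le [Finite H] (t : ℕ)
    (Hs : AddSubgroup (AddChar (nsmulAddMonoidHom t : H →+ H).range ℂ)) :
    multiplesCard t (Hs.comap (charRestrict (nsmulAddMonoidHom t : H →+ H).range)) ≤
      Nat.card Hs := by
  set G := Hs.comap (charRestrict (nsmulAddMonoidHom t : H →+ H).range)
  refine Nat.card_le_card_of_injective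
    (fun y : (nsmulAddMonoidHom t : G →+ G).range => (⟨_, y.2.choose.2⟩ : Hs)) fun y z h => ?_
  have h1 := nsmul_eq_nsmul_of_charRestrict (congrArg Subtype.val h)
  have hy : t • y.2.choose = (y : G) := y.2.choose_spec
  have hz : t • z.2.choose = (z : G) := z.2.choose_spec
  refine Subtype.ext ?_
  rw [← hy, ← hz]
  exact Subtype.ext h1

/-- The case `Hs = ⊤` of the previous bound, as `tH` and its dual have equal order. -/
theorem multiplesCard_addChar_le [Finite H] (t : ℕ) :
    multiplesCard t (AddChar H ℂ) ≤ multiplesCard t H := by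
  have h := multiplesCard_comap_charRestrict_le (H := H) t ⊤
  have h1 : Nat.card (AddChar (nsmulAddMonoidHom t : H →+ H).range ℂ) = multiplesCard t H := by
    cases nonempty_fintype (nsmulAddMonoidHom t : H →+ H).range
    rw [Nat.card_eq_fintype_card, AddChar.card_eq, multiplesCard, Nat.card_eq_fintype_card]
  rw [AddSubgroup.card_top, h1] at h
  refine le_trans ?_ h
  refine Nat.card_le_card_of_injective
    (fun y : (nsmulAddMonoidHom t : AddChar H ℂ →+ AddChar H ℂ).range =>
      (⟨⟨y, trivial⟩, ?_⟩ : (nsmulAddMonoidHom t :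
        (⊤ : AddSubgroup (AddChar _ ℂ)).comap (charRestrict _) →+ _).range)) fun y z h => ?_
  · obtain ⟨x, hx⟩ := y.2
    exact ⟨⟨x, trivial⟩, Subtype.ext hx⟩
  · exact Subtype.ext (Subtype.mk.inj (Subtype.mk.inj h))

theorem multiplesCard_comap_le [Finite H] (t : ℕ) (P : AddSubgroup (nsmulAddMonoidHom t : H →+ H).range) :
    multiplesCard t (P.comap (nsmulAddMonoidHom t : H →+ H).rangeRestrict) ≤ Nat.card P := by
  set G := P.comap (nsmulAddMonoidHom t : H →+ H).rangeRestrict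
  refine Nat.card_le_card_of_injective
    (fun y : (nsmulAddMonoidHom t : G →+ G).range => (⟨_, y.2.choose.2⟩ : P)) fun y z h => ?_
  have h1 : t • (y.2.choose : H) = t • (z.2.choose : H) :=
    congrArg (fun w : P => ((w : (nsmulAddMonoidHom t : H →+ H).range) : H)) h
  have hy : t • y.2.choose = (y : G) := y.2.choose_spec
  have hz : t • z.2.choose = (z : G) := z.2.choose_spec
  refine Subtype.ext ?_
  rw [← hy, ← hz]
  exact Subtype.ext h1

end MultiplesCard

/-! ### Matchings between elements and characters. -/

/-- Elements `u i` and characters `ψ j` such that `ψ j (u i) = ζ` exactly on the diagonal. -/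
def CharMatching {H ι : Type*} [AddCommGroup H] (I : Finset ι) (u : ι → H) (ψ : ι → AddChar H ℂ)
    (ζ : ℂ) : Prop :=
  ∀ i ∈ I, ∀ j ∈ I, ψ j (u i) = ζ ↔ i = j

section CharMatching

variable {H ι : Type*} [AddCommGroup H] {I : Finset ι} {u : ι → H} {ψ : ι → AddChar H ℂ} {ζ : ℂ}

theorem CharMatching.dual (h : CharMatching I u ψ ζ) :
    CharMatching I ψ (fun i => (AddChar.doubleDualEmb (u i) : AddChar (AddChar H ℂ) ℂ)) ζ :=
  fun i hi j hj => (h j hj i hi).trans eq_comm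

/-- Restricting a matching to a coset of a subgroup costs a factor equal to the exponent. -/
theorem CharMatching.exists_restrict {M : ℕ} (hM : 0 < M) (hH : ∀ x : H, M • x = 0)
    (h : CharMatching I u ψ ζ) {A : Finset ι} (hA : A ⊆ I) (H₁ : AddSubgroup H)
    (hdiff : ∀ i ∈ A, ∀ j ∈ A, u i - u j ∈ H₁) :
    ∃ (A' : Finset ι) (u' : ι → H₁) (ψ' : ι → AddChar H₁ ℂ) (ζ' : ℂ),
      CharMatching A' u' ψ' ζ' ∧ A.card ≤ M * A'.card := by
  classical
  rcases A.eq_empty_or_nonempty with rfl | ⟨i₀, hi₀⟩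
  · exact ⟨∅, 0, 0, 0, by simp [CharMatching], by simp⟩
  have hroot : ∀ j ∈ A, ψ j (u i₀) ∈ Polynomial.nthRootsFinset M (1 : ℂ) := fun j _ => by
    rw [Polynomial.mem_nthRootsFinset hM, ← AddChar.map_nsmul_eq_pow, hH,
      AddChar.map_zero_eq_one]
  -- Recentring at `u i₀` divides `ψ j (u i)` by `ψ j (u i₀)`, an `M`-th root of unity. Pigeonholing
  -- its value makes the new diagonal value `ζ / z` the same for all `j`.
  obtain ⟨z, hz, hcard⟩ : ∃ z ∈ Polynomial.nthRootsFinset M (1 : ℂ),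
      A.card ≤ M * (A.filter fun j => ψ j (u i₀) = z).card := by
    obtain ⟨z, hz, hmax⟩ := Finset.exists_max_image (Polynomial.nthRootsFinset M (1 : ℂ))
      (fun z => (A.filter fun j => ψ j (u i₀) = z).card) ⟨_, hroot i₀ hi₀⟩
    refine ⟨z, hz, ?_⟩
    rw [Finset.card_eq_sum_card_fiberwise (f := fun j => ψ j (u i₀)) hroot]
    refine (Finset.sum_le_card_nsmul _ _ _ hmax).trans ?_
    rw [smul_eq_mul]
    refine Nat.mul_le_mul_right _ ?_
    rw [Polynomial.nthRootsFinset]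
    exact (Multiset.toFinset_card_le _).trans (Polynomial.card_nthRoots M 1)
  have hz0 : z ≠ 0 := by
    rintro rfl
    rw [Polynomial.mem_nthRootsFinset hM, zero_pow hM.ne'] at hz
    exact zero_ne_one hz
  refine ⟨A.filter fun j => ψ j (u i₀) = z,
    fun i => if hi : u i - u i₀ ∈ H₁ then ⟨u i - u i₀, hi⟩ else 0,
    fun j => (ψ j).compAddMonoidHom H₁.subtype, ζ / z, ?_, hcard⟩
  intro i hi j hj
  obtain ⟨hiA, -⟩ := Finset.mem_filter.1 hi
  obtain ⟨hjA, hjz⟩ := Finset.mem_filter.1 hj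
  beta_reduce
  rw [dif_pos (hdiff i hiA i₀ hi₀), AddChar.compAddMonoidHom_apply]
  simp only [AddSubgroup.coe_subtype]
  rw [AddChar.map_sub_eq_div, hjz, div_left_inj' hz0]
  exact h i (hA hiA) j (hA hjA)

/-- A large matching has a biased character sum. -/
theorem CharMatching.exists_bias [Finite H] {M : ℕ} (hM : 0 < M) (hH : ∀ x : H, M • x = 0)
    (h : CharMatching I u ψ ζ) (hI : 2 * M ≤ I.card) :
    ∃ t < M, 1 < multiplesCard t H ∧
      (I.card : ℝ) ^ 2 / (2 * M) ≤ ‖∑ j ∈ I, ∑ i ∈ I, ψ j (t • u i)‖ := by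
  classical
  by_contra! hcon
  have hIpos : 0 < I.card := by omega
  obtain ⟨i₀, hi₀⟩ := Finset.card_pos.1 hIpos
  have hζ : ψ i₀ (u i₀) = ζ := (h i₀ hi₀ i₀ hi₀).2 rfl
  have hpow : ∀ i j, (ψ j (u i)) ^ M = 1 := fun i j => by
    rw [← AddChar.map_nsmul_eq_pow, hH, AddChar.map_zero_eq_one]
  have hζM : ζ ^ M = 1 := by rw [← hζ]; exact hpow _ _
  have hζnorm : ‖ζ‖ = 1 := by rw [← hζ]; exact AddChar.norm_apply _ _
  have hζ0 : ζ ≠ 0 := by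
    rintro rfl
    simp at hζnorm
  have hgeom : ∀ i ∈ I, ∀ j ∈ I,
      ∑ t ∈ Finset.range M, (ψ j (u i) / ζ) ^ t = if i = j then (M : ℂ) else 0 := by
    intro i hi j hj
    split_ifs with hij
    · rw [(h i hi j hj).2 hij, div_self hζ0]
      simp
    · have h1 : ψ j (u i) / ζ ≠ 1 := fun h2 =>
        hij ((h i hi j hj).1 ((div_eq_one_iff_eq hζ0).1 h2))
      rw [geom_sum_eq h1, div_pow, hpow, hζM, div_one, sub_self, zero_div]
  have htot : ∑ t ∈ Finset.range M, ∑ j ∈ I, ∑ i ∈ I, (ψ j (u i) / ζ) ^ t =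
      (M : ℂ) * I.card := by
    rw [Finset.sum_comm]
    have h1 : ∀ j ∈ I, ∑ t ∈ Finset.range M, ∑ i ∈ I, (ψ j (u i) / ζ) ^ t = M := by
      intro j hj
      rw [Finset.sum_comm, Finset.sum_congr rfl fun i hi => hgeom i hi j hj]
      simp [hj]
    rw [Finset.sum_congr rfl h1, Finset.sum_const, nsmul_eq_mul, mul_comm]
  set N : ℝ := (I.card : ℝ) with hN
  have hNpos : 0 < N := Nat.cast_pos.2 hIpos
  have hMpos : (0 : ℝ) < M := by exact_mod_cast hM
  -- The powers `(ψ j (u i) / ζ) ^ t` sum over `t` to `M` times the diagonal indicator, in total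
  -- only `M N ≤ N² / 2`. The term `t = 0` gives `N²`, any `t` with `tH = 0` also gives `N²`, and
  -- without bias every other term exceeds `-N² / (2M)`: a contradiction.
  have hterm : ∀ t ∈ Finset.range M, -(N ^ 2 / (2 * M)) +
      (if t = 0 then N ^ 2 + N ^ 2 / (2 * M) else 0) ≤
        (∑ j ∈ I, ∑ i ∈ I, (ψ j (u i) / ζ) ^ t).re := by
    intro t ht
    by_cases h1 : 1 < multiplesCard t H
    · have ht0 : t ≠ 0 := by
        rintro rfl
        have : (nsmulAddMonoidHom 0 : H →+ H).range = ⊥ := by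
          rw [AddMonoidHom.range_eq_bot_iff]
          ext x
          simp
        rw [multiplesCard, this] at h1
        simp at h1
      have h2 := hcon t (Finset.mem_range.1 ht) h1
      have h3 : ∑ j ∈ I, ∑ i ∈ I, (ψ j (u i) / ζ) ^ t =
          (∑ j ∈ I, ∑ i ∈ I, ψ j (t • u i)) / ζ ^ t := by
        simp only [div_pow, Finset.sum_div, AddChar.map_nsmul_eq_pow]
      have h4 : ‖∑ j ∈ I, ∑ i ∈ I, (ψ j (u i) / ζ) ^ t‖ < N ^ 2 / (2 * M) := by
        rw [h3, norm_div, norm_pow, hζnorm, one_pow, div_one]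
        exact h2
      rw [if_neg ht0, add_zero]
      have h5 := (abs_le.1 (Complex.abs_re_le_norm (∑ j ∈ I, ∑ i ∈ I, (ψ j (u i) / ζ) ^ t))).1
      linarith
    · have hsub : ∀ x : H, t • x = 0 := by
        have h2 : multiplesCard t H = 1 := le_antisymm (not_lt.1 h1) (multiplesCard_pos t)
        rw [multiplesCard, AddSubgroup.card_eq_one] at h2
        intro x
        have : t • x ∈ (nsmulAddMonoidHom t : H →+ H).range := ⟨x, rfl⟩
        rwa [h2, AddSubgroup.mem_bot] at this
      have h2 : ∀ i j, (ψ j (u i)) ^ t = 1 := fun i j => by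
        rw [← AddChar.map_nsmul_eq_pow, hsub, AddChar.map_zero_eq_one]
      have h3 : ζ ^ t = 1 := by rw [← hζ]; exact h2 _ _
      have h4 : ∑ j ∈ I, ∑ i ∈ I, (ψ j (u i) / ζ) ^ t = ((N ^ 2 : ℝ) : ℂ) := by
        simp only [div_pow, h2, h3, div_one, Finset.sum_const, nsmul_eq_mul, mul_one]
        rw [hN]
        push_cast
        ring
      rw [h4, Complex.ofReal_re]
      have h5 : 0 ≤ N ^ 2 / (2 * M) := by positivity
      split_ifs
      · linarith
      · have := sq_nonneg N
        linarith
  have hsum := Finset.sum_le_sum hterm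
  rw [← Complex.re_sum, htot, Finset.sum_add_distrib, Finset.sum_ite_eq'] at hsum
  simp only [Finset.mem_range, hM, if_true, Finset.sum_const, Finset.card_range,
    nsmul_eq_mul] at hsum
  have h1 : ((M : ℂ) * (I.card : ℂ)).re = M * N := by
    rw [hN, ← Nat.cast_mul, Complex.natCast_re]
    push_cast
    ring
  rw [h1] at hsum
  have h2 : (M : ℝ) * -(N ^ 2 / (2 * M)) = -(N ^ 2 / 2) := by field_simp
  have h3 : (M : ℝ) * N ≤ N ^ 2 / 2 := by
    have : (2 * M : ℝ) ≤ N := by rw [hN]; exact_mod_cast hI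
    nlinarith
  have h5 : 0 < N ^ 2 / (2 * M) := by positivity
  linarith

end CharMatching

/-! ### Recursion on matchings and its potential. -/

section PushWeight

open Classical in
/-- The distribution of `g i` for a uniformly random `i ∈ I`. -/
noncomputable def pushWeight {ι A : Type*} (I : Finset ι) (g : ι → A) (x : A) : ℝ :=
  ((I.filter fun i => g i = x).card : ℝ) / I.card

variable {ι A : Type*} [Fintype A] {I : Finset ι} (g : ι → A)

theorem sum_pushWeight_mul (F : A → ℂ) :
    ∑ x, (pushWeight I g x : ℂ) * F x = (∑ i ∈ I, F (g i)) / I.card := by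
  classical
  simp only [pushWeight, Complex.ofReal_div, Complex.ofReal_natCast, div_mul_eq_mul_div]
  rw [← Finset.sum_div]
  congr 1
  have h : ∀ x, (((I.filter fun i => g i = x).card : ℕ) : ℂ) * F x =
      ∑ i ∈ I, if g i = x then F (g i) else 0 := by
    intro x
    rw [← nsmul_eq_mul, ← Finset.sum_const, Finset.sum_filter]
    refine Finset.sum_congr rfl fun i _ => ?_
    split_ifs with h
    · rw [h]
    · rfl
  simp only [h]
  rw [Finset.sum_comm]
  simp

theorem sum_pushWeight (hI : I.Nonempty) : ∑ x, pushWeight I g x = 1 := by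
  have h := sum_pushWeight_mul (I := I) g fun _ => 1
  have hI' : (I.card : ℂ) ≠ 0 := by exact_mod_cast hI.card_pos.ne'
  simp only [mul_one, Finset.sum_const, nsmul_eq_mul] at h
  rw [div_self hI'] at h
  exact_mod_cast h

open Classical in
theorem cosetMass_pushWeight [AddCommGroup A] (H : AddSubgroup A) (a : A) :
    cosetMass (pushWeight I g) H a = ((I.filter fun i => g i - a ∈ H).card : ℝ) / I.card := by
  have h := sum_pushWeight_mul (I := I) g fun x => if x - a ∈ H then 1 else 0
  rw [Finset.sum_boole] at h
  have h1 : (cosetMass (pushWeight I g) H a : ℂ) =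
      ∑ x, (pushWeight I g x : ℂ) * if x - a ∈ H then 1 else 0 := by
    rw [cosetMass]
    push_cast
    exact Finset.sum_congr rfl fun x _ => by split_ifs <;> simp
  rw [h, ← Complex.ofReal_natCast, ← Complex.ofReal_natCast, ← Complex.ofReal_div] at h1
  exact Complex.ofReal_injective h1

end PushWeight

/-- `cost` bounds the logarithmic loss of density in approximate duality for groups of exponent
dividing `M` and characters sums of bias at least `1 / (2M)`. -/
def DualityCost (M : ℕ) (cost : ℝ → ℝ) : Prop :=
  ∀ (K : Type) [AddCommGroup K] [Fintype K], (∀ x : K, M • x = 0) → 1 < Fintype.card K →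
    ∀ (p : K → ℝ) (q : AddChar K ℂ → ℝ), (∀ x, 0 ≤ p x) → ∑ x, p x = 1 → (∀ χ, 0 ≤ q χ) →
    ∑ χ, q χ = 1 → 1 / (2 * M : ℝ) ≤ ‖∑ χ, (q χ : ℂ) * weightFourier p χ‖ →
    ∃ (H : AddSubgroup (AddChar K ℂ)) (x₀ : K) (χ₀ : AddChar K ℂ),
      Real.exp (-cost (Real.log (Fintype.card K))) ≤ cosetMass p (charAnnihilator H) x₀ ∧
      Real.exp (-cost (Real.log (Fintype.card K))) ≤ cosetMass q H χ₀

/-- Below the threshold the trivial choice of the whole dual group and the heaviest point of `p`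
costs `k`. Above it, `R = exp (k / s)` and `δ = 1 / (4M)`: there `5 ^ s ≤ k / s`, so the loss `δ ^
(-6 · 5 ^ s)` is also `exp (O(k / s))`. -/
theorem PFRConjectureOver.exists_dualityCost {M : ℕ} (hM : 0 < M) (h : PFRConjectureOver M) :
    ∃ C : ℝ, 0 ≤ C ∧ ∀ s : ℕ, 0 < s →
      DualityCost M (fun k => if k < s * 5 ^ s then k else C * (k / s)) := by
  obtain ⟨C₀, hC₀⟩ := h.exists_approx_duality hM
  have hM1 : (1 : ℝ) ≤ M := by exact_mod_cast hM
  have hlogM : 0 ≤ Real.log (4 * M) := Real.log_nonneg (by linarith)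
  refine ⟨C₀ * (3 + 6 * Real.log (4 * M)), by positivity, ?_⟩
  intro s hs K _ _ hK hcard p q hp hp1 hq hq1 hbias
  set k := Real.log (Fintype.card K) with hk
  have hKpos : (0 : ℝ) < Fintype.card K := by exact_mod_cast Fintype.card_pos
  have hk0 : 0 ≤ k := Real.log_nonneg (by exact_mod_cast hcard.le)
  have hs0 : (0 : ℝ) < s := by exact_mod_cast hs
  beta_reduce
  split_ifs with hks
  · refine ⟨⊤, ?_⟩
    obtain ⟨x₀, hx₀⟩ := Finite.exists_max p
    refine ⟨x₀, 0, ?_, ?_⟩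
    · have h1 : (1 : ℝ) ≤ Fintype.card K * p x₀ := by
        rw [← hp1, ← nsmul_eq_mul, ← Finset.card_univ]
        exact Finset.sum_le_card_nsmul _ _ _ fun x _ => hx₀ x
      rw [Real.exp_neg, hk, Real.exp_log hKpos, inv_le_iff_one_le_mul₀' hKpos]
      refine h1.trans (mul_le_mul_of_nonneg_left ?_ hKpos.le)
      rw [cosetMass]
      refine le_trans ?_ (Finset.single_le_sum (fun x _ => ?_) (Finset.mem_univ x₀))
      · simp
      · split_ifs; exacts [hp x, le_rfl]
    · have h1 : cosetMass q ⊤ 0 = 1 := by simp [cosetMass, hq1]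
      rw [h1]
      exact Real.exp_le_one_iff.2 (by linarith)
  · have hks' : (s : ℝ) * 5 ^ s ≤ k := not_lt.1 hks
    set δ : ℝ := 1 / (4 * M) with hδ
    have hδ0 : 0 < δ := by positivity
    have hδ2 : δ ≤ 1 / 2 := by
      rw [hδ]; exact one_div_le_one_div_of_le (by norm_num) (by linarith)
    set R := Real.exp (k / s) with hR
    have hR1 : 1 ≤ R := Real.one_le_exp (by positivity)
    have hRs : (Fintype.card K : ℝ) ≤ R ^ s := by
      rw [hR, ← Real.exp_nat_mul, mul_div_cancel₀ _ hs0.ne', hk, Real.exp_log hKpos]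
    obtain ⟨H, x₀, χ₀, h1, h2⟩ := hC₀ K hK p q hp hp1 hq hq1 δ R s hδ0 hδ2 hR1 hRs (by
      refine le_of_eq_of_le ?_ hbias
      rw [hδ]; field_simp; norm_num)
    have hbase : 4 * R / δ ^ (6 * 5 ^ s) ≤
        Real.exp ((3 + 6 * Real.log (4 * M)) * (k / s)) := by
      have h3 : (5 : ℝ) ^ s ≤ k / s := by rw [le_div_iff₀ hs0]; linarith
      have h4 : (1 : ℝ) ≤ 5 ^ s := one_le_pow₀ (by norm_num)
      have h5 : δ = Real.exp (-Real.log (4 * M)) := by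
        rw [Real.exp_neg, Real.exp_log (by linarith), hδ, one_div]
      have h6 : (4 : ℝ) ≤ Real.exp 2 := by
        have := Real.add_one_le_exp (1 : ℝ)
        rw [show (2 : ℝ) = 1 + 1 by norm_num, Real.exp_add]
        nlinarith
      have h7 : δ ^ (6 * 5 ^ s) = Real.exp (-(6 * 5 ^ s * Real.log (4 * M))) := by
        rw [h5, ← Real.exp_nat_mul]
        push_cast
        ring_nf
      rw [h7, div_eq_mul_inv, ← Real.exp_neg, neg_neg]
      calc 4 * R * Real.exp (6 * 5 ^ s * Real.log (4 * M))
          ≤ Real.exp 2 * R * Real.exp (6 * 5 ^ s * Real.log (4 * M)) := by gcongr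
        _ = Real.exp (2 + k / s + 6 * 5 ^ s * Real.log (4 * M)) := by
            rw [hR, ← Real.exp_add, ← Real.exp_add]
        _ ≤ _ := by
            refine Real.exp_le_exp.2 ?_
            have h8 := mul_le_mul_of_nonneg_right h3 hlogM
            nlinarith
    have hδR : 0 < 4 * R / δ ^ (6 * 5 ^ s) := by positivity
    have hfin : ∀ B : ℝ, 1 ≤ (4 * R / δ ^ (6 * 5 ^ s)) ^ C₀ * B →
        Real.exp (-(C₀ * (3 + 6 * Real.log (4 * M)) * (k / s))) ≤ B := by
      intro B hB
      have hB0 : 0 < B := by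
        by_contra! hneg
        have := mul_nonpos_of_nonneg_of_nonpos (pow_nonneg hδR.le C₀) hneg
        linarith
      rw [Real.exp_neg, inv_le_iff_one_le_mul₀' (Real.exp_pos _)]
      refine hB.trans (mul_le_mul_of_nonneg_right ?_ hB0.le)
      rw [mul_assoc, Real.exp_nat_mul]
      exact pow_le_pow_left₀ hδR.le hbase C₀
    exact ⟨H, x₀, χ₀, hfin _ h1, hfin _ h2⟩

/-- Accounting for one round: the coset restriction costs `cost + log M`, paid by the drop of `φ` at
the index `t` whose logarithm halves. The sizes `f` are kept abstract so that a matching in the dual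
group can be charged to the sizes for the original group. -/
theorem CharMatching.log_card_le_of_restrict {H ι : Type*} [AddCommGroup H] [Finite H]
    {I : Finset ι} {u : ι → H} {ψ : ι → AddChar H ℂ} {ζ : ℂ} {M : ℕ} (hM : 0 < M)
    (hH : ∀ x : H, M • x = 0) (h : CharMatching I u ψ ζ) (hI : I.Nonempty) {cost φ : ℝ → ℝ}
    (hmono : ∀ x y, 0 ≤ x → x ≤ y → φ x ≤ φ y)
    (hstep : ∀ x y, Real.log 2 ≤ x → 0 ≤ y → 2 * y ≤ x → cost x + Real.log M + φ y ≤ φ x)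
    {f : ℕ → ℕ} {t : ℕ} (ht : t < M) (hft : 1 < f t) (H₁ : AddSubgroup H)
    (hle : ∀ s, multiplesCard s H₁ ≤ f s) (hsq : multiplesCard t H₁ ^ 2 ≤ f t)
    {A : Finset ι} (hAI : A ⊆ I) (hdiff : ∀ i ∈ A, ∀ j ∈ A, u i - u j ∈ H₁)
    (hA : Real.exp (-cost (Real.log (f t))) * I.card ≤ A.card)
    (ih : ∀ (A' : Finset ι) (u' : ι → H₁) (ψ' : ι → AddChar H₁ ℂ) (ζ' : ℂ),
      CharMatching A' u' ψ' ζ' → Real.log A'.card ≤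
        Real.log (2 * M) + ∑ s ∈ Finset.range M, φ (Real.log (multiplesCard s H₁))) :
    Real.log I.card ≤ Real.log (2 * M) + ∑ s ∈ Finset.range M, φ (Real.log (f s)) := by
  obtain ⟨A', u', ψ', ζ', hmatch, hcard⟩ := h.exists_restrict hM hH hAI H₁ hdiff
  have h1 := ih A' u' ψ' ζ' hmatch
  have hIpos : (0 : ℝ) < I.card := by exact_mod_cast hI.card_pos
  have hMpos : (0 : ℝ) < M := by exact_mod_cast hM
  have hcard' : (A.card : ℝ) ≤ M * A'.card := by exact_mod_cast hcard
  have hA'pos : (0 : ℝ) < A'.card := by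
    have h2 : 0 < Real.exp (-cost (Real.log (f t))) * I.card := by positivity
    have h3 : (0 : ℝ) < M * A'.card := by linarith
    exact pos_of_mul_pos_right h3 hMpos.le
  have h2 := Real.log_le_log (by positivity) (hA.trans hcard')
  rw [Real.log_mul (Real.exp_pos _).ne' hIpos.ne', Real.log_exp,
    Real.log_mul hMpos.ne' hA'pos.ne'] at h2
  have hpos : ∀ s, (1 : ℝ) ≤ multiplesCard s H₁ := fun s => by
    exact_mod_cast multiplesCard_pos (H := H₁) s
  have hsum : cost (Real.log (f t)) + Real.log M +
      ∑ s ∈ Finset.range M, φ (Real.log (multiplesCard s H₁)) ≤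
      ∑ s ∈ Finset.range M, φ (Real.log (f s)) := by
    have htM := Finset.mem_range.2 ht
    rw [← Finset.add_sum_erase _ _ htM, ← Finset.add_sum_erase _ _ htM, ← add_assoc]
    refine add_le_add (hstep _ _ ?_ (Real.log_nonneg (hpos t)) ?_)
      (Finset.sum_le_sum fun s _ => hmono _ _ (Real.log_nonneg (hpos s)) ?_)
    · exact Real.log_le_log two_pos (by exact_mod_cast hft)
    · have h3 : ((multiplesCard t H₁ : ℝ)) ^ 2 ≤ f t := by exact_mod_cast hsq
      have h4 := Real.log_le_log (by have := hpos t; positivity) h3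
      rwa [Real.log_pow] at h4
    · exact Real.log_le_log (by linarith [hpos s]) (by exact_mod_cast hle s)
  linarith

/-- A matching in a group of exponent dividing `M` has at most exponential size in the potential
`∑ φ (log |tH|)`. -/
theorem DualityCost.log_card_le {M : ℕ} (hM : 0 < M) {cost φ : ℝ → ℝ} (hcost : DualityCost M cost)
    (hmono : ∀ x y, 0 ≤ x → x ≤ y → φ x ≤ φ y) (hφ0 : 0 ≤ φ 0)
    (hstep : ∀ x y, Real.log 2 ≤ x → 0 ≤ y → 2 * y ≤ x → cost x + Real.log M + φ y ≤ φ x)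
    {ι : Type} (N : ℕ) :
    ∀ (H : Type) [AddCommGroup H] [Finite H], (∀ x : H, M • x = 0) →
      ∑ t ∈ Finset.range M, multiplesCard t H = N →
      ∀ (I : Finset ι) (u : ι → H) (ψ : ι → AddChar H ℂ) (ζ : ℂ), CharMatching I u ψ ζ →
      Real.log I.card ≤
        Real.log (2 * M) + ∑ t ∈ Finset.range M, φ (Real.log (multiplesCard t H)) := by
  classical
  -- The recursion terminates because `∑ t, |tH|` strictly decreases: no summand grows and the
  -- chosen one, greater than 1, has its new value's square bounded by the old value.
  induction N using Nat.strong_induction_on with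
  | _ N ihN =>
  intro H _ _ hH hN I u ψ ζ hmatch
  have hM1 : (1 : ℝ) ≤ M := by exact_mod_cast hM
  rcases lt_or_ge I.card (2 * M) with hI | hI
  · have h1 : 0 ≤ ∑ t ∈ Finset.range M, φ (Real.log (multiplesCard t H)) :=
      Finset.sum_nonneg fun t _ => hφ0.trans <| hmono _ _ le_rfl <|
        Real.log_nonneg (by exact_mod_cast multiplesCard_pos (H := H) t)
    have h2 : Real.log I.card ≤ Real.log (2 * M) := by
      rcases Nat.eq_zero_or_pos I.card with h0 | h0
      · rw [h0, Nat.cast_zero, Real.log_zero]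
        exact Real.log_nonneg (by linarith)
      · exact Real.log_le_log (by exact_mod_cast h0) (by exact_mod_cast hI.le)
    linarith
  obtain ⟨t, ht, hft, hbias⟩ := hmatch.exists_bias hM hH hI
  have hIne : I.Nonempty := Finset.card_pos.1 (by omega)
  have hIpos : (0 : ℝ) < I.card := by exact_mod_cast hIne.card_pos
  set K := (nsmulAddMonoidHom t : H →+ H).range with hKdef
  cases nonempty_fintype K
  have hKcard : Fintype.card K = multiplesCard t H := by
    rw [multiplesCard, Nat.card_eq_fintype_card]
  let g : ι → K := fun i => (nsmulAddMonoidHom t : H →+ H).rangeRestrict (u i)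
  let r : ι → AddChar K ℂ := fun j => charRestrict K (ψ j)
  have hweight : 1 / (2 * M : ℝ) ≤
      ‖∑ χ, (pushWeight I r χ : ℂ) * weightFourier (pushWeight I g) χ‖ := by
    rw [sum_pushWeight_mul]
    simp only [weightFourier, sum_pushWeight_mul]
    rw [← Finset.sum_div, div_div, norm_div, ← Nat.cast_mul, Complex.norm_natCast,
      le_div_iff₀ (by rw [Nat.cast_mul]; positivity)]
    refine le_trans (le_of_eq ?_) hbias
    rw [Nat.cast_mul]
    ring
  obtain ⟨Hs, x₀, χ₀, hp, hq⟩ := hcost K (fun x => Subtype.ext (hH x)) (by rwa [hKcard])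
    (pushWeight I g) (pushWeight I r) (fun x => div_nonneg (Nat.cast_nonneg _) (Nat.cast_nonneg _))
    (sum_pushWeight g hIne) (fun x => div_nonneg (Nat.cast_nonneg _) (Nat.cast_nonneg _))
    (sum_pushWeight r hIne) hweight
  rw [cosetMass_pushWeight, le_div_iff₀ hIpos, hKcard] at hp hq
  have hprod := card_mul_card_charAnnihilator_le Hs
  rw [Nat.card_eq_fintype_card (α := K), hKcard] at hprod
  have hsmall : ∀ (f : ℕ → ℕ), (∀ s, f s ≤ multiplesCard s H) → f t ^ 2 ≤ multiplesCard t H →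
      ∑ s ∈ Finset.range M, f s < N := by
    intro f hf hft2
    rw [← hN]
    refine Finset.sum_lt_sum (fun s _ => hf s) ⟨t, Finset.mem_range.2 ht, ?_⟩
    by_contra! hcon
    nlinarith
  -- The two orders multiply to at most `|tH|`, so the smaller is at most its square root. A small
  -- annihilator restricts the elements; a small `Hs` restricts the characters, via the dual
  -- matching.
  rcases le_total (Nat.card (charAnnihilator Hs)) (Nat.card Hs) with hcase | hcase
  · set H₁ := (charAnnihilator Hs).comap (nsmulAddMonoidHom t : H →+ H).rangeRestrict
    have hsq : multiplesCard t H₁ ^ 2 ≤ multiplesCard t H := by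
      rw [sq]
      exact (Nat.mul_le_mul ((multiplesCard_comap_le t _).trans hcase)
        (multiplesCard_comap_le t _)).trans hprod
    have hle : ∀ s, multiplesCard s H₁ ≤ multiplesCard s H :=
      fun s => multiplesCard_subgroup_le s H₁
    refine hmatch.log_card_le_of_restrict hM hH hIne hmono hstep
      (f := fun s => multiplesCard s H) ht hft H₁ hle hsq (Finset.filter_subset _ _) ?_ hp
      fun A' u' ψ' ζ' => ihN _ (hsmall _ hle hsq) H₁ (fun x => Subtype.ext (hH x)) rfl A' u' ψ' ζ'
    intro i hi j hj
    have h1 := (charAnnihilator Hs).sub_mem (Finset.mem_filter.1 hi).2 (Finset.mem_filter.1 hj).2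
    rw [sub_sub_sub_cancel_right] at h1
    rw [AddSubgroup.mem_comap, map_sub]
    exact h1
  · have hG : ∀ χ : AddChar H ℂ, M • χ = 0 := fun χ => by
      ext x
      rw [AddChar.nsmul_apply, ← AddChar.map_nsmul_eq_pow, hH, AddChar.map_zero_eq_one,
        AddChar.zero_apply]
    set H₁ := Hs.comap (charRestrict K)
    have hsq : multiplesCard t H₁ ^ 2 ≤ multiplesCard t H := by
      rw [sq]
      exact (Nat.mul_le_mul (multiplesCard_comap_charRestrict_le t _)
        ((multiplesCard_comap_charRestrict_le t _).trans hcase)).trans hprod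
    have hle : ∀ s, multiplesCard s H₁ ≤ multiplesCard s H :=
      fun s => (multiplesCard_subgroup_le s H₁).trans (multiplesCard_addChar_le s)
    refine hmatch.dual.log_card_le_of_restrict hM hG hIne hmono hstep
      (f := fun s => multiplesCard s H) ht hft H₁ hle hsq (Finset.filter_subset _ _) ?_ hq
      fun A' u' ψ' ζ' => ihN _ (hsmall _ hle hsq) H₁ (fun x => Subtype.ext (hG x)) rfl A' u' ψ' ζ'
    intro i hi j hj
    have h1 := Hs.sub_mem (Finset.mem_filter.1 hi).2 (Finset.mem_filter.1 hj).2
    rw [sub_sub_sub_cancel_right] at h1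
    rw [AddSubgroup.mem_comap, map_sub]
    exact h1

/-- Halving `x` lowers `x / s` by at least `x / (2s)`, which pays for the cost above the threshold,
and lowers `min x (s * 5 ^ s)` by at least `x / 2` below it. The term `4 * Real.log M` covers the
pigeonhole loss, using `x ≥ log 2 ≥ 1/2` below and `x / s ≥ 1` above. -/
theorem DualityCost.exists_potential {M s : ℕ} (hM : 0 < M) (hs : 0 < s) {C : ℝ} (hC : 0 ≤ C)
    {φ : ℝ → ℝ}
    (hφ : ∀ x, φ x = (2 * C + 2 + 4 * Real.log M) * (x / s + min x (s * 5 ^ s))) :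
    (∀ x y, 0 ≤ x → x ≤ y → φ x ≤ φ y) ∧ 0 ≤ φ 0 ∧
    ∀ x y, Real.log 2 ≤ x → 0 ≤ y → 2 * y ≤ x →
      (if x < s * 5 ^ s then x else C * (x / s)) + Real.log M + φ y ≤ φ x := by
  have hs0 : (0 : ℝ) < s := by exact_mod_cast hs
  have hlogM : 0 ≤ Real.log M := Real.log_nonneg (by exact_mod_cast hM)
  set D := 2 * C + 2 + 4 * Real.log M with hD
  set B : ℝ := s * 5 ^ s with hB
  have hB0 : 0 < B := by positivity
  have hD0 : 0 ≤ D := by positivity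
  have hmin : ∀ x y, x ≤ y → min x B ≤ min y B := fun x y h => min_le_min_right _ h
  refine ⟨fun x y _ hxy => ?_, ?_, fun x y hx hy hyx => ?_⟩
  · rw [hφ, hφ]
    have := hmin x y hxy
    gcongr
  · rw [hφ, min_eq_left hB0.le]; simp
  · rw [hφ, hφ]
    have hlog2 : (1 : ℝ) / 2 ≤ Real.log 2 := by have := Real.log_two_gt_d9; linarith
    have hdiv : 2 * (y / s) ≤ x / s := by
      rw [← mul_div_assoc]; gcongr
    split_ifs with hxB
    · rw [min_eq_left hxB.le, min_eq_left (by linarith : y ≤ B)]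
      have h1 : D * (x / 2) ≤ D * ((x / s + x) - (y / s + y)) := by
        refine mul_le_mul_of_nonneg_left ?_ hD0
        have : 0 ≤ y / s := by positivity
        linarith
      have h2 : x + Real.log M ≤ D * (x / 2) := by
        rw [hD]
        nlinarith [mul_nonneg hC (by linarith : (0 : ℝ) ≤ x)]
      linarith
    · have hxB' : B ≤ x := not_lt.1 hxB
      have h5 : (1 : ℝ) ≤ 5 ^ s := one_le_pow₀ (by norm_num)
      have hxs : 1 ≤ x / s := by
        rw [le_div_iff₀ hs0]
        nlinarith
      have h1 : D * (x / s / 2) ≤ D * ((x / s + min x B) - (y / s + min y B)) := by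
        refine mul_le_mul_of_nonneg_left ?_ hD0
        have := hmin y x (by linarith)
        linarith
      have h2 : C * (x / s) + Real.log M ≤ D * (x / s / 2) := by
        rw [hD]
        nlinarith
      linarith

/-! ### Weights as characters, and the conditional bound. -/

theorem hammingNorm_eq_sum_val {n : ℕ} (x : Fin n → ZMod 2) : hammingNorm x = ∑ l, (x l).val := by
  rw [hammingNorm, Finset.card_filter]
  refine Finset.sum_congr rfl fun i _ => ?_
  have : ∀ y : ZMod 2, (if y ≠ 0 then 1 else 0) = y.val := by decide
  exact this _

theorem val_add_zmod_two (a b : ZMod 2) :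
    ((a + b).val : ℤ) = (1 - 2 * b.val) * a.val + b.val := by
  revert a b; decide

theorem hammingNorm_add_cast {n : ℕ} (R : Type*) [CommRing R] (x v : Fin n → ZMod 2) :
    (hammingNorm (x + v) : R) =
      ∑ l, (1 - 2 * ((v l).val : R)) * ((x l).val : R) + (hammingNorm v : R) := by
  rw [hammingNorm_eq_sum_val, hammingNorm_eq_sum_val, Nat.cast_sum, Nat.cast_sum,
    ← Finset.sum_add_distrib]
  refine Finset.sum_congr rfl fun l _ => ?_
  have := congrArg (Int.cast : ℤ → R) (val_add_zmod_two (x l) (v l))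
  push_cast at this
  exact this

/-- The additive character whose value at the lift of `x` depends on the weight of `x + v`. -/
noncomputable def weightChar {n : ℕ} (M : ℕ) [NeZero M] (v : Fin n → ZMod 2) :
    AddChar ((Fin n → ZMod M) × ZMod M) ℂ :=
  (ZMod.stdAddChar (N := M)).compAddMonoidHom <| AddMonoidHom.mk'
    (fun p : (Fin n → ZMod M) × ZMod M =>
      ∑ l, (1 - 2 * ((v l).val : ZMod M)) * p.1 l + (hammingNorm v : ZMod M) * p.2)
    (fun p q => by
      simp only [Prod.fst_add, Prod.snd_add, Pi.add_apply, mul_add, Finset.sum_add_distrib]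
      ring)

theorem weightChar_apply {n M : ℕ} [NeZero M] (x v : Fin n → ZMod 2) :
    weightChar M v (fun l => ((x l).val : ZMod M), 1) =
      ZMod.stdAddChar (hammingNorm (x + v) : ZMod M) := by
  rw [hammingNorm_add_cast]
  simp [weightChar]

/-- The character for `w` at the lift of `x₀ + v` encodes `|x₀ + v + w|` modulo `M`; isolation makes
it the value for `x₀` exactly when `v + w = 0`, that is `v = w`. The last coordinate, fixed to 1,
carries the constant `|w|`. -/
theorem IsolatedWeight.charMatching {n M : ℕ} [NeZero M] {x₀ : Fin n → ZMod 2}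
    {V : Submodule (ZMod 2) (Fin n → ZMod 2)} (h : IsolatedWeight M x₀ V) (I : Finset V) :
    CharMatching I (fun v : V => ((fun l => (((x₀ + v) l).val : ZMod M), 1) :
      (Fin n → ZMod M) × ZMod M)) (fun v => weightChar M v)
      (ZMod.stdAddChar (hammingNorm x₀ : ZMod M)) := by
  intro v _ w _
  have hchar : ∀ y : Fin n → ZMod 2, y + y = 0 := fun y => funext fun l => CharTwo.add_self_eq_zero (y l)
  rw [weightChar_apply, ZMod.injective_stdAddChar.eq_iff, ZMod.natCast_eq_natCast_iff, add_assoc]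
  constructor
  · intro hmod
    have h0 : (v : Fin n → ZMod 2) + w = 0 := h _ (V.add_mem v.2 w.2) hmod
    refine Subtype.ext ?_
    rw [eq_neg_of_add_eq_zero_left h0, neg_eq_iff_add_eq_zero, hchar]
  · rintro rfl
    rw [hchar, add_zero]

theorem IsolatedWeight.finrank_le_of_potential {n M : ℕ} (hM : 0 < M) {x₀ : Fin n → ZMod 2}
    {V : Submodule (ZMod 2) (Fin n → ZMod 2)} (h : IsolatedWeight M x₀ V) {cost φ : ℝ → ℝ}
    (hcost : DualityCost M cost) (hmono : ∀ x y, 0 ≤ x → x ≤ y → φ x ≤ φ y) (hφ0 : 0 ≤ φ 0)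
    (hstep : ∀ x y, Real.log 2 ≤ x → 0 ≤ y → 2 * y ≤ x → cost x + Real.log M + φ y ≤ φ x) :
    Module.finrank (ZMod 2) V * Real.log 2 ≤
      Real.log (2 * M) + M * φ ((n + 1) * Real.log M) := by
  classical
  have : NeZero M := ⟨hM.ne'⟩
  have h1 := hcost.log_card_le hM hmono hφ0 hstep _ ((Fin n → ZMod M) × ZMod M)
    (fun x => by ext <;> simp) rfl Finset.univ _ _ _ (h.charMatching Finset.univ)
  rw [Finset.card_univ, Module.card_eq_pow_finrank (K := ZMod 2), ZMod.card, Nat.cast_pow,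
    Real.log_pow] at h1
  refine h1.trans (add_le_add le_rfl ?_)
  refine (Finset.sum_le_card_nsmul _ _ (φ ((n + 1) * Real.log M)) fun t _ => ?_).trans
    (by rw [Finset.card_range, nsmul_eq_mul])
  refine hmono _ _ (Real.log_natCast_nonneg _) ?_
  have hpos : 0 < multiplesCard t ((Fin n → ZMod M) × ZMod M) := Nat.card_pos
  have hle : multiplesCard t ((Fin n → ZMod M) × ZMod M) ≤ M ^ (n + 1) := by
    refine (Nat.card_le_card_of_injective _ Subtype.val_injective).trans (le_of_eq ?_)
    simp [pow_succ]
  calc Real.log (multiplesCard t ((Fin n → ZMod M) × ZMod M))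
      ≤ Real.log ((M : ℝ) ^ (n + 1)) :=
        Real.log_le_log (by exact_mod_cast hpos) (by exact_mod_cast hle)
    _ = _ := by rw [Real.log_pow]; push_cast; ring

theorem PFRConjectureOver.exists_finrank_le {M : ℕ} (hM : 0 < M) (hPFR : PFRConjectureOver M) :
    ∃ c : ℝ, 0 < c ∧ ∀ n : ℕ, 2 ≤ n → ∀ (x₀ : Fin n → ZMod 2)
      (V : Submodule (ZMod 2) (Fin n → ZMod 2)), IsolatedWeight M x₀ V →
      (Module.finrank (ZMod 2) V : ℝ) ≤ c * ((n : ℝ) / Real.log n) := by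
  obtain ⟨C, hC, hcost⟩ := hPFR.exists_dualityCost hM
  have hM1 : (1 : ℝ) ≤ M := by exact_mod_cast hM
  have hlogM : 0 ≤ Real.log M := Real.log_nonneg hM1
  have hlogM2 : 0 ≤ Real.log (2 * M) := Real.log_nonneg (by linarith)
  have hlog2 : 0 < Real.log 2 := Real.log_pos one_lt_two
  have hlog25 : 0 < Real.log 25 := Real.log_pos (by norm_num)
  set D := 2 * C + 2 + 4 * Real.log M with hD
  have hD0 : 0 ≤ D := by positivity
  set E := Real.log (2 * M) + M * (D * (2 * Real.log M + 1)) with hE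
  have hE0 : 0 ≤ E := by positivity
  refine ⟨Real.log 25 + E * (2 * Real.log 25) / Real.log 2, by positivity,
    fun n hn x₀ V hV => ?_⟩
  have hn0 : (0 : ℝ) < n := by exact_mod_cast (by omega : 0 < n)
  have hlogn : 0 < Real.log n := Real.log_pos (by exact_mod_cast hn)
  have hq : 0 ≤ (n : ℝ) / Real.log n := by positivity
  rw [add_mul]
  rcases lt_or_ge n 25 with hn25 | hn25
  · have h1 : (Module.finrank (ZMod 2) V : ℝ) ≤ n := by
      exact_mod_cast (by simpa using Submodule.finrank_le V)
    have h2 : Real.log n ≤ Real.log 25 := Real.log_le_log hn0 (by exact_mod_cast hn25.le)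
    have h3 : (n : ℝ) ≤ Real.log 25 * (n / Real.log n) := by
      rw [← mul_div_assoc, le_div_iff₀ hlogn, mul_comm]
      gcongr
    have h4 : 0 ≤ E * (2 * Real.log 25) / Real.log 2 * (n / Real.log n) := by positivity
    linarith
  -- Base 25 balances the two terms of the potential: `s² 5 ^ s ≤ 25 ^ s ≤ n` gives `s 5 ^ s ≤ n /
  -- s`, and `s` is of order `log n`. For `n < 25` the trivial bound `dim V ≤ n` was enough.
  · set s := Nat.log 25 n with hs
    have hs1 : 0 < s := Nat.log_pos (by norm_num) hn25
    have hs0 : (0 : ℝ) < s := by exact_mod_cast hs1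
    have hpow : 25 ^ s ≤ n := Nat.pow_log_le_self 25 (by omega)
    have hlt : n < 25 ^ (s + 1) := Nat.lt_pow_succ_log_self (by norm_num) n
    have hss : s * s ≤ 5 ^ s := by
      have h1 : s ≤ 2 ^ s := Nat.lt_two_pow_self.le
      calc s * s ≤ 2 ^ s * 2 ^ s := Nat.mul_le_mul h1 h1
        _ = 4 ^ s := (mul_pow 2 2 s).symm
        _ ≤ 5 ^ s := Nat.pow_le_pow_left (by norm_num) s
    have hsn : s * 5 ^ s * s ≤ n := by
      calc s * 5 ^ s * s = s * s * 5 ^ s := by ring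
        _ ≤ 5 ^ s * 5 ^ s := Nat.mul_le_mul_right _ hss
        _ = 25 ^ s := (mul_pow 5 5 s).symm
        _ ≤ n := hpow
    have hB : (s : ℝ) * 5 ^ s ≤ n / s := by
      rw [le_div_iff₀ hs0]; exact_mod_cast hsn
    have hone : 1 ≤ (n : ℝ) / s := by
      rw [le_div_iff₀ hs0, one_mul]
      exact_mod_cast Nat.log_le_self 25 n
    have hlogs : Real.log n ≤ 2 * Real.log 25 * s := by
      have h1 : Real.log n ≤ Real.log ((25 : ℝ) ^ (s + 1)) :=
        Real.log_le_log hn0 (by exact_mod_cast hlt.le)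
      rw [Real.log_pow] at h1
      have h2 : (1 : ℝ) ≤ s := by exact_mod_cast hs1
      push_cast at h1
      nlinarith
    have hns : (n : ℝ) / s ≤ 2 * Real.log 25 * (n / Real.log n) := by
      rw [← mul_div_assoc, div_le_div_iff₀ hs0 hlogn]
      nlinarith
    set φ : ℝ → ℝ := fun x => D * (x / s + min x (s * 5 ^ s)) with hφ
    obtain ⟨hmono, hφ0, hstep⟩ :=
      DualityCost.exists_potential hM hs1 hC (φ := φ) (fun x => rfl)
    have hmain := hV.finrank_le_of_potential hM (hcost s hs1) hmono hφ0 hstep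
    have hφn : φ ((n + 1) * Real.log M) ≤ D * (2 * Real.log M + 1) * (n / s) := by
      rw [hφ, mul_assoc D]
      refine mul_le_mul_of_nonneg_left ?_ hD0
      have h1 : ((n : ℝ) + 1) * Real.log M / s ≤ 2 * Real.log M * (n / s) := by
        rw [← mul_div_assoc, div_le_div_iff_of_pos_right hs0]
        have : (1 : ℝ) ≤ n := by exact_mod_cast (by omega : 1 ≤ n)
        nlinarith
      have h2 : min (((n : ℝ) + 1) * Real.log M) (s * 5 ^ s) ≤ n / s := (min_le_right _ _).trans hB
      linarith
    have h5 : Module.finrank (ZMod 2) V * Real.log 2 ≤ E * (n / s) := by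
      refine hmain.trans ?_
      rw [hE, add_mul (Real.log (2 * M))]
      refine add_le_add (le_mul_of_one_le_right hlogM2 hone) ?_
      rw [mul_assoc (M : ℝ)]
      gcongr
    have h6 : (Module.finrank (ZMod 2) V : ℝ) ≤
        E * (2 * Real.log 25) / Real.log 2 * (n / Real.log n) := by
      rw [div_mul_eq_mul_div, le_div_iff₀ hlog2]
      refine h5.trans ?_
      rw [mul_assoc]
      gcongr
    have : 0 ≤ Real.log 25 * ((n : ℝ) / Real.log n) := by positivity
    linarith

theorem mainTheorem6 :
    -- `M` a power of `2`
    (∀ n M : ℕ, 0 < n → (∃ k : ℕ, M = 2 ^ k) →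
      (maxUniqueWeightModDim n M : ℝ) ≤ (M : ℝ) - 1) ∧
    -- `M` an odd prime power
    (∀ n M : ℕ, 0 < n → Odd M → IsPrimePow M →
      (maxUniqueWeightModDim n M : ℝ) ≤ ((M : ℝ) - 1) * Real.logb 2 ((n : ℝ) + 1)) ∧
    -- `M = 2 M'` with `M'` an odd prime power
    (∀ n M' : ℕ, 0 < n → Odd M' → IsPrimePow M' →
      (maxUniqueWeightModDim n (2 * M') : ℝ) ≤
        1 + ((M' : ℝ) - 1) * Real.logb 2 ((n : ℝ) + 1)) ∧
    -- `M = 2 ^ ℓ * M'` with `ℓ ≥ 2` and `M'` an odd prime power; the constant depends only on `ℓ`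
    (∀ ℓ : ℕ, 2 ≤ ℓ → ∃ C : ℝ, 0 < C ∧ ∀ n M' : ℕ, 2 ≤ n → Odd M' → IsPrimePow M' →
      (maxUniqueWeightModDim n (2 ^ ℓ * M') : ℝ) ≤
        C * ((M' : ℝ) * Real.log (n : ℝ)) ^ (2 ^ (ℓ - 1) - 1)) ∧
    -- every `M`, under the polynomial Freiman-Ruzsa conjecture; the constant depends only on `M`
    (PFRConjecture → ∀ M : ℕ, 0 < M → ∃ c : ℝ, 0 < c ∧ ∀ n : ℕ, 2 ≤ n →
      (maxUniqueWeightModDim n M : ℝ) ≤ c * ((n : ℝ) / Real.log (n : ℝ))) := by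
  refine ⟨?_, ?_, ?_, ?_, ?_⟩
  · rintro n _ _ ⟨k, rfl⟩
    obtain ⟨x₀, V, hV, hd⟩ := exists_isolatedWeight (n := n) (M := 2 ^ k)
    have h1 : (1 : ℕ) ≤ 2 ^ k := Nat.one_le_two_pow
    rw [← hd, ← Nat.cast_one, ← Nat.cast_sub h1]
    exact_mod_cast hV.finrank_le_two_pow
  · intro n M _ _ hM
    obtain ⟨x₀, V, hV, hd⟩ := exists_isolatedWeight (n := n) (M := M)
    rw [← hd]
    exact hV.finrank_le_logb hM
  · intro n M _ hodd hM
    obtain ⟨x₀, V, hV, hd⟩ := exists_isolatedWeight (n := n) (M := 2 * M)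
    rw [← hd]
    exact hV.finrank_le_one_add_logb hodd hM
  · intro ℓ hℓ
    refine ⟨(1 + 2 ^ (ℓ - 1) * (ℓ * 2 ^ (ℓ - 1))) * 3 ^ (2 ^ (ℓ - 1) - 1), by positivity,
      fun n M hn hodd hM => ?_⟩
    obtain ⟨x₀, V, hV, hd⟩ := exists_isolatedWeight (n := n) (M := 2 ^ ℓ * M)
    rw [← hd]
    exact hV.finrank_le_two_pow_mul hn hℓ hodd hM
  · intro hPFR M hM
    obtain ⟨c, hc, hle⟩ := (hPFR M hM).exists_finrank_le hM
    refine ⟨c, hc, fun n hn => ?_⟩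
    obtain ⟨x₀, V, hV, hd⟩ := exists_isolatedWeight (n := n) (M := M)
    rw [← hd]
    exact hle n hn x₀ V hV
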